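/- Let $n\ge 1$ be an integer. For Schwartz functions $F_0,\dots,F_n:\mathbb{R}^n\to\mathbb{C}$ and $0<r<R$, let \[ \Lambda_{n,r,R} := \int_{\{x\in\mathbb{R}^{n+1}\,:\, r\le |x_0+\dots+x_n|\le R\}} \ \prod_{i=0}^{n} F_i(x_0,\dots,x_{i-1},x_{i+1},\dots,x_n)\,\frac{1}{x_0+\dots+x_n}\,dx_0\cdots dx_n \] denote the truncated simplex Hilbert transform of degree $n$. There exists a finite constant $C$, depending only on $n$, such that for all Schwartz functions $F_0,\dots,F_n$ on $\mathbb{R}^n$ and all real numbers $0<r<R$ the integral defining $\Lambda_{n,r,R}$ converges absolutely and \[ |\Lambda_{n,r,R}| \le C\Big(\log\frac{R}{r}\Big)^{1-2^{-n+1}}\, \|F_0\|_{L^{2^n}(\mathbb{R}^n)}\, \prod_{i=1}^{n}\|F_i\|_{L^{2^{n-i+1}}(\mathbb{R}^n)} . \] -/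

import Mathlib

open MeasureTheory
open scoped SchwartzMap

noncomputable section

/-- The truncation region `{x ∈ ℝ^{n+1} : r ≤ |x_0 + ⋯ + x_n| ≤ R}`. -/
def truncationRegion (n : ℕ) (r R : ℝ) : Set (Fin (n + 1) → ℝ) :=
  {x | r ≤ |∑ i, x i| ∧ |∑ i, x i| ≤ R}

/-- The integrand
`∏_{i=0}^n F_i(x_0, …, x_{i-1}, x_{i+1}, …, x_n) · 1 / (x_0 + ⋯ + x_n)`. -/
def simplexIntegrand {n : ℕ} (F : Fin (n + 1) → 𝓢(Fin n → ℝ, ℂ))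
    (x : Fin (n + 1) → ℝ) : ℂ :=
  (∏ i, F i (i.removeNth x)) * (1 / ((∑ i, x i : ℝ) : ℂ))

/-- The truncated simplex Hilbert transform `Λ_{n,r,R}` of degree `n`, as a form in the
`n + 1` Schwartz functions `F_0, …, F_n` on `ℝ^n`; the integral is with respect to Lebesgue
measure on `ℝ^{n+1}`. -/
def truncatedSimplexHilbert {n : ℕ} (r R : ℝ) (F : Fin (n + 1) → 𝓢(Fin n → ℝ, ℂ)) : ℂ :=
  ∫ x in truncationRegion n r R, simplexIntegrand F x

end

/-!
Everything is reduced to real functions in the unit balls of their Lebesgue spaces, and the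
truncated reciprocal is replaced by a superposition, over scales `r < s ≤ R` with respect to
`ds / s`, of the kernels `s ^ 3 * heat3 (s ^ 2) t`; the difference is dominated by Gaussians at the
two scales `r` and `R` (`abs_truncatedInv_sub_le`). A kernel which is integrable in
`x_0 + ⋯ + x_n` is harmless, because the product of the functions is bounded by a sum of their
powers, and each power can be integrated after the one variable that it misses
(`Normalized.admissible`). The same argument applies when some variables have been doubled, the
product is taken over all vertices of the resulting cubes (`cubeForm`), and there are Gaussian
weights in the side lengths of these cubes. The scales between `r` and `R` are responsible for the
logarithm, and the trivial bound would give its first power.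

The gain comes from an induction on the degree. Write the kernel at scale `s` as a convolution of
`s * heat1 (w * s ^ 2)` with a function dominated by a Gaussian; this is possible for second and
third derivatives of the heat kernel (`Cancelling`). The Cauchy–Schwarz inequality in all variables
except the last one removes the function that does not depend on it, doubles the last variable and
leaves the square of a convolution with `heat1`. That square is again a form, of degree one less and
with one more doubled variable, and its kernel is the `pairCubeKernel`
(`Cancelling.abs_cubeForm_le`, `Admissible.pairForm_eq`). Choosing a parameter in the arithmetic
mean inequality shows that a bound by the power `e` of the logarithm for the pair forms yields the
power `(1 + e) / 2` for the original form.

The pair forms are nonnegative, and the scale derivative of the form with a Gaussian kernel is a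
combination of pair forms, minus a multiple of the form with the profile `centreProfile`, which is
a second derivative of the heat kernel in the centre of the cube. By the fundamental theorem of
calculus the integral over scales of each pair form is then controlled by that of the form with
`centreProfile`, up to the Gaussian forms at the two end scales (`Admissible.integral_pairForm_le`).
As `centreProfile` is cancelling, the induction continues in the lower degree (`profileBound`). In
degree zero the form with `centreProfile` vanishes. In degree one both functions can be given a
derivative of the heat kernel, and the exponent starts at `0` (`Cancelling.abs_cubeForm_one_le`);
hence `1 - 2 ^ (-n + 1)` in degree `n`.
-/

/-! ### The heat kernel on the line -/

/-- The centred Gaussian density of variance `v`. -/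
noncomputable def heat (v t : ℝ) : ℝ := (√(2 * Real.pi * v))⁻¹ * Real.exp (-t ^ 2 / (2 * v))

/-- The first spatial derivative of `heat v`. -/
noncomputable def heat1 (v t : ℝ) : ℝ := -(t / v) * heat v t

/-- The second spatial derivative of `heat v`. -/
noncomputable def heat2 (v t : ℝ) : ℝ := (t ^ 2 / v ^ 2 - 1 / v) * heat v t

/-- The third spatial derivative of `heat v`. -/
noncomputable def heat3 (v t : ℝ) : ℝ := (3 * t / v ^ 2 - t ^ 3 / v ^ 3) * heat v t

lemma heat_nonneg (v t : ℝ) : 0 ≤ heat v t := by unfold heat; positivity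

@[fun_prop]
lemma Measurable.heat {α : Type*} [MeasurableSpace α] {f g : α → ℝ} (hf : Measurable f)
    (hg : Measurable g) : Measurable fun x => heat (f x) (g x) := by
  unfold _root_.heat; fun_prop

@[fun_prop]
lemma Measurable.heat1 {α : Type*} [MeasurableSpace α] {f g : α → ℝ} (hf : Measurable f)
    (hg : Measurable g) : Measurable fun x => heat1 (f x) (g x) := by
  unfold _root_.heat1; fun_prop

@[fun_prop]
lemma Measurable.heat2 {α : Type*} [MeasurableSpace α] {f g : α → ℝ} (hf : Measurable f)
    (hg : Measurable g) : Measurable fun x => heat2 (f x) (g x) := by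
  unfold _root_.heat2; fun_prop

@[fun_prop]
lemma Measurable.heat3 {α : Type*} [MeasurableSpace α] {f g : α → ℝ} (hf : Measurable f)
    (hg : Measurable g) : Measurable fun x => heat3 (f x) (g x) := by
  unfold _root_.heat3; fun_prop

lemma heat_neg (v t : ℝ) : heat v (-t) = heat v t := by simp [heat]

lemma heat_eq_gaussianPDFReal {v : ℝ} (hv : 0 < v) :
    heat v = ProbabilityTheory.gaussianPDFReal 0 v.toNNReal := by
  ext t; simp [heat, ProbabilityTheory.gaussianPDFReal, hv.le]

lemma integrable_pow_mul_heat {v : ℝ} (hv : 0 < v) (n : ℕ) :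
    Integrable fun t => t ^ n * heat v t := by
  have h := integrable_rpow_mul_exp_neg_mul_sq (b := (2 * v)⁻¹) (by positivity)
    (s := (n : ℝ)) (by have : (0:ℝ) ≤ n := n.cast_nonneg
                       linarith)
  refine (h.const_mul (√(2 * Real.pi * v))⁻¹).congr (Filter.Eventually.of_forall fun t => ?_)
  simp only [heat, Real.rpow_natCast]
  rw [show -(2 * v)⁻¹ * t ^ 2 = -t ^ 2 / (2 * v) by ring]
  ring

lemma integrable_heat {v : ℝ} (hv : 0 < v) : Integrable (heat v) := by
  simpa using integrable_pow_mul_heat hv 0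

lemma integral_heat {v : ℝ} (hv : 0 < v) : ∫ t, heat v t = 1 := by
  rw [heat_eq_gaussianPDFReal hv]
  exact ProbabilityTheory.integral_gaussianPDFReal_eq_one 0
    (by simpa using hv)

lemma lintegral_heat {v : ℝ} (hv : 0 < v) : ∫⁻ t, ENNReal.ofReal (heat v t) = 1 := by
  rw [← ofReal_integral_eq_lintegral_ofReal (integrable_heat hv)
    (Filter.Eventually.of_forall fun t => heat_nonneg v t), integral_heat hv, ENNReal.ofReal_one]

lemma integral_odd_pow_mul_heat (v : ℝ) {n : ℕ} (hn : Odd n) :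
    ∫ t, t ^ n * heat v t = 0 := by
  have h := integral_neg_eq_self (fun t : ℝ => t ^ n * heat v t) volume
  simp only [heat_neg, hn.neg_pow, neg_mul, integral_neg] at h
  linarith

lemma integral_sq_mul_heat {v : ℝ} (hv : 0 < v) : ∫ t, t ^ 2 * heat v t = v := by
  have hv' : (v.toNNReal : NNReal) ≠ 0 := by simpa using hv
  have h := ProbabilityTheory.variance_fun_id_gaussianReal (μ := 0) (v := v.toNNReal)
  rw [ProbabilityTheory.variance_eq_integral (by fun_prop),
    ProbabilityTheory.integral_id_gaussianReal,
    ProbabilityTheory.integral_gaussianReal_eq_integral_smul hv'] at h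
  rw [heat_eq_gaussianPDFReal hv]
  simpa [mul_comm, hv.le] using h

/-- The moments of a Gaussian up to order three. -/
lemma integral_cubic_mul_heat {v : ℝ} (hv : 0 < v) (m p₀ p₁ p₂ p₃ : ℝ) :
    ∫ t, (p₀ + p₁ * (t - m) + p₂ * (t - m) ^ 2 + p₃ * (t - m) ^ 3) * heat v (t - m)
      = p₀ + p₂ * v := by
  rw [integral_sub_right_eq_self
    (fun t => (p₀ + p₁ * t + p₂ * t ^ 2 + p₃ * t ^ 3) * heat v t) m]
  have i0 := (integrable_pow_mul_heat hv 0).const_mul p₀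
  have i1 := (integrable_pow_mul_heat hv 1).const_mul p₁
  have i2 := (integrable_pow_mul_heat hv 2).const_mul p₂
  have i3 := (integrable_pow_mul_heat hv 3).const_mul p₃
  have e : (fun t => (p₀ + p₁ * t + p₂ * t ^ 2 + p₃ * t ^ 3) * heat v t) =
      fun t => p₀ * (t ^ 0 * heat v t) + p₁ * (t ^ 1 * heat v t) + p₂ * (t ^ 2 * heat v t)
        + p₃ * (t ^ 3 * heat v t) := by ext t; ring
  rw [e, integral_add (by exact (i0.add i1).add i2) i3,
    integral_add (by exact i0.add i1) i2, integral_add i0 i1]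
  simp only [integral_const_mul]
  rw [integral_sq_mul_heat hv, integral_odd_pow_mul_heat v (by decide : Odd 1),
    integral_odd_pow_mul_heat v (by decide : Odd 3)]
  simp [integral_heat hv]

lemma heat_mul_heat {ρ w : ℝ} (hρ : 0 < ρ) (hw : 0 < w) (u c v : ℝ) :
    heat ρ (u - v) * heat w (v + c) =
      heat (ρ + w) (u + c) * heat (ρ * w / (ρ + w)) (v - (w * u - ρ * c) / (ρ + w)) := by
  have h0 : 0 < ρ + w := by positivity
  have hp := Real.pi_pos
  unfold heat
  have e : √(2 * Real.pi * ρ) * √(2 * Real.pi * w) =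
      √(2 * Real.pi * (ρ + w)) * √(2 * Real.pi * (ρ * w / (ρ + w))) := by
    rw [← Real.sqrt_mul (by positivity), ← Real.sqrt_mul (by positivity)]
    congr 1; field_simp
  have e2 : -(u - v) ^ 2 / (2 * ρ) + -(v + c) ^ 2 / (2 * w) = -(u + c) ^ 2 / (2 * (ρ + w)) +
      -(v - (w * u - ρ * c) / (ρ + w)) ^ 2 / (2 * (ρ * w / (ρ + w))) := by
    field_simp; ring
  rw [mul_mul_mul_comm, ← Real.exp_add, e2, ← mul_inv, e, mul_inv, Real.exp_add]
  ring

/-- A cubic polynomial integrated against a product of two translated Gaussians; the polynomial is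
expanded around the centre of the product. -/
lemma integral_cubic_mul_heat_mul_heat {ρ w : ℝ} (hρ : 0 < ρ) (hw : 0 < w) (u c : ℝ)
    (f : ℝ → ℝ) (p₀ p₁ p₂ p₃ : ℝ)
    (hf : ∀ v, f v = (p₀ + p₁ * (v - (w * u - ρ * c) / (ρ + w)) +
      p₂ * (v - (w * u - ρ * c) / (ρ + w)) ^ 2 + p₃ * (v - (w * u - ρ * c) / (ρ + w)) ^ 3) *
      (heat ρ (u - v) * heat w (v + c))) :
    ∫ v, f v = (p₀ + p₂ * (ρ * w / (ρ + w))) * heat (ρ + w) (u + c) := by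
  have h0 : 0 < ρ * w / (ρ + w) := by positivity
  rw [← integral_cubic_mul_heat h0 ((w * u - ρ * c) / (ρ + w)) p₀ p₁ p₂ p₃, ← integral_mul_const]
  congr 1; ext v; rw [hf, heat_mul_heat hρ hw]; ring

lemma integral_heat_mul_heat {ρ w : ℝ} (hρ : 0 < ρ) (hw : 0 < w) (u c : ℝ) :
    ∫ v, heat ρ (u - v) * heat w (v + c) = heat (ρ + w) (u + c) := by
  rw [integral_cubic_mul_heat_mul_heat hρ hw u c _ 1 0 0 0 (fun v => by ring)]; ring

lemma integral_heat1_mul_heat {ρ w : ℝ} (hρ : 0 < ρ) (hw : 0 < w) (u c : ℝ) :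
    ∫ v, heat1 ρ (u - v) * heat w (v + c) = heat1 (ρ + w) (u + c) := by
  have h0 : 0 < ρ + w := by positivity
  rw [integral_cubic_mul_heat_mul_heat hρ hw u c _ (-(u + c) / (ρ + w)) (1 / ρ) 0 0]
  · simp only [heat1]; ring
  · intro v; simp only [heat1]; rw [← mul_assoc]; congr 2; field_simp; ring

lemma integral_heat1_mul_heat1 {ρ w : ℝ} (hρ : 0 < ρ) (hw : 0 < w) (u c : ℝ) :
    ∫ v, heat1 ρ (u - v) * heat1 w (v + c) = heat2 (ρ + w) (u + c) := by
  have h0 : 0 < ρ + w := by positivity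
  rw [integral_cubic_mul_heat_mul_heat hρ hw u c _ ((u + c) ^ 2 / (ρ + w) ^ 2)
    ((u + c) / (ρ + w) * (1 / w - 1 / ρ)) (-1 / (ρ * w)) 0]
  · simp only [heat2]; field_simp; ring
  · intro v; simp only [heat1]; rw [mul_mul_mul_comm]; congr 1; field_simp; ring

lemma integral_heat1_mul_heat2 {ρ w : ℝ} (hρ : 0 < ρ) (hw : 0 < w) (u c : ℝ) :
    ∫ v, heat1 ρ (u - v) * heat2 w (v + c) = heat3 (ρ + w) (u + c) := by
  have h0 : 0 < ρ + w := by positivity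
  -- with `S = (u + c) / (ρ + w)` and `y` the distance to the centre, the polynomial is
  -- `-(S - y / ρ) * ((S + y / w) ^ 2 - 1 / w)`
  rw [integral_cubic_mul_heat_mul_heat hρ hw u c _
    (-((u + c) / (ρ + w)) ^ 3 + ((u + c) / (ρ + w)) / w)
    (((u + c) / (ρ + w)) ^ 2 * (1 / ρ - 2 / w) - 1 / (ρ * w))
    (((u + c) / (ρ + w)) * (2 / (ρ * w) - 1 / w ^ 2)) (1 / (ρ * w ^ 2))]
  · simp only [heat3]; field_simp; ring
  · intro v; simp only [heat1, heat2]; rw [mul_mul_mul_comm]; congr 1; field_simp; ring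

/-- The mixed second derivative `∂_t ∂_{t'}` of `heat A (u + (t + t') / 2) * heat B (t - t')`,
as a function of `z = u + (t + t') / 2` and `d = t - t'`. -/
noncomputable def pairKernel (A B z d : ℝ) : ℝ := heat2 A z * heat B d / 4 - heat A z * heat2 B d

lemma heat_mul_heat_add {w : ℝ} (hw : 0 < w) (t t' v : ℝ) :
    heat w (t + v) * heat w (t' + v) = heat (2 * w) (t - t') * heat (w / 2) (v + (t + t') / 2) := by
  have hp := Real.pi_pos
  unfold heat
  have e : √(2 * Real.pi * w) * √(2 * Real.pi * w) =
      √(2 * Real.pi * (2 * w)) * √(2 * Real.pi * (w / 2)) := by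
    rw [← Real.sqrt_mul (by positivity), ← Real.sqrt_mul (by positivity)]
    congr 1; field_simp
  have e2 : -(t + v) ^ 2 / (2 * w) + -(t' + v) ^ 2 / (2 * w) = -(t - t') ^ 2 / (2 * (2 * w)) +
      -(v + (t + t') / 2) ^ 2 / (2 * (w / 2)) := by
    field_simp; ring
  rw [mul_mul_mul_comm, ← Real.exp_add, e2, ← mul_inv, e, mul_inv, Real.exp_add]
  ring

lemma integral_heat_mul_pair {ρ w : ℝ} (hρ : 0 < ρ) (hw : 0 < w) (u t t' : ℝ) :
    ∫ v, heat ρ (u - v) * (heat w (t + v) * heat w (t' + v)) =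
      heat (ρ + w / 2) (u + (t + t') / 2) * heat (2 * w) (t - t') := by
  simp only [heat_mul_heat_add hw, mul_left_comm _ (heat (2 * w) _)]
  rw [integral_const_mul, integral_heat_mul_heat hρ (by positivity)]
  ring

/-- The pair kernel is a superposition of products `heat1 w (t + v) * heat1 w (t' + v)` with
positive coefficients; this makes the associated forms nonnegative. -/
lemma integral_heat_mul_heat1_pair {ρ w : ℝ} (hρ : 0 < ρ) (hw : 0 < w) (u t t' : ℝ) :
    ∫ v, heat ρ (u - v) * (heat1 w (t + v) * heat1 w (t' + v)) =
      pairKernel (ρ + w / 2) (2 * w) (u + (t + t') / 2) (t - t') := by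
  have hw2 : 0 < w / 2 := by positivity
  have h0 : 0 < ρ + w / 2 := by positivity
  set c := (t + t') / 2 with hc
  set S := (u + c) / (ρ + w / 2) with hS
  rw [integral_cubic_mul_heat_mul_heat hρ hw2 u c _
    (heat (2 * w) (t - t') / w ^ 2 * ((w / 2 * S) ^ 2 - (t - t') ^ 2 / 4))
    (heat (2 * w) (t - t') / w ^ 2 * (w * S)) (heat (2 * w) (t - t') / w ^ 2) 0]
  · simp only [pairKernel, heat2, hS]; field_simp; ring
  · intro v
    have e : heat1 w (t + v) * heat1 w (t' + v) = (1 / w ^ 2 * ((t + v) * (t' + v))) *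
        (heat (2 * w) (t - t') * heat (w / 2) (v + c)) := by
      rw [hc, ← heat_mul_heat_add hw]; simp only [heat1]; field_simp
    rw [e]
    have e3 : w / 2 * S + (v - (w / 2 * u - ρ * c) / (ρ + w / 2)) = v + c := by
      rw [hS]; field_simp; ring
    have e4 : (t + v) * (t' + v) = (v + c) ^ 2 - (t - t') ^ 2 / 4 := by rw [hc]; ring
    rw [e4, ← e3]; ring

lemma heat_pos {v : ℝ} (hv : 0 < v) (t : ℝ) : 0 < heat v t := by
  have := Real.pi_pos
  unfold heat; positivity

lemma heat_eq_exp_mul_heat_two_mul {v : ℝ} (hv : 0 < v) (t : ℝ) :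
    heat v t = √2 * Real.exp (-(t ^ 2 / v / 4)) * heat (2 * v) t := by
  have hp := Real.pi_pos
  have e : √(2 * Real.pi * (2 * v)) = √2 * √(2 * Real.pi * v) := by
    rw [← Real.sqrt_mul (by positivity)]; ring_nf
  have e2 : -t ^ 2 / (2 * v) = -(t ^ 2 / v / 4) + -t ^ 2 / (2 * (2 * v)) := by field_simp; ring
  unfold heat
  rw [e, e2, Real.exp_add]
  field_simp

lemma abs_heat1_le {v : ℝ} (hv : 0 < v) (t : ℝ) :
    |heat1 v t| ≤ √2 / √v * heat (2 * v) t := by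
  have hs : 0 < √v := Real.sqrt_pos.2 hv
  have hy : t ^ 2 / v = (|t| / √v) ^ 2 := by rw [div_pow, Real.sq_sqrt hv.le, sq_abs]
  have key : |t| / √v * Real.exp (-(t ^ 2 / v / 4)) ≤ 1 := by
    rw [Real.exp_neg, ← div_eq_mul_inv, div_le_one (Real.exp_pos _), hy]
    have := Real.add_one_le_exp ((|t| / √v) ^ 2 / 4)
    nlinarith [sq_nonneg (|t| / √v / 2 - 1)]
  rw [heat1, heat_eq_exp_mul_heat_two_mul hv, abs_mul, abs_neg, abs_div, abs_of_pos hv,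
    abs_of_nonneg (mul_nonneg (by positivity) (heat_nonneg _ _))]
  calc |t| / v * (√2 * Real.exp (-(t ^ 2 / v / 4)) * heat (2 * v) t)
      = (|t| / √v * Real.exp (-(t ^ 2 / v / 4))) * (√2 / √v * heat (2 * v) t) := by
        nth_rw 1 [← Real.mul_self_sqrt hv.le]; field_simp
    _ ≤ 1 * (√2 / √v * heat (2 * v) t) :=
        mul_le_mul_of_nonneg_right key (mul_nonneg (by positivity) (heat_nonneg _ _))
    _ = _ := one_mul _

lemma abs_heat2_le {v : ℝ} (hv : 0 < v) (t : ℝ) :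
    |heat2 v t| ≤ 4 * √2 / v * heat (2 * v) t := by
  have key : |t ^ 2 / v - 1| * Real.exp (-(t ^ 2 / v / 4)) ≤ 4 := by
    have h0 : 0 ≤ t ^ 2 / v := by positivity
    rw [Real.exp_neg, ← div_eq_mul_inv, div_le_iff₀ (Real.exp_pos _), abs_le]
    have := Real.add_one_le_exp (t ^ 2 / v / 4)
    constructor <;> linarith
  rw [heat2, heat_eq_exp_mul_heat_two_mul hv, abs_mul,
    abs_of_nonneg (a := √2 * _ * _) (mul_nonneg (by positivity) (heat_nonneg _ _))]
  have e : |t ^ 2 / v ^ 2 - 1 / v| = |t ^ 2 / v - 1| / v := by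
    rw [← abs_of_pos hv, ← abs_div, abs_of_pos hv]; congr 1; field_simp
  rw [e]
  calc |t ^ 2 / v - 1| / v * (√2 * Real.exp (-(t ^ 2 / v / 4)) * heat (2 * v) t)
      = (|t ^ 2 / v - 1| * Real.exp (-(t ^ 2 / v / 4))) * (√2 / v * heat (2 * v) t) := by ring
    _ ≤ 4 * (√2 / v * heat (2 * v) t) :=
        mul_le_mul_of_nonneg_right key (mul_nonneg (by positivity) (heat_nonneg _ _))
    _ = _ := by ring

lemma abs_mul_heat1_le {w s : ℝ} (hw : 0 < w) (hs : 0 < s) (t : ℝ) :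
    |s * heat1 (w * s ^ 2) t| ≤ √2 / √w * heat (2 * (w * s ^ 2)) t := by
  rw [abs_mul, abs_of_pos hs]
  refine (mul_le_mul_of_nonneg_left (abs_heat1_le (by positivity) t) hs.le).trans_eq ?_
  rw [Real.sqrt_mul hw.le, Real.sqrt_sq hs.le]
  have : 0 < √w := Real.sqrt_pos.2 hw
  field_simp

lemma abs_sq_mul_heat2_le {w s : ℝ} (hw : 0 < w) (hs : 0 < s) (t : ℝ) :
    |s ^ 2 * heat2 (w * s ^ 2) t| ≤ 4 * √2 / w * heat (2 * (w * s ^ 2)) t := by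
  rw [abs_mul, abs_of_pos (by positivity : 0 < s ^ 2)]
  refine (mul_le_mul_of_nonneg_left (abs_heat2_le (by positivity) t) (by positivity)).trans_eq ?_
  field_simp

lemma hasDerivAt_heat {v : ℝ} (hv : 0 < v) (t : ℝ) :
    HasDerivAt (fun v => heat v t) (heat2 v t / 2) v := by
  have hp := Real.pi_pos
  have h1 : HasDerivAt (fun v : ℝ => (√(2 * Real.pi * v))⁻¹)
      (-(2 * Real.pi * 1 / (2 * √(2 * Real.pi * v))) / √(2 * Real.pi * v) ^ 2) v :=
    (((hasDerivAt_id v).const_mul (2 * Real.pi)).sqrt (by simp; positivity)).inv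
      (by positivity)
  have h2 : HasDerivAt (fun v : ℝ => Real.exp (-t ^ 2 / (2 * v)))
      (Real.exp (-t ^ 2 / (2 * v)) * ((0 * (2 * v) - -t ^ 2 * (2 * 1)) / (2 * v) ^ 2)) v :=
    (((hasDerivAt_const v (-t ^ 2)).div ((hasDerivAt_id v).const_mul 2) (by simp; positivity))).exp
  refine (h1.mul h2).congr_deriv ?_
  have hq : √(2 * Real.pi * v) ^ 2 = 2 * Real.pi * v := Real.sq_sqrt (by positivity)
  have hq0 : 0 < √(2 * Real.pi * v) := by positivity
  simp only [heat2, heat]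
  rw [hq]
  field_simp
  ring

/-- The heat equation, in the scaling `v = a * s ^ 2`. -/
lemma hasDerivAt_heat_scale {a s : ℝ} (ha : 0 < a) (hs : 0 < s) (t : ℝ) :
    HasDerivAt (fun s => heat (a * s ^ 2) t) (s⁻¹ * (a * (s ^ 2 * heat2 (a * s ^ 2) t))) s := by
  have h := (hasDerivAt_heat (v := a * s ^ 2) (by positivity) t).comp s
    ((hasDerivAt_pow 2 s).const_mul a)
  refine h.congr_deriv ?_
  simp; field_simp

lemma lintegral_heat_mul_heat {ρ w : ℝ} (hρ : 0 < ρ) (hw : 0 < w) (u c : ℝ) :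
    ∫⁻ v, ENNReal.ofReal (heat ρ (u - v) * heat w (v + c)) =
      ENNReal.ofReal (heat (ρ + w) (u + c)) := by
  rw [← ofReal_integral_eq_lintegral_ofReal, integral_heat_mul_heat hρ hw]
  · refine Integrable.of_integral_ne_zero ?_
    rw [integral_heat_mul_heat hρ hw]
    exact (heat_pos (by positivity) _).ne'
  · exact Filter.Eventually.of_forall fun v => mul_nonneg (heat_nonneg _ _) (heat_nonneg _ _)

lemma lintegral_heat_mul_pair {ρ w : ℝ} (hρ : 0 < ρ) (hw : 0 < w) (u t t' : ℝ) :
    ∫⁻ v, ENNReal.ofReal (heat ρ (u - v) * (heat w (t + v) * heat w (t' + v))) =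
      ENNReal.ofReal (heat (ρ + w / 2) (u + (t + t') / 2) * heat (2 * w) (t - t')) := by
  rw [← ofReal_integral_eq_lintegral_ofReal, integral_heat_mul_pair hρ hw]
  · refine Integrable.of_integral_ne_zero ?_
    rw [integral_heat_mul_pair hρ hw]
    exact (mul_pos (heat_pos (by positivity) _) (heat_pos (by positivity) _)).ne'
  · exact Filter.Eventually.of_forall fun v => mul_nonneg (heat_nonneg _ _)
      (mul_nonneg (heat_nonneg _ _) (heat_nonneg _ _))

/-- A family of kernels `φ s`, `s > 0`, is cancelling at width `w` when each `φ s` is the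
convolution `g * κ * g` of a kernel `κ` dominated by a Gaussian of variance `2 * w * s ^ 2` with two
copies of the scaled derivative `g = s * heat1 (w * s ^ 2)`. -/
def Cancelling (w : ℝ) (φ : ℝ → ℝ → ℝ) : Prop :=
  ∃ (C : ℝ) (κ : ℝ → ℝ → ℝ), 0 ≤ C ∧ (∀ s, Measurable (κ s)) ∧ ∀ s, 0 < s →
    (∀ t, |κ s t| ≤ C * heat (2 * (w * s ^ 2)) t) ∧
    ∀ t u, φ s (t + u) = ∫ v, s * heat1 (w * s ^ 2) (t + v) *
      ∫ v', κ s (v' - v) * (s * heat1 (w * s ^ 2) (u - v'))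

lemma heat_le_heat_two_mul {v : ℝ} (hv : 0 < v) (t : ℝ) : heat v t ≤ √2 * heat (2 * v) t := by
  rw [heat_eq_exp_mul_heat_two_mul hv]
  refine mul_le_mul_of_nonneg_right ?_ (heat_nonneg _ _)
  refine mul_le_of_le_one_right (by positivity) (Real.exp_le_one_iff.2 ?_)
  have : 0 ≤ t ^ 2 / v / 4 := by positivity
  linarith

lemma cancelling_heat2 {w : ℝ} (hw : 0 < w) :
    Cancelling w fun s t => s ^ 2 * heat2 (3 * w * s ^ 2) t := by
  refine ⟨√2, fun s t => heat (w * s ^ 2) t, by positivity, fun s => by fun_prop, fun s hs => ?_⟩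
  have hv : 0 < w * s ^ 2 := by positivity
  refine ⟨fun t => ?_, fun t u => ?_⟩
  · rw [abs_of_nonneg (heat_nonneg _ _)]; exact heat_le_heat_two_mul hv t
  · have e : ∀ v, ∫ v', heat (w * s ^ 2) (v' - v) * (s * heat1 (w * s ^ 2) (u - v')) =
        s * heat1 (w * s ^ 2 + w * s ^ 2) (u - v) := fun v => by
      have := integral_heat1_mul_heat hv hv u (-v)
      rw [sub_eq_add_neg u v, ← this, ← integral_const_mul]
      congr 1; ext v'; rw [← sub_eq_add_neg]; ring
    simp only [e]
    have := integral_heat1_mul_heat1 (ρ := w * s ^ 2 + w * s ^ 2) (by positivity) hv u t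
    rw [show 3 * w * s ^ 2 = w * s ^ 2 + w * s ^ 2 + w * s ^ 2 by ring, add_comm t u, ← this,
      ← integral_const_mul]
    congr 1; ext v; rw [add_comm v t]; ring

lemma cancelling_heat3 {w : ℝ} (hw : 0 < w) :
    Cancelling w fun s t => s ^ 3 * heat3 (3 * w * s ^ 2) t := by
  refine ⟨√2 / √w, fun s t => s * heat1 (w * s ^ 2) t, by positivity, fun s => by fun_prop,
    fun s hs => ?_⟩
  have hv : 0 < w * s ^ 2 := by positivity
  refine ⟨abs_mul_heat1_le hw hs, fun t u => ?_⟩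
  have e : ∀ v, ∫ v', s * heat1 (w * s ^ 2) (v' - v) * (s * heat1 (w * s ^ 2) (u - v')) =
      s ^ 2 * heat2 (w * s ^ 2 + w * s ^ 2) (u - v) := fun v => by
    have := integral_heat1_mul_heat1 hv hv u (-v)
    rw [sub_eq_add_neg u v, ← this, ← integral_const_mul]
    congr 1; ext v'; rw [← sub_eq_add_neg]; ring
  simp only [e]
  have := integral_heat1_mul_heat2 hv (w := w * s ^ 2 + w * s ^ 2) (by positivity) t u
  rw [show 3 * w * s ^ 2 = w * s ^ 2 + (w * s ^ 2 + w * s ^ 2) by ring, ← this,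
    ← integral_const_mul, ← integral_neg_eq_self]
  congr 1; ext v; rw [sub_neg_eq_add, neg_add_eq_sub]; ring

/-! ### Cauchy–Schwarz with an abstract parameter space -/

lemma measurePreserving_prod_swap_right {A B C : Type*} [MeasurableSpace A] [MeasurableSpace B]
    [MeasurableSpace C] (μ : Measure A) (ν : Measure B) (τ : Measure C) [SFinite μ] [SFinite ν]
    [SFinite τ] :
    MeasurePreserving (fun p : (A × B) × C => ((p.1.1, p.2), p.1.2))
      ((μ.prod ν).prod τ) ((μ.prod τ).prod ν) :=
  (((measurePreserving_prodAssoc μ τ ν).symm MeasurableEquiv.prodAssoc).comp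
    ((MeasurePreserving.id μ).prod Measure.measurePreserving_swap)).comp
      (measurePreserving_prodAssoc μ ν τ)

lemma MeasureTheory.MeasurePreserving.integral_comp_of_integrable {A B : Type*}
    [MeasurableSpace A] [MeasurableSpace B] {μ : Measure A} {ν : Measure B} {e : A → B}
    (he : MeasurePreserving e μ ν) {f : B → ℝ} (hf : AEStronglyMeasurable f ν) :
    ∫ x, f (e x) ∂μ = ∫ y, f y ∂ν := by
  rw [← he.map_eq] at hf ⊢
  exact (integral_map he.measurable.aemeasurable hf).symm

lemma integrable_of_lintegral_prod_ne_top {Q B : Type*} [MeasurableSpace Q]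
    {μ : Measure Q} [MeasurableSpace B] {ν : Measure B}
    [SFinite ν] {f : Q × B → ℝ} (hf : Measurable f) {g : Q → ENNReal}
    (hfg : ∀ᵐ q ∂μ, ∫⁻ v, ‖f (q, v)‖ₑ ∂ν ≤ g q) (hg : ∫⁻ q, g q ∂μ ≠ ⊤) :
    Integrable f (μ.prod ν) := by
  refine ⟨hf.aestronglyMeasurable, ?_⟩
  rw [hasFiniteIntegral_iff_enorm, lintegral_prod _ (by fun_prop)]
  exact (lintegral_mono_ae hfg).trans_lt hg.lt_top

/-- Multiplying by a translated Gaussian in a new variable does not change integrals. -/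
lemma lintegral_mul_heat_shift {Q : Type*} [MeasurableSpace Q] {μ : Measure Q}
    {g : Q → ENNReal} (hg : Measurable g) {c : Q → ℝ}
    (hc : Measurable c) {τ : ℝ} (hτ : 0 < τ) :
    ∫⁻ y : Q × ℝ, g y.1 * ENNReal.ofReal (heat τ (c y.1 - y.2)) ∂μ.prod volume =
      ∫⁻ q, g q ∂μ := by
  rw [lintegral_prod _ (by fun_prop)]
  refine lintegral_congr fun q => ?_
  dsimp only
  rw [lintegral_const_mul _ (by fun_prop),
    lintegral_sub_left_eq_self (fun v => ENNReal.ofReal (heat τ v)), lintegral_heat hτ, mul_one]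

lemma integrable_mul_heat_shift {Q : Type*} [MeasurableSpace Q] {μ : Measure Q}
    {g : Q → ℝ} (hgm : Measurable g) (hg : Integrable g μ) {c : Q → ℝ}
    (hc : Measurable c) {τ : ℝ} (hτ : 0 < τ) :
    Integrable (fun y : Q × ℝ => g y.1 * heat τ (c y.1 - y.2)) (μ.prod volume) := by
  refine ⟨by fun_prop, ?_⟩
  rw [hasFiniteIntegral_iff_enorm]
  have := lintegral_mul_heat_shift (μ := μ) (g := fun q => ‖g q‖ₑ) (by fun_prop) hc hτ
  simp only [enorm_mul, Real.enorm_of_nonneg (heat_nonneg _ _)]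
  rw [this]; exact hg.2

section
variable {Q : Type*} [MeasurableSpace Q] {μ : Measure Q} [SFinite μ]

lemma integral_mul_heat_shift {g : Q → ℝ} (hgm : Measurable g) (hg : Integrable g μ) {c : Q → ℝ}
    (hc : Measurable c) {τ : ℝ} (hτ : 0 < τ) :
    ∫ y : Q × ℝ, g y.1 * heat τ (c y.1 - y.2) ∂μ.prod volume = ∫ q, g q ∂μ := by
  rw [integral_prod _ (integrable_mul_heat_shift hgm hg hc hτ)]
  refine integral_congr_ae (ae_of_all _ fun q => ?_)
  simp only [integral_const_mul]
  rw [integral_sub_left_eq_self (fun v => heat τ v), integral_heat hτ, mul_one]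

lemma measurable_integral_mul_heat1 {a : Q × ℝ → ℝ} (ha : Measurable a) (w : ℝ) :
    Measurable fun y : Q × ℝ => ∫ t, a (y.1, t) * heat1 w (t + y.2) :=
  (StronglyMeasurable.integral_prod_right (f := fun (y : Q × ℝ) (t : ℝ) =>
    a (y.1, t) * heat1 w (t + y.2)) (Measurable.stronglyMeasurable (by
      unfold Function.uncurry; fun_prop))).measurable

lemma abs_heat1_mul_le {w : ℝ} (hw : 0 < w) (x y : ℝ) :
    |heat1 w x * heat1 w y| ≤ (√2 / √w) ^ 2 * (heat (2 * w) x * heat (2 * w) y) := by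
  rw [abs_mul]
  refine (mul_le_mul (abs_heat1_le hw x) (abs_heat1_le hw y) (abs_nonneg _)
    (mul_nonneg (by positivity) (heat_nonneg _ _))).trans_eq (by ring)

/-- A form whose kernel is a pair kernel is an integral of squares. -/
lemma integral_mul_pairKernel {a : Q × ℝ → ℝ} (ha : Measurable a) {u W : Q → ℝ}
    (hu : Measurable u) (hW : Measurable W) (hW0 : ∀ q, 0 ≤ W q) {ρ w : ℝ} (hρ : 0 < ρ)
    (hw : 0 < w)
    (hfin : ∫⁻ p : Q × (ℝ × ℝ), ‖a (p.1, p.2.1) * a (p.1, p.2.2)‖ₑ *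
      ENNReal.ofReal (heat (ρ + w) (u p.1 + (p.2.1 + p.2.2) / 2) *
        heat (4 * w) (p.2.1 - p.2.2) * W p.1) ∂μ.prod volume ≠ ⊤) :
    Integrable (fun y : Q × ℝ => W y.1 * heat ρ (u y.1 - y.2) *
      (∫ t, a (y.1, t) * heat1 w (t + y.2)) ^ 2) (μ.prod volume) ∧
    ∫ p : Q × (ℝ × ℝ), a (p.1, p.2.1) * a (p.1, p.2.2) *
      (pairKernel (ρ + w / 2) (2 * w) (u p.1 + (p.2.1 + p.2.2) / 2) (p.2.1 - p.2.2) * W p.1)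
        ∂μ.prod volume =
    ∫ y : Q × ℝ, W y.1 * heat ρ (u y.1 - y.2) *
      (∫ t, a (y.1, t) * heat1 w (t + y.2)) ^ 2 ∂μ.prod volume := by
  set f : (Q × (ℝ × ℝ)) × ℝ → ℝ := fun z => a (z.1.1, z.1.2.1) * a (z.1.1, z.1.2.2) * W z.1.1 *
    (heat ρ (u z.1.1 - z.2) * (heat1 w (z.1.2.1 + z.2) * heat1 w (z.1.2.2 + z.2))) with hfdef
  have hfm : Measurable f := by rw [hfdef]; fun_prop
  have hf : Integrable f ((μ.prod volume).prod volume) := by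
    refine integrable_of_lintegral_prod_ne_top hfm (g := fun p =>
      ENNReal.ofReal ((√2 / √w) ^ 2) * (‖a (p.1, p.2.1) * a (p.1, p.2.2)‖ₑ *
      ENNReal.ofReal (heat (ρ + w) (u p.1 + (p.2.1 + p.2.2) / 2) *
        heat (4 * w) (p.2.1 - p.2.2) * W p.1))) (ae_of_all _ fun p => ?_) ?_
    · have := lintegral_heat_mul_pair hρ (w := 2 * w) (by positivity) (u p.1) p.2.1 p.2.2
      rw [show 2 * w / 2 = w by ring, show 2 * (2 * w) = 4 * w by ring] at this
      rw [ENNReal.ofReal_mul (mul_nonneg (heat_nonneg _ _) (heat_nonneg _ _)), ← this]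
      calc ∫⁻ v, ‖f (p, v)‖ₑ ≤ ∫⁻ v, ENNReal.ofReal ((√2 / √w) ^ 2) *
            (‖a (p.1, p.2.1) * a (p.1, p.2.2)‖ₑ * ENNReal.ofReal (W p.1)) *
            ENNReal.ofReal (heat ρ (u p.1 - v) *
              (heat (2 * w) (p.2.1 + v) * heat (2 * w) (p.2.2 + v))) := by
            refine lintegral_mono fun v => ?_
            simp only [hfdef, enorm_mul (_ * _ * W p.1), enorm_mul (_ * _) (W p.1),
              enorm_mul (heat ρ _), Real.enorm_of_nonneg (hW0 _),
              Real.enorm_of_nonneg (heat_nonneg _ _)]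
            rw [ENNReal.ofReal_mul (heat_nonneg ρ _)]
            have h := abs_heat1_mul_le hw (p.2.1 + v) (p.2.2 + v)
            have h' : ‖heat1 w (p.2.1 + v) * heat1 w (p.2.2 + v)‖ₑ ≤
                ENNReal.ofReal ((√2 / √w) ^ 2) *
                  ENNReal.ofReal (heat (2 * w) (p.2.1 + v) * heat (2 * w) (p.2.2 + v)) := by
              rw [← ENNReal.ofReal_mul (by positivity), Real.enorm_eq_ofReal_abs]
              exact ENNReal.ofReal_le_ofReal h
            calc _ ≤ ‖a (p.1, p.2.1) * a (p.1, p.2.2)‖ₑ * ENNReal.ofReal (W p.1) *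
                  (ENNReal.ofReal (heat ρ (u p.1 - v)) * (ENNReal.ofReal ((√2 / √w) ^ 2) *
                  ENNReal.ofReal (heat (2 * w) (p.2.1 + v) * heat (2 * w) (p.2.2 + v)))) := by
                  gcongr
              _ = _ := by ring
        _ = _ := by rw [lintegral_const_mul _ (by fun_prop)]; ring
    · rw [lintegral_const_mul _ (by fun_prop)]
      exact ENNReal.mul_ne_top ENNReal.ofReal_ne_top hfin
  have he := measurePreserving_prod_swap_right μ (volume : Measure ℝ) (volume : Measure (ℝ × ℝ))
  have hfe : Integrable (fun z : (Q × ℝ) × (ℝ × ℝ) => f ((z.1.1, z.2), z.1.2))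
      ((μ.prod volume).prod volume) := he.integrable_comp_of_integrable hf
  have inner : ∀ y : Q × ℝ, ∫ x : ℝ × ℝ, f ((y.1, x), y.2) =
      W y.1 * heat ρ (u y.1 - y.2) * (∫ t, a (y.1, t) * heat1 w (t + y.2)) ^ 2 := fun y => by
    rw [sq, Measure.volume_eq_prod, ← integral_prod_mul, ← integral_const_mul]
    congr 1; ext x; simp only [hfdef]; ring
  refine ⟨hfe.integral_prod_left.congr (ae_of_all _ inner), ?_⟩
  calc _ = ∫ z, f z ∂((μ.prod volume).prod volume) := by
        rw [integral_prod _ hf]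
        refine integral_congr_ae (ae_of_all _ fun p => ?_)
        simp only [hfdef]
        rw [integral_const_mul, integral_heat_mul_heat1_pair hρ hw]; ring
    _ = ∫ z : (Q × ℝ) × (ℝ × ℝ), f ((z.1.1, z.2), z.1.2) ∂((μ.prod volume).prod volume) :=
        (he.integral_comp_of_integrable hf.aestronglyMeasurable).symm
    _ = _ := by
        rw [integral_prod _ hfe]
        exact integral_congr_ae (ae_of_all _ inner)

/-- Cauchy–Schwarz, in the form of a weighted AM–GM inequality, eliminating the factor `b`, which
does not depend on the integration variable of the derivative `heat1 w`. -/
lemma abs_integral_mul_conv_le {a : Q × ℝ → ℝ} (ha : Measurable a) {b : Q → ℝ} (hb : Measurable b)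
    {u W : Q → ℝ} (hu : Measurable u) (hW : Measurable W) (hW0 : ∀ q, 0 ≤ W q)
    {φ E : ℝ → ℝ} (hE : Measurable E) {w S C l B : ℝ} (hw : 0 < w) (hC : 0 ≤ C) (hl : 0 < l)
    (hφ : ∀ t u, φ (t + u) = ∫ v, S * heat1 w (t + v) * E (u - v))
    (hEb : ∀ t, |E t| ≤ C * heat (4 * w) t)
    (hfin : ∫⁻ p : Q × ℝ, ‖a p * b p.1‖ₑ *
      ENNReal.ofReal (heat (6 * w) (p.2 + u p.1) * W p.1) ∂μ.prod volume ≠ ⊤)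
    (hB0 : 0 ≤ B) (hB : ∫⁻ q, ‖b q‖ₑ ^ 2 * ENNReal.ofReal (W q) ∂μ ≤ ENNReal.ofReal B)
    (hJ : Integrable (fun y : Q × ℝ => W y.1 * heat (4 * w) (u y.1 - y.2) *
      (∫ t, a (y.1, t) * heat1 w (t + y.2)) ^ 2) (μ.prod volume)) :
    |∫ p : Q × ℝ, a p * b p.1 * (φ (p.2 + u p.1) * W p.1) ∂μ.prod volume| ≤
      C * (l * B + l⁻¹ * (S ^ 2 * ∫ y : Q × ℝ, W y.1 * heat (4 * w) (u y.1 - y.2) *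
      (∫ t, a (y.1, t) * heat1 w (t + y.2)) ^ 2 ∂μ.prod volume)) := by
  set H : Q × ℝ → ℝ := fun y => ∫ t, a (y.1, t) * heat1 w (t + y.2) with hH
  set f : (Q × ℝ) × ℝ → ℝ := fun z => a z.1 * b z.1.1 * W z.1.1 *
    (S * heat1 w (z.1.2 + z.2) * E (u z.1.1 - z.2)) with hfdef
  have hfm : Measurable f := by rw [hfdef]; fun_prop
  have hf : Integrable f ((μ.prod volume).prod volume) := by
    refine integrable_of_lintegral_prod_ne_top hfm (g := fun p =>
      ENNReal.ofReal (|S| * (√2 / √w) * C) * (‖a p * b p.1‖ₑ *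
      ENNReal.ofReal (heat (6 * w) (p.2 + u p.1) * W p.1))) (ae_of_all _ fun p => ?_) ?_
    · have := lintegral_heat_mul_heat (ρ := 4 * w) (w := 2 * w) (by positivity) (by positivity)
        (u p.1) p.2
      rw [show 4 * w + 2 * w = 6 * w by ring, add_comm (u p.1)] at this
      rw [ENNReal.ofReal_mul (heat_nonneg _ _), ← this]
      calc ∫⁻ v, ‖f (p, v)‖ₑ ≤ ∫⁻ v, ENNReal.ofReal (|S| * (√2 / √w) * C) *
            (‖a p * b p.1‖ₑ * ENNReal.ofReal (W p.1)) *
            ENNReal.ofReal (heat (4 * w) (u p.1 - v) * heat (2 * w) (v + p.2)) := by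
            refine lintegral_mono fun v => ?_
            simp only [hfdef, enorm_mul (_ * _ * W p.1), enorm_mul (_ * _) (W p.1),
              Real.enorm_of_nonneg (hW0 _)]
            have h' : ‖S * heat1 w (p.2 + v) * E (u p.1 - v)‖ₑ ≤
                ENNReal.ofReal (|S| * (√2 / √w) * C) *
                  ENNReal.ofReal (heat (4 * w) (u p.1 - v) * heat (2 * w) (v + p.2)) := by
              rw [← ENNReal.ofReal_mul (by positivity), Real.enorm_eq_ofReal_abs]
              refine ENNReal.ofReal_le_ofReal ?_
              rw [abs_mul, abs_mul, add_comm v]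
              calc |S| * |heat1 w (p.2 + v)| * |E (u p.1 - v)|
                  ≤ |S| * (√2 / √w * heat (2 * w) (p.2 + v)) *
                    (C * heat (4 * w) (u p.1 - v)) := by
                    gcongr
                    · exact mul_nonneg (abs_nonneg _)
                        (mul_nonneg (by positivity) (heat_nonneg _ _))
                    · exact abs_heat1_le hw _
                    · exact hEb _
                _ = _ := by ring
            calc _ ≤ ‖a p * b p.1‖ₑ * ENNReal.ofReal (W p.1) *
                  (ENNReal.ofReal (|S| * (√2 / √w) * C) *
                  ENNReal.ofReal (heat (4 * w) (u p.1 - v) * heat (2 * w) (v + p.2))) := by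
                  gcongr
              _ = _ := by ring
        _ = _ := by rw [lintegral_const_mul _ (by fun_prop)]; ring
    · rw [lintegral_const_mul _ (by fun_prop)]
      exact ENNReal.mul_ne_top ENNReal.ofReal_ne_top hfin
  have he := measurePreserving_prod_swap_right μ (volume : Measure ℝ) (volume : Measure ℝ)
  have hfe : Integrable (fun z : (Q × ℝ) × ℝ => f ((z.1.1, z.2), z.1.2))
      ((μ.prod volume).prod volume) := he.integrable_comp_of_integrable hf
  have inner : ∀ y : Q × ℝ, ∫ x : ℝ, f ((y.1, x), y.2) =
      b y.1 * W y.1 * E (u y.1 - y.2) * (S * H y) := fun y => by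
    rw [← mul_assoc, hH, ← integral_const_mul]
    congr 1; ext x; simp only [hfdef]; ring
  have rep : ∫ p : Q × ℝ, a p * b p.1 * (φ (p.2 + u p.1) * W p.1) ∂μ.prod volume =
      ∫ y : Q × ℝ, b y.1 * W y.1 * E (u y.1 - y.2) * (S * H y) ∂μ.prod volume := by
    calc _ = ∫ z, f z ∂((μ.prod volume).prod volume) := by
          rw [integral_prod _ hf]
          refine integral_congr_ae (ae_of_all _ fun p => ?_)
          simp only [hfdef]
          rw [integral_const_mul, hφ]; ring
      _ = ∫ z : (Q × ℝ) × ℝ, f ((z.1.1, z.2), z.1.2) ∂((μ.prod volume).prod volume) :=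
          (he.integral_comp_of_integrable hf.aestronglyMeasurable).symm
      _ = _ := by
          rw [integral_prod _ hfe]
          exact integral_congr_ae (ae_of_all _ inner)
  have hb2 : Integrable (fun q => b q ^ 2 * W q) μ := by
    refine ⟨by fun_prop, ?_⟩
    rw [hasFiniteIntegral_iff_enorm]
    refine lt_of_le_of_lt (le_trans (lintegral_mono fun q => ?_) hB) ENNReal.ofReal_lt_top
    rw [enorm_mul, enorm_pow, Real.enorm_of_nonneg (hW0 q)]
  have hb2B : ∫ q, b q ^ 2 * W q ∂μ ≤ B := by
    rw [integral_eq_lintegral_of_nonneg_ae (ae_of_all _ fun q =>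
      mul_nonneg (sq_nonneg _) (hW0 q)) hb2.aestronglyMeasurable]
    refine ENNReal.toReal_le_of_le_ofReal hB0 (le_trans (lintegral_mono fun q => ?_) hB)
    rw [ENNReal.ofReal_mul (sq_nonneg _), ← sq_abs, ENNReal.ofReal_pow (abs_nonneg _),
      Real.enorm_eq_ofReal_abs]
  have hw4 : 0 < 4 * w := by positivity
  have hb3 := integrable_mul_heat_shift (μ := μ) (g := fun q => b q ^ 2 * W q) (by fun_prop) hb2 hu
    hw4
  have hb4 := integral_mul_heat_shift (μ := μ) (g := fun q => b q ^ 2 * W q) (by fun_prop) hb2 hu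
    hw4
  have hint := ((hb3.const_mul l).add ((hJ.const_mul (S ^ 2)).const_mul l⁻¹)).const_mul C
  rw [rep, ← Real.norm_eq_abs]
  refine (norm_integral_le_of_norm_le hint (ae_of_all _ fun y => ?_)).trans ?_
  · simp only [Pi.add_apply]
    rw [Real.norm_eq_abs, abs_mul, abs_mul, abs_mul, abs_of_nonneg (hW0 _)]
    have hh := heat_nonneg (4 * w) (u y.1 - y.2)
    have key : |b y.1| * |S * H y| ≤ l * b y.1 ^ 2 + l⁻¹ * (S ^ 2 * H y ^ 2) := by
      have h1 : 0 ≤ (l * |b y.1| - |S * H y|) ^ 2 := sq_nonneg _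
      have h2 : |S * H y| ^ 2 = S ^ 2 * H y ^ 2 := by rw [sq_abs]; ring
      have h3 : 0 ≤ |b y.1| * |S * H y| := by positivity
      rw [← h2, ← sq_abs (b y.1)]
      have : l * (|b y.1| * |S * H y|) ≤
          l * (l * |b y.1| ^ 2 + l⁻¹ * |S * H y| ^ 2) := by
        have : l * (l * |b y.1| ^ 2 + l⁻¹ * |S * H y| ^ 2) =
          (l * |b y.1|) ^ 2 + |S * H y| ^ 2 := by field_simp
        nlinarith
      exact le_of_mul_le_mul_left this hl
    calc |b y.1| * W y.1 * |E (u y.1 - y.2)| * |S * H y|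
        ≤ |b y.1| * W y.1 * (C * heat (4 * w) (u y.1 - y.2)) * |S * H y| := by
          gcongr
          · exact mul_nonneg (abs_nonneg _) (hW0 _)
          · exact hEb _
      _ = (|b y.1| * |S * H y|) * (C * heat (4 * w) (u y.1 - y.2) * W y.1) := by ring
      _ ≤ (l * b y.1 ^ 2 + l⁻¹ * (S ^ 2 * H y ^ 2)) *
          (C * heat (4 * w) (u y.1 - y.2) * W y.1) :=
          mul_le_mul_of_nonneg_right key (mul_nonneg (mul_nonneg hC hh) (hW0 _))
      _ = _ := by ring
  · rw [integral_const_mul, integral_add' (hb3.const_mul l) ((hJ.const_mul (S ^ 2)).const_mul l⁻¹)]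
    simp only [integral_const_mul]
    rw [hb4]
    gcongr

/-- When both functions are paired with a derivative of the heat kernel, the form is dominated
by two diagonal forms. -/
lemma abs_integral_mul_conv_conv_le {a b : Q × ℝ → ℝ} (ha : Measurable a) (hb : Measurable b)
    {u W : Q → ℝ} (hu : Measurable u) (hW : Measurable W) (hW0 : ∀ q, 0 ≤ W q)
    {φ κ : ℝ → ℝ} (hκ : Measurable κ) {w S C : ℝ} (hw : 0 < w) (hC : 0 ≤ C)
    (hφ : ∀ t u, φ (t + u) =
      ∫ v, S * heat1 w (t + v) * ∫ v', κ (v' - v) * (S * heat1 w (u - v')))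
    (hκb : ∀ t, |κ t| ≤ C * heat (2 * w) t)
    (hfin : ∫⁻ p : Q × (ℝ × ℝ), ‖a (p.1, p.2.1) * b (p.1, p.2.2)‖ₑ *
      ENNReal.ofReal (heat (6 * w) (p.2.1 + (p.2.2 + u p.1)) * W p.1) ∂μ.prod volume ≠ ⊤)
    (hJa : Integrable (fun y : Q × ℝ => W y.1 * (∫ t, a (y.1, t) * heat1 w (t + y.2)) ^ 2)
      (μ.prod volume))
    (hJb : Integrable (fun y : Q × ℝ => W y.1 * (∫ t, b (y.1, t) * heat1 w (t + y.2)) ^ 2)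
      (μ.prod volume)) :
    |∫ p : Q × (ℝ × ℝ), a (p.1, p.2.1) * b (p.1, p.2.2) *
        (φ (p.2.1 + (p.2.2 + u p.1)) * W p.1) ∂μ.prod volume| ≤
      C * (S ^ 2 * ∫ y : Q × ℝ, W y.1 * (∫ t, a (y.1, t) * heat1 w (t + y.2)) ^ 2 ∂μ.prod volume
        + S ^ 2 * ∫ y : Q × ℝ, W y.1 * (∫ t, b (y.1, t) * heat1 w (t + y.2)) ^ 2
          ∂μ.prod volume) := by
  set Ha : Q × ℝ → ℝ := fun y => ∫ t, a (y.1, t) * heat1 w (t + y.2) with hHa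
  set Hb : Q × ℝ → ℝ := fun y => ∫ t, b (y.1, t) * heat1 w (t + y.2) with hHb
  have hHam : Measurable Ha := measurable_integral_mul_heat1 ha w
  have hHbm : Measurable Hb := measurable_integral_mul_heat1 hb w
  set D := √2 / √w with hD
  have hD0 : 0 ≤ D := by positivity
  set f : (Q × (ℝ × ℝ)) × (ℝ × ℝ) → ℝ := fun z => a (z.1.1, z.1.2.1) * b (z.1.1, z.1.2.2) *
    W z.1.1 * (S * heat1 w (z.1.2.1 + z.2.1) * (κ (u z.1.1 - z.2.2 - z.2.1) *
      (S * heat1 w (z.1.2.2 + z.2.2)))) with hfdef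
  have hfm : Measurable f := by rw [hfdef]; fun_prop
  have hw2 : 0 < 2 * w := by positivity
  have hw4 : 0 < 4 * w := by positivity
  have hf : Integrable f ((μ.prod volume).prod volume) := by
    refine integrable_of_lintegral_prod_ne_top hfm (g := fun p =>
      ENNReal.ofReal (S ^ 2 * D ^ 2 * C) * (‖a (p.1, p.2.1) * b (p.1, p.2.2)‖ₑ *
      ENNReal.ofReal (heat (6 * w) (p.2.1 + (p.2.2 + u p.1)) * W p.1))) (ae_of_all _ fun p => ?_) ?_
    · have hconv : ∫⁻ v : ℝ × ℝ, ENNReal.ofReal (heat (2 * w) (p.2.1 + v.1) *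
          (heat (2 * w) (u p.1 - v.2 - v.1) * heat (2 * w) (p.2.2 + v.2))) =
          ENNReal.ofReal (heat (6 * w) (p.2.1 + (p.2.2 + u p.1))) := by
        rw [Measure.volume_eq_prod, lintegral_prod_symm _ (by fun_prop)]
        have e1 : ∀ y, ∫⁻ x, ENNReal.ofReal (heat (2 * w) (p.2.1 + x) *
            (heat (2 * w) (u p.1 - y - x) * heat (2 * w) (p.2.2 + y))) =
            ENNReal.ofReal (heat (4 * w) (u p.1 + p.2.1 - y) * heat (2 * w) (y + p.2.2)) := by
          intro y
          have := lintegral_heat_mul_heat hw2 hw2 (u p.1 - y) p.2.1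
          rw [show 2 * w + 2 * w = 4 * w by ring] at this
          rw [show u p.1 + p.2.1 - y = u p.1 - y + p.2.1 by ring,
            ENNReal.ofReal_mul (heat_nonneg _ _), ← this,
            ← lintegral_mul_const _ (by fun_prop)]
          refine lintegral_congr fun x => ?_
          rw [← ENNReal.ofReal_mul (mul_nonneg (heat_nonneg _ _) (heat_nonneg _ _)),
            add_comm x, add_comm y]
          ring_nf
        simp only [e1]
        rw [lintegral_heat_mul_heat hw4 hw2]
        ring_nf
      rw [ENNReal.ofReal_mul (heat_nonneg _ _), ← hconv]
      calc ∫⁻ v, ‖f (p, v)‖ₑ ≤ ∫⁻ v : ℝ × ℝ, ENNReal.ofReal (S ^ 2 * D ^ 2 * C) *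
            (‖a (p.1, p.2.1) * b (p.1, p.2.2)‖ₑ * ENNReal.ofReal (W p.1)) *
            ENNReal.ofReal (heat (2 * w) (p.2.1 + v.1) *
              (heat (2 * w) (u p.1 - v.2 - v.1) * heat (2 * w) (p.2.2 + v.2))) := by
            refine lintegral_mono fun v => ?_
            simp only [hfdef, enorm_mul (_ * _ * W p.1), enorm_mul (_ * _) (W p.1),
              Real.enorm_of_nonneg (hW0 _)]
            have h' : ‖S * heat1 w (p.2.1 + v.1) * (κ (u p.1 - v.2 - v.1) *
                (S * heat1 w (p.2.2 + v.2)))‖ₑ ≤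
                ENNReal.ofReal (S ^ 2 * D ^ 2 * C) *
                  ENNReal.ofReal (heat (2 * w) (p.2.1 + v.1) *
              (heat (2 * w) (u p.1 - v.2 - v.1) * heat (2 * w) (p.2.2 + v.2))) := by
              rw [← ENNReal.ofReal_mul (by positivity), Real.enorm_eq_ofReal_abs]
              refine ENNReal.ofReal_le_ofReal ?_
              rw [abs_mul, abs_mul, abs_mul, abs_mul]
              calc |S| * |heat1 w (p.2.1 + v.1)| * (|κ (u p.1 - v.2 - v.1)| *
                    (|S| * |heat1 w (p.2.2 + v.2)|))
                  ≤ |S| * (D * heat (2 * w) (p.2.1 + v.1)) *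
                    (C * heat (2 * w) (u p.1 - v.2 - v.1) *
                    (|S| * (D * heat (2 * w) (p.2.2 + v.2)))) := by
                    have n1 := heat_nonneg (2 * w) (p.2.1 + v.1)
                    have n2 := heat_nonneg (2 * w) (u p.1 - v.2 - v.1)
                    gcongr
                    · exact abs_heat1_le hw _
                    · exact hκb _
                    · exact abs_heat1_le hw _
                _ = _ := by rw [← sq_abs S]; ring
            calc _ ≤ ‖a (p.1, p.2.1) * b (p.1, p.2.2)‖ₑ * ENNReal.ofReal (W p.1) *
                  (ENNReal.ofReal (S ^ 2 * D ^ 2 * C) *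
                  ENNReal.ofReal (heat (2 * w) (p.2.1 + v.1) *
              (heat (2 * w) (u p.1 - v.2 - v.1) * heat (2 * w) (p.2.2 + v.2)))) := by
                  gcongr
              _ = _ := by ring
        _ = _ := by rw [lintegral_const_mul _ (by fun_prop)]; ring
    · rw [lintegral_const_mul _ (by fun_prop)]
      exact ENNReal.mul_ne_top ENNReal.ofReal_ne_top hfin
  have he := measurePreserving_prod_swap_right μ (volume : Measure (ℝ × ℝ))
    (volume : Measure (ℝ × ℝ))
  have hfe : Integrable (fun z : (Q × (ℝ × ℝ)) × (ℝ × ℝ) => f ((z.1.1, z.2), z.1.2))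
      ((μ.prod volume).prod volume) := he.integrable_comp_of_integrable hf
  have inner : ∀ y : Q × (ℝ × ℝ), ∫ x : ℝ × ℝ, f ((y.1, x), y.2) =
      W y.1 * κ (u y.1 - y.2.2 - y.2.1) * (S * Ha (y.1, y.2.1)) * (S * Hb (y.1, y.2.2)) :=
    fun y => by
    have : Ha (y.1, y.2.1) * Hb (y.1, y.2.2) = ∫ x : ℝ × ℝ,
        (a (y.1, x.1) * heat1 w (x.1 + y.2.1)) * (b (y.1, x.2) * heat1 w (x.2 + y.2.2)) := by
      rw [Measure.volume_eq_prod]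
      exact (integral_prod_mul (fun t => a (y.1, t) * heat1 w (t + y.2.1))
        (fun t => b (y.1, t) * heat1 w (t + y.2.2))).symm
    rw [show W y.1 * κ (u y.1 - y.2.2 - y.2.1) * (S * Ha (y.1, y.2.1)) * (S * Hb (y.1, y.2.2)) =
      W y.1 * κ (u y.1 - y.2.2 - y.2.1) * S ^ 2 * (Ha (y.1, y.2.1) * Hb (y.1, y.2.2)) by ring,
      this, ← integral_const_mul]
    congr 1; ext x; simp only [hfdef]; ring
  have rep : ∫ p : Q × (ℝ × ℝ), a (p.1, p.2.1) * b (p.1, p.2.2) *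
        (φ (p.2.1 + (p.2.2 + u p.1)) * W p.1) ∂μ.prod volume =
      ∫ y : Q × (ℝ × ℝ), W y.1 * κ (u y.1 - y.2.2 - y.2.1) * (S * Ha (y.1, y.2.1)) *
        (S * Hb (y.1, y.2.2)) ∂μ.prod volume := by
    calc _ = ∫ z, f z ∂((μ.prod volume).prod volume) := by
          rw [integral_prod _ hf]
          refine integral_congr_ae ?_
          filter_upwards [hf.prod_right_ae] with p hp
          rw [Measure.volume_eq_prod, integral_prod _ (by rwa [← Measure.volume_eq_prod])]
          rw [hφ, ← integral_mul_const, ← integral_const_mul]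
          congr 1; ext v
          rw [← integral_sub_left_eq_self _ volume (u p.1), ← integral_const_mul,
            ← integral_mul_const, ← integral_const_mul]
          congr 1; ext v'
          simp only [hfdef]
          rw [show p.2.2 + u p.1 - (u p.1 - v') = p.2.2 + v' by ring]
          ring
      _ = ∫ z : (Q × (ℝ × ℝ)) × (ℝ × ℝ), f ((z.1.1, z.2), z.1.2)
            ∂((μ.prod volume).prod volume) :=
          (he.integral_comp_of_integrable hf.aestronglyMeasurable).symm
      _ = _ := by
          rw [integral_prod _ hfe]
          exact integral_congr_ae (ae_of_all _ inner)
  -- the two diagonal terms, with the Gaussian weight linking the two translation variables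
  have asc := (measurePreserving_prodAssoc μ (volume : Measure ℝ) (volume : Measure ℝ))
  have asc' := asc.symm MeasurableEquiv.prodAssoc
  have sw := (MeasurePreserving.id μ).prod
    (Measure.measurePreserving_swap (μ := (volume : Measure ℝ)) (ν := (volume : Measure ℝ)))
  have diag : ∀ H : Q × ℝ → ℝ, Measurable H →
      Integrable (fun y : Q × ℝ => W y.1 * H y ^ 2) (μ.prod volume) →
      Integrable (fun y : Q × (ℝ × ℝ) => W y.1 * H (y.1, y.2.1) ^ 2 *
        heat (2 * w) (u y.1 - y.2.2 - y.2.1)) (μ.prod volume) ∧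
      ∫ y : Q × (ℝ × ℝ), W y.1 * H (y.1, y.2.1) ^ 2 *
        heat (2 * w) (u y.1 - y.2.2 - y.2.1) ∂(μ.prod volume) =
      ∫ y : Q × ℝ, W y.1 * H y ^ 2 ∂(μ.prod volume) := by
    intro H hH hi
    have i1 := integrable_mul_heat_shift (μ := μ.prod volume) (by fun_prop) hi
      (c := fun y => u y.1 - y.2) (by fun_prop) hw2
    have i2 := integral_mul_heat_shift (μ := μ.prod volume) (by fun_prop) hi
      (c := fun y => u y.1 - y.2) (by fun_prop) hw2
    have i3 := asc'.integrable_comp_of_integrable i1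
    rw [Measure.volume_eq_prod]
    refine ⟨i3.congr (ae_of_all _ fun y => ?_), ?_⟩
    · simp only [Function.comp, MeasurableEquiv.prodAssoc]
      simp [sub_right_comm]
    · rw [← i2, ← asc'.integral_comp_of_integrable i1.aestronglyMeasurable]
      refine integral_congr_ae (ae_of_all _ fun y => ?_)
      simp [MeasurableEquiv.prodAssoc, sub_right_comm]
  obtain ⟨ia, ja⟩ := diag Ha hHam hJa
  obtain ⟨ib, jb⟩ := diag Hb hHbm hJb
  have ib' : Integrable (fun y : Q × (ℝ × ℝ) => W y.1 * Hb (y.1, y.2.2) ^ 2 *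
        heat (2 * w) (u y.1 - y.2.2 - y.2.1)) (μ.prod volume) := by
    have := sw.integrable_comp_of_integrable (by rwa [Measure.volume_eq_prod] at ib)
    rw [Measure.volume_eq_prod]
    refine this.congr (ae_of_all _ fun y => ?_)
    simp [sub_right_comm]
  have jb' : ∫ y : Q × (ℝ × ℝ), W y.1 * Hb (y.1, y.2.2) ^ 2 *
        heat (2 * w) (u y.1 - y.2.2 - y.2.1) ∂(μ.prod volume) =
      ∫ y : Q × ℝ, W y.1 * Hb y ^ 2 ∂(μ.prod volume) := by
    rw [Measure.volume_eq_prod] at ib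
    rw [← jb, Measure.volume_eq_prod]
    refine Eq.trans ?_ (sw.integral_comp_of_integrable ib.aestronglyMeasurable)
    refine integral_congr_ae (ae_of_all _ fun y => ?_)
    simp [sub_right_comm]
  have hint := ((ia.const_mul (S ^ 2)).add (ib'.const_mul (S ^ 2))).const_mul C
  rw [rep, ← Real.norm_eq_abs]
  refine (norm_integral_le_of_norm_le hint (ae_of_all _ fun y => ?_)).trans ?_
  · simp only [Pi.add_apply]
    have hh := heat_nonneg (2 * w) (u y.1 - y.2.2 - y.2.1)
    rw [Real.norm_eq_abs, abs_mul, abs_mul, abs_mul, abs_of_nonneg (hW0 _)]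
    have key : |S * Ha (y.1, y.2.1)| * |S * Hb (y.1, y.2.2)| ≤
        S ^ 2 * Ha (y.1, y.2.1) ^ 2 + S ^ 2 * Hb (y.1, y.2.2) ^ 2 := by
      rw [← mul_pow, ← mul_pow, ← sq_abs (S * Ha _), ← sq_abs (S * Hb _)]
      nlinarith [sq_nonneg (|S * Ha (y.1, y.2.1)| - |S * Hb (y.1, y.2.2)|),
        sq_nonneg |S * Ha (y.1, y.2.1)|, sq_nonneg |S * Hb (y.1, y.2.2)|]
    calc W y.1 * |κ (u y.1 - y.2.2 - y.2.1)| * |S * Ha (y.1, y.2.1)| * |S * Hb (y.1, y.2.2)|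
        ≤ W y.1 * (C * heat (2 * w) (u y.1 - y.2.2 - y.2.1)) * |S * Ha (y.1, y.2.1)| *
          |S * Hb (y.1, y.2.2)| := by
          gcongr
          · exact hW0 _
          · exact hκb _
      _ = (|S * Ha (y.1, y.2.1)| * |S * Hb (y.1, y.2.2)|) *
          (W y.1 * (C * heat (2 * w) (u y.1 - y.2.2 - y.2.1))) := by ring
      _ ≤ _ := mul_le_mul_of_nonneg_right key (mul_nonneg (hW0 _) (mul_nonneg hC hh))
      _ = _ := by ring
  · rw [integral_const_mul, integral_add' (ia.const_mul (S ^ 2)) (ib'.const_mul (S ^ 2))]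
    simp only [integral_const_mul]
    rw [ja, jb']

end

/-! ### Forms on cubes -/

/-- The vertex of the cube `∏ j, {(ω j).1, (ω j).2}` selected by `ε`. -/
def vertex {k : ℕ} (ω : Fin k → ℝ × ℝ) (ε : Fin k → Bool) : Fin k → ℝ :=
  fun j => if ε j then (ω j).2 else (ω j).1

/-- The product of `f` over all vertices of the cube `ω`. -/
noncomputable def cubeProd {k : ℕ} (f : (Fin k → ℝ) → ℝ) (ω : Fin k → ℝ × ℝ) : ℝ :=
  ∏ ε : Fin k → Bool, f (vertex ω ε)

/-- The sum of the coordinates of the centre of the cube `ω`. -/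
noncomputable def mid {k : ℕ} (ω : Fin k → ℝ × ℝ) : ℝ := ∑ j, ((ω j).1 + (ω j).2) / 2

/-- The Gaussian weight with variances `B` in the side lengths of the cube `ω`. -/
noncomputable def sideWeight {k : ℕ} (B : Fin k → ℝ) (ω : Fin k → ℝ × ℝ) : ℝ :=
  ∏ j, heat (B j) ((ω j).1 - (ω j).2)

@[fun_prop]
lemma measurable_vertex {k : ℕ} (ε : Fin k → Bool) : Measurable fun ω => vertex ω ε := by
  refine measurable_pi_lambda _ fun j => ?_
  unfold vertex; split_ifs <;> fun_prop

@[fun_prop]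
lemma measurable_mid {k : ℕ} : Measurable (mid (k := k)) := by unfold mid; fun_prop

@[fun_prop]
lemma measurable_sideWeight {k : ℕ} (B : Fin k → ℝ) : Measurable (sideWeight B) := by
  unfold sideWeight; fun_prop

lemma sideWeight_nonneg {k : ℕ} (B : Fin k → ℝ) (ω : Fin k → ℝ × ℝ) : 0 ≤ sideWeight B ω :=
  Finset.prod_nonneg fun _ _ => heat_nonneg _ _

lemma measurable_cubeProd {X : Type*} [MeasurableSpace X] {k : ℕ} {f : X × (Fin k → ℝ) → ℝ}
    (hf : Measurable f) :
    Measurable fun p : X × (Fin k → ℝ × ℝ) => cubeProd (fun ζ => f (p.1, ζ)) p.2 := by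
  unfold cubeProd
  refine Finset.measurable_prod _ fun ε _ => ?_
  exact hf.comp (measurable_fst.prodMk ((measurable_vertex ε).comp measurable_snd))

/-- The form obtained by multiplying `f` over all vertices of a cube, with a kernel depending on
`σ x` plus the coordinate sum of the centre of the cube, and on the cube itself. -/
noncomputable def cubeForm {X : Type*} [MeasureSpace X] {k : ℕ} (σ : X → ℝ)
    (f : X × (Fin k → ℝ) → ℝ) (K : ℝ → (Fin k → ℝ × ℝ) → ℝ) : ℝ :=
  ∫ p : X × (Fin k → ℝ × ℝ), cubeProd (fun ζ => f (p.1, ζ)) p.2 * K (σ p.1 + mid p.2) p.2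

/-- The Hölder type bound which makes cube forms with integrable kernels absolutely convergent. -/
structure Admissible {X : Type*} [MeasureSpace X] {k : ℕ} (σ : X → ℝ)
    (f : X × (Fin k → ℝ) → ℝ) : Prop where
  measurable_sum : Measurable σ
  measurable : Measurable f
  lintegral_le : ∀ (h : ℝ → ENNReal) (h' : Fin k → ℝ → ENNReal), Measurable h →
    (∀ j, Measurable (h' j)) →
    ∫⁻ p : X × (Fin k → ℝ × ℝ), ‖cubeProd (fun ζ => f (p.1, ζ)) p.2‖ₑ *
      (h (σ p.1 + mid p.2) * ∏ j, h' j ((p.2 j).1 - (p.2 j).2)) ≤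
    (∫⁻ t, h t) * ∏ j, ∫⁻ t, h' j t

/-- The kernel at scale `s` with profile `φ` in the centre and Gaussian weights in the sides. -/
noncomputable def profileKernel {k : ℕ} (φ : ℝ → ℝ → ℝ) (β : Fin k → ℝ) (s z : ℝ)
    (ω : Fin k → ℝ × ℝ) : ℝ := φ s z * sideWeight (fun j => β j * s ^ 2) ω

/-- The scaled mixed second derivative, in the two copies of the `j`-th doubled variable, of the
Gaussian kernel with variance `α * s ^ 2` in the centre and `β * s ^ 2` in the sides. -/
noncomputable def pairCubeKernel {k : ℕ} (α : ℝ) (β : Fin (k + 1) → ℝ) (j : Fin (k + 1)) (s z : ℝ)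
    (ω : Fin (k + 1) → ℝ × ℝ) : ℝ :=
  s ^ 2 * (pairKernel (α * s ^ 2) (β j * s ^ 2) z ((ω j).1 - (ω j).2) *
    sideWeight (fun i => β (j.succAbove i) * s ^ 2) fun i => ω (j.succAbove i))

section
variable {X : Type*} [MeasureSpace X] {k : ℕ} {σ : X → ℝ}

lemma Admissible.lintegral_enorm_le {f : X × (Fin k → ℝ) → ℝ} (hf : Admissible σ f)
    {K : ℝ → (Fin k → ℝ × ℝ) → ℝ} {A C : ℝ} {B : Fin k → ℝ} (hA : 0 < A) (hB : ∀ j, 0 < B j)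
    (hK : ∀ z ω, |K z ω| ≤ C * (heat A z * sideWeight B ω)) :
    ∫⁻ p : X × (Fin k → ℝ × ℝ),
      ‖cubeProd (fun ζ => f (p.1, ζ)) p.2 * K (σ p.1 + mid p.2) p.2‖ₑ ≤ ENNReal.ofReal C := by
  have h := hf.lintegral_le (fun t => ENNReal.ofReal (heat A t))
    (fun j t => ENNReal.ofReal (heat (B j) t)) (by fun_prop) (fun j => by fun_prop)
  simp only [lintegral_heat hA, lintegral_heat (hB _), Finset.prod_const_one, mul_one] at h
  calc _ ≤ ∫⁻ p : X × (Fin k → ℝ × ℝ), ENNReal.ofReal C *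
        (‖cubeProd (fun ζ => f (p.1, ζ)) p.2‖ₑ * (ENNReal.ofReal (heat A (σ p.1 + mid p.2)) *
          ∏ j, ENNReal.ofReal (heat (B j) ((p.2 j).1 - (p.2 j).2)))) := by
        refine lintegral_mono fun p => ?_
        rw [enorm_mul, ← ENNReal.ofReal_prod_of_nonneg fun _ _ => heat_nonneg _ _,
          ← ENNReal.ofReal_mul (heat_nonneg _ _), mul_left_comm]
        gcongr
        rw [Real.enorm_eq_ofReal_abs, ← ENNReal.ofReal_mul' (mul_nonneg (heat_nonneg _ _)
          (Finset.prod_nonneg fun _ _ => heat_nonneg _ _))]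
        exact ENNReal.ofReal_le_ofReal (hK _ _)
    _ ≤ ENNReal.ofReal C := by
        rw [lintegral_const_mul' _ _ ENNReal.ofReal_ne_top]
        exact mul_le_of_le_one_right' h

lemma Admissible.integrable {f : X × (Fin k → ℝ) → ℝ} (hf : Admissible σ f)
    {K : ℝ → (Fin k → ℝ × ℝ) → ℝ} {A C : ℝ} {B : Fin k → ℝ} (hA : 0 < A) (hB : ∀ j, 0 < B j)
    (hK : ∀ z ω, |K z ω| ≤ C * (heat A z * sideWeight B ω)) (hKm : Measurable K.uncurry) :
    Integrable fun p : X × (Fin k → ℝ × ℝ) =>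
      cubeProd (fun ζ => f (p.1, ζ)) p.2 * K (σ p.1 + mid p.2) p.2 := by
  have h1 := measurable_cubeProd hf.measurable
  have h2 := hf.measurable_sum
  refine ⟨(h1.mul (hKm.comp (by fun_prop :
    Measurable fun p : X × (Fin k → ℝ × ℝ) => (σ p.1 + mid p.2, p.2)))).aestronglyMeasurable, ?_⟩
  exact (hf.lintegral_enorm_le hA hB hK).trans_lt ENNReal.ofReal_lt_top

lemma Admissible.abs_cubeForm_le {f : X × (Fin k → ℝ) → ℝ} (hf : Admissible σ f)
    {K : ℝ → (Fin k → ℝ × ℝ) → ℝ} {A C : ℝ} {B : Fin k → ℝ} (hA : 0 < A) (hB : ∀ j, 0 < B j)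
    (hC : 0 ≤ C) (hK : ∀ z ω, |K z ω| ≤ C * (heat A z * sideWeight B ω)) :
    |cubeForm σ f K| ≤ C := by
  rw [← Real.norm_eq_abs, ← toReal_enorm]
  refine ENNReal.toReal_le_of_le_ofReal hC ?_
  exact (enorm_integral_le_lintegral_enorm _).trans (hf.lintegral_enorm_le hA hB hK)

end

section
variable {X : Type*} [MeasureSpace X] [SFinite (volume : Measure X)] {k : ℕ} {σ : X → ℝ}

/-- Joint integrability over scales and space. -/
lemma Admissible.integrable_scales {f : X × (Fin k → ℝ) → ℝ} (hf : Admissible σ f)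
    {K : ℝ → ℝ → (Fin k → ℝ × ℝ) → ℝ} {α C r R : ℝ} {β : Fin k → ℝ} (hα : 0 < α)
    (hβ : ∀ j, 0 < β j) (hr : 0 < r)
    (hK : ∀ s, 0 < s → ∀ z ω, |K s z ω| ≤
      C * (heat (α * s ^ 2) z * sideWeight (fun j => β j * s ^ 2) ω))
    (hKm : Measurable fun y : ℝ × ℝ × (Fin k → ℝ × ℝ) => K y.1 y.2.1 y.2.2) :
    Integrable (fun y : ℝ × (X × (Fin k → ℝ × ℝ)) => y.1⁻¹ *
      (cubeProd (fun ζ => f (y.2.1, ζ)) y.2.2 * K y.1 (σ y.2.1 + mid y.2.2) y.2.2))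
      ((volume.restrict (Set.Ioc r R)).prod volume) := by
  have h1 := measurable_cubeProd hf.measurable
  have h2 := hf.measurable_sum
  have h3 := hKm.comp (by fun_prop : Measurable fun y : ℝ × (X × (Fin k → ℝ × ℝ)) =>
    (y.1, σ y.2.1 + mid y.2.2, y.2.2))
  refine integrable_of_lintegral_prod_ne_top
    (measurable_fst.inv.mul ((h1.comp measurable_snd).mul h3))
    (g := fun _ => ENNReal.ofReal r⁻¹ * ENNReal.ofReal C) ?_ ?_
  · filter_upwards [self_mem_ae_restrict measurableSet_Ioc] with s hs
    have hs0 : 0 < s := hr.trans hs.1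
    have e : ‖s⁻¹‖ₑ ≤ ENNReal.ofReal r⁻¹ := by
      rw [Real.enorm_of_nonneg (by positivity)]
      exact ENNReal.ofReal_le_ofReal (inv_anti₀ hr hs.1.le)
    calc _ ≤ ∫⁻ p : X × (Fin k → ℝ × ℝ), ENNReal.ofReal r⁻¹ *
          ‖cubeProd (fun ζ => f (p.1, ζ)) p.2 * K s (σ p.1 + mid p.2) p.2‖ₑ := by
          refine lintegral_mono fun p => ?_
          rw [enorm_mul]; gcongr
      _ ≤ _ := by
          rw [lintegral_const_mul' _ _ ENNReal.ofReal_ne_top]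
          gcongr
          exact hf.lintegral_enorm_le (by positivity)
            (fun j => mul_pos (hβ j) (by positivity)) (hK s hs0)
  · rw [lintegral_const]
    refine ENNReal.mul_ne_top (ENNReal.mul_ne_top ENNReal.ofReal_ne_top ENNReal.ofReal_ne_top) ?_
    simp

end

lemma vertex_insertNth {k : ℕ} (j : Fin (k + 1)) (d : ℝ × ℝ) (ω : Fin k → ℝ × ℝ) (b : Bool)
    (ε : Fin k → Bool) :
    vertex (j.insertNth d ω) (j.insertNth b ε : Fin (k + 1) → Bool) =
      (j.insertNth (if b then d.2 else d.1) (vertex ω ε) : Fin (k + 1) → ℝ) := by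
  ext i
  refine Fin.succAboveCases j ?_ (fun i => ?_) i <;> simp [vertex]

lemma cubeProd_insertNth {k : ℕ} (g : (Fin (k + 1) → ℝ) → ℝ) (j : Fin (k + 1)) (d : ℝ × ℝ)
    (ω : Fin k → ℝ × ℝ) :
    cubeProd g (j.insertNth d ω) = cubeProd (fun ζ => g (j.insertNth d.1 ζ)) ω *
      cubeProd (fun ζ => g (j.insertNth d.2 ζ)) ω := by
  unfold cubeProd
  rw [← (Fin.insertNthEquiv (fun _ => Bool) j).prod_comp, Fintype.prod_prod_type, Fintype.prod_bool]
  simp [Fin.insertNthEquiv, vertex_insertNth, mul_comm]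

lemma mid_insertNth {k : ℕ} (j : Fin (k + 1)) (d : ℝ × ℝ) (ω : Fin k → ℝ × ℝ) :
    mid (j.insertNth d ω) = mid ω + (d.1 + d.2) / 2 := by
  simp [mid, Fin.sum_univ_succAbove _ j, add_comm]

lemma measurable_cubeProd_insertNth {X : Type*} [MeasurableSpace X] {k : ℕ}
    {f : X × (Fin (k + 1) → ℝ) → ℝ} (hf : Measurable f)
    (j : Fin (k + 1)) :
    Measurable fun z : (X × (Fin k → ℝ × ℝ)) × ℝ =>
      cubeProd (fun ζ => f (z.1.1, j.insertNth z.2 ζ)) z.1.2 := by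
  unfold cubeProd
  refine Finset.measurable_prod _ fun ε _ => hf.comp (measurable_fst.fst.prodMk ?_)
  refine measurable_pi_lambda _ fun i => ?_
  refine Fin.succAboveCases j ?_ (fun i => ?_) i
  · simpa using measurable_snd
  · simp only [Fin.insertNth_apply_succAbove]
    exact (measurable_pi_apply i).comp ((measurable_vertex ε).comp measurable_fst.snd)

lemma measurePreserving_insertNth {X : Type*} [MeasureSpace X] [SFinite (volume : Measure X)]
    {k : ℕ} (j : Fin (k + 1)) :
    MeasurePreserving (fun z : (X × (Fin k → ℝ × ℝ)) × (ℝ × ℝ) =>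
      (z.1.1, (j.insertNth z.2 z.1.2 : Fin (k + 1) → ℝ × ℝ)))
      ((volume : Measure (X × (Fin k → ℝ × ℝ))).prod volume) volume := by
  have h1 := (volume_preserving_piFinSuccAbove (fun _ : Fin (k + 1) => ℝ × ℝ) j).symm
    (MeasurableEquiv.piFinSuccAbove _ j)
  have h2 := measurePreserving_prodAssoc (volume : Measure X)
    (volume : Measure (Fin k → ℝ × ℝ)) (volume : Measure (ℝ × ℝ))
  exact (((MeasurePreserving.id volume).prod
    (h1.comp Measure.measurePreserving_swap)).comp h2)

section
variable {X : Type*} [MeasureSpace X] [SFinite (volume : Measure X)] {k : ℕ} {σ : X → ℝ}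

/-- The square integral to which a pair form is equal: the two copies of the `j`-th doubled
variable are decoupled by a translation parameter. -/
noncomputable def squareIntegrand (σ : X → ℝ) (f : X × (Fin (k + 1) → ℝ) → ℝ) (α : ℝ)
    (β : Fin (k + 1) → ℝ) (j : Fin (k + 1)) (s : ℝ) (y : (X × (Fin k → ℝ × ℝ)) × ℝ) : ℝ :=
  sideWeight (fun i => β (j.succAbove i) * s ^ 2) y.1.2 *
    heat ((α - β j / 4) * s ^ 2) (σ y.1.1 + mid y.1.2 - y.2) *
    (∫ t, cubeProd (fun ζ => f (y.1.1, j.insertNth t ζ)) y.1.2 *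
      heat1 (β j / 2 * s ^ 2) (t + y.2)) ^ 2

lemma Admissible.pairForm_eq {f : X × (Fin (k + 1) → ℝ) → ℝ} (hf : Admissible σ f) {α s : ℝ}
    {β : Fin (k + 1) → ℝ} (hβ : ∀ j, 0 < β j) (j : Fin (k + 1)) (hαβ : β j < 4 * α)
    (hs : 0 < s) :
    Integrable (squareIntegrand σ f α β j s) ∧
    cubeForm σ f (pairCubeKernel α β j s) = s ^ 2 * ∫ y, squareIntegrand σ f α β j s y := by
  have hm := measurePreserving_insertNth (X := X) (k := k) j
  have hρ : 0 < (α - β j / 4) * s ^ 2 := mul_pos (by linarith) (by positivity)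
  have hw : 0 < β j / 2 * s ^ 2 := mul_pos (half_pos (hβ j)) (by positivity)
  have hσ := hf.measurable_sum
  have hB : ∀ i, 0 < (j.insertNth (4 * (β j / 2 * s ^ 2))
      (fun i => β (j.succAbove i) * s ^ 2) : Fin (k + 1) → ℝ) i := by
    intro i
    refine Fin.succAboveCases j ?_ (fun i => ?_) i
    · simp only [Fin.insertNth_apply_same]; positivity
    · simp only [Fin.insertNth_apply_succAbove]; exact mul_pos (hβ _) (by positivity)
  have hfin := hf.lintegral_enorm_le (K := fun z ω => heat ((α - β j / 4) * s ^ 2 +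
    β j / 2 * s ^ 2) z * sideWeight (j.insertNth (4 * (β j / 2 * s ^ 2))
      (fun i => β (j.succAbove i) * s ^ 2)) ω) (C := 1) (add_pos hρ hw) hB
    (fun z ω => by rw [one_mul, abs_of_nonneg (mul_nonneg (heat_nonneg _ _)
      (sideWeight_nonneg _ _))])
  rw [← hm.map_eq, lintegral_map' (by
    have := measurable_cubeProd hf.measurable
    fun_prop) hm.measurable.aemeasurable] at hfin
  have key := integral_mul_pairKernel (μ := (volume : Measure (X × (Fin k → ℝ × ℝ))))
    (measurable_cubeProd_insertNth hf.measurable j) (u := fun q => σ q.1 + mid q.2)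
    (W := fun q => sideWeight (fun i => β (j.succAbove i) * s ^ 2) q.2) (by fun_prop)
    (by fun_prop) (fun q => sideWeight_nonneg _ _) hρ hw (by
      refine ne_top_of_le_ne_top ENNReal.ofReal_ne_top (le_trans (le_of_eq ?_) hfin)
      refine lintegral_congr fun p => ?_
      rw [cubeProd_insertNth, mid_insertNth, enorm_mul (cubeProd _ _ * cubeProd _ _),
        Real.enorm_of_nonneg (mul_nonneg (heat_nonneg _ _) (sideWeight_nonneg _ _))]
      congr 2
      dsimp only
      simp only [sideWeight, Fin.prod_univ_succAbove _ j, Fin.insertNth_apply_same,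
        Fin.insertNth_apply_succAbove, add_assoc, mul_assoc])
  refine ⟨key.1, ?_⟩
  have e := key.2
  unfold cubeForm
  simp only [squareIntegrand]
  rw [Measure.volume_eq_prod (X × _) ℝ]
  rw [← e, ← integral_const_mul, ← hm.integral_comp_of_integrable]
  · refine integral_congr_ae (ae_of_all _ fun p => ?_)
    simp only [cubeProd_insertNth, mid_insertNth, pairCubeKernel, Fin.insertNth_apply_same,
      Fin.insertNth_apply_succAbove, add_assoc]
    rw [show (α - β j / 4) * s ^ 2 + β j / 2 * s ^ 2 / 2 = α * s ^ 2 by ring,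
      show 2 * (β j / 2 * s ^ 2) = β j * s ^ 2 by ring]
    ring
  · have := measurable_cubeProd hf.measurable
    unfold pairCubeKernel pairKernel
    exact Measurable.aestronglyMeasurable (by fun_prop)

lemma Admissible.pairForm_nonneg {f : X × (Fin (k + 1) → ℝ) → ℝ} (hf : Admissible σ f) {α s : ℝ}
    {β : Fin (k + 1) → ℝ} (hβ : ∀ j, 0 < β j) (j : Fin (k + 1)) (hαβ : β j < 4 * α)
    (hs : 0 < s) : 0 ≤ cubeForm σ f (pairCubeKernel α β j s) := by
  rw [(hf.pairForm_eq hβ j hαβ hs).2]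
  refine mul_nonneg (sq_nonneg _) (integral_nonneg fun y => ?_)
  exact mul_nonneg (mul_nonneg (sideWeight_nonneg _ _) (heat_nonneg _ _)) (sq_nonneg _)

end

/-! ### Telescoping over scales -/

/-- The part of the pair kernel in which the second derivative falls on the `j`-th side. -/
noncomputable def sideKernel {k : ℕ} (α : ℝ) (β : Fin (k + 1) → ℝ) (j : Fin (k + 1)) (s z : ℝ)
    (ω : Fin (k + 1) → ℝ × ℝ) : ℝ :=
  heat (α * s ^ 2) z * (s ^ 2 * heat2 (β j * s ^ 2) ((ω j).1 - (ω j).2) *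
    sideWeight (fun i => β (j.succAbove i) * s ^ 2) fun i => ω (j.succAbove i))

/-- The profile of the second derivative of the Gaussian. -/
noncomputable def centreProfile (α s t : ℝ) : ℝ := s ^ 2 * heat2 (α * s ^ 2) t

lemma sideWeight_succAbove {k : ℕ} (B : Fin (k + 1) → ℝ) (j : Fin (k + 1))
    (ω : Fin (k + 1) → ℝ × ℝ) :
    sideWeight B ω = heat (B j) ((ω j).1 - (ω j).2) *
      sideWeight (fun i => B (j.succAbove i)) fun i => ω (j.succAbove i) := by
  simp only [sideWeight, Fin.prod_univ_succAbove _ j]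

lemma pairCubeKernel_eq {k : ℕ} (α : ℝ) (β : Fin (k + 1) → ℝ) (j : Fin (k + 1)) (s z : ℝ)
    (ω : Fin (k + 1) → ℝ × ℝ) : pairCubeKernel α β j s z ω =
      profileKernel (centreProfile α) β s z ω / 4 - sideKernel α β j s z ω := by
  rw [profileKernel, sideWeight_succAbove _ j, pairCubeKernel, sideKernel, pairKernel,
    centreProfile]
  ring

lemma prod_erase_eq_prod_succAbove {k : ℕ} (f : Fin (k + 1) → ℝ) (j : Fin (k + 1)) :
    ∏ i ∈ Finset.univ.erase j, f i = ∏ i, f (j.succAbove i) := by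
  rw [← Finset.compl_singleton, ← Fin.image_succAbove_univ,
    Finset.prod_image fun _ _ _ _ h => Fin.succAbove_right_injective h]

/-- The derivative in the scale of the Gaussian kernel on a cube. -/
lemma hasDerivAt_gaussKernel {k : ℕ} {α : ℝ} {β : Fin (k + 1) → ℝ} (hα : 0 < α)
    (hβ : ∀ j, 0 < β j) {s : ℝ} (hs : 0 < s) (z : ℝ) (ω : Fin (k + 1) → ℝ × ℝ) :
    HasDerivAt (fun s => heat (α * s ^ 2) z * sideWeight (fun j => β j * s ^ 2) ω)
      (s⁻¹ * (α * profileKernel (centreProfile α) β s z ω +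
        ∑ j, β j * sideKernel α β j s z ω)) s := by
  have h := HasDerivAt.fun_finsetProd (u := Finset.univ) (x := s)
    (f := fun j s => heat (β j * s ^ 2) ((ω j).1 - (ω j).2))
    (f' := fun j => s⁻¹ * (β j * (s ^ 2 * heat2 (β j * s ^ 2) ((ω j).1 - (ω j).2))))
    fun j _ => hasDerivAt_heat_scale (hβ j) hs _
  refine ((hasDerivAt_heat_scale hα hs z).mul h).congr_deriv ?_
  simp only [prod_erase_eq_prod_succAbove, smul_eq_mul, profileKernel, centreProfile, mul_add,
    Finset.mul_sum]
  congr 1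
  · simp only [sideWeight]; ring
  · refine Finset.sum_congr rfl fun j _ => ?_
    simp only [sideKernel, sideWeight]; ring

lemma abs_profileKernel_centre_le {k : ℕ} {α : ℝ} (hα : 0 < α) (β : Fin k → ℝ) {s : ℝ}
    (hs : 0 < s) (z : ℝ) (ω : Fin k → ℝ × ℝ) :
    |profileKernel (centreProfile α) β s z ω| ≤
      4 * √2 / α * (heat (2 * α * s ^ 2) z * sideWeight (fun j => β j * s ^ 2) ω) := by
  rw [profileKernel, abs_mul, abs_of_nonneg (sideWeight_nonneg _ _), ← mul_assoc, mul_assoc 2]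
  exact mul_le_mul_of_nonneg_right (abs_sq_mul_heat2_le hα hs z) (sideWeight_nonneg _ _)

lemma abs_sideKernel_le {k : ℕ} (α : ℝ) {β : Fin (k + 1) → ℝ} (hβ : ∀ j, 0 < β j)
    (j : Fin (k + 1)) {s : ℝ} (hs : 0 < s) (z : ℝ) (ω : Fin (k + 1) → ℝ × ℝ) :
    |sideKernel α β j s z ω| ≤ 4 * √2 / β j * (heat (α * s ^ 2) z *
      sideWeight (fun i => (j.insertNth (2 * β j) (fun i => β (j.succAbove i)) :
        Fin (k + 1) → ℝ) i * s ^ 2) ω) := by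
  rw [sideKernel, sideWeight_succAbove _ j, abs_mul, abs_mul,
    abs_of_nonneg (sideWeight_nonneg _ _), abs_of_nonneg (heat_nonneg _ _)]
  simp only [Fin.insertNth_apply_same, Fin.insertNth_apply_succAbove]
  have h := abs_sq_mul_heat2_le (hβ j) hs ((ω j).1 - (ω j).2)
  rw [← mul_assoc 2] at h
  calc _ ≤ heat (α * s ^ 2) z * (4 * √2 / β j * heat (2 * β j * s ^ 2) ((ω j).1 - (ω j).2) *
        sideWeight (fun i => β (j.succAbove i) * s ^ 2) fun i => ω (j.succAbove i)) := by
        gcongr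
        · exact heat_nonneg _ _
        · exact sideWeight_nonneg _ _
    _ = _ := by ring

section
variable {X : Type*} [MeasureSpace X] [SFinite (volume : Measure X)] {k : ℕ} {σ : X → ℝ}

/-- Fubini for forms integrated over scales. -/
lemma integral_scales_eq {f : X × (Fin k → ℝ) → ℝ} {K : ℝ → ℝ → (Fin k → ℝ × ℝ) → ℝ} {r R : ℝ}
    (h : Integrable (fun y : ℝ × (X × (Fin k → ℝ × ℝ)) => y.1⁻¹ *
      (cubeProd (fun ζ => f (y.2.1, ζ)) y.2.2 * K y.1 (σ y.2.1 + mid y.2.2) y.2.2))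
      ((volume.restrict (Set.Ioc r R)).prod volume)) :
    IntegrableOn (fun s => s⁻¹ * cubeForm σ f (K s)) (Set.Ioc r R) ∧
    ∫ y : ℝ × (X × (Fin k → ℝ × ℝ)), y.1⁻¹ *
      (cubeProd (fun ζ => f (y.2.1, ζ)) y.2.2 * K y.1 (σ y.2.1 + mid y.2.2) y.2.2)
      ∂(volume.restrict (Set.Ioc r R)).prod volume =
    ∫ s in Set.Ioc r R, s⁻¹ * cubeForm σ f (K s) := by
  refine ⟨h.integral_prod_left.congr (ae_of_all _ fun s => ?_), ?_⟩
  · simp only [cubeForm]; rw [← integral_const_mul]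
  · rw [integral_prod _ h]
    refine integral_congr_ae (ae_of_all _ fun s => ?_)
    simp only [cubeForm]; rw [← integral_const_mul]

/-- Telescoping: the sum of the pair forms, integrated over scales, is controlled by the central
form, since the scale derivative of the Gaussian kernel is a combination of them. As all pair forms
are nonnegative, each one of them is controlled. -/
theorem Admissible.integral_pairForm_le {f : X × (Fin (k + 1) → ℝ) → ℝ} (hf : Admissible σ f)
    {α r R : ℝ} {β : Fin (k + 1) → ℝ} (hα : 0 < α) (hβ : ∀ j, 0 < β j)
    (hαβ : ∀ j, β j < 4 * α) (hr : 0 < r) (hrR : r < R) (j : Fin (k + 1)) :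
    IntegrableOn (fun s => s⁻¹ * cubeForm σ f (pairCubeKernel α β j s)) (Set.Ioc r R) ∧
    β j * ∫ s in Set.Ioc r R, s⁻¹ * cubeForm σ f (pairCubeKernel α β j s) ≤
      (α + (∑ i, β i) / 4) * |∫ s in Set.Ioc r R, s⁻¹ *
        cubeForm σ f (profileKernel (centreProfile α) β s)| + 2 := by
  have hT := hf.integrable_scales (K := profileKernel (centreProfile α) β) (α := 2 * α) (r := r)
    (R := R) (by positivity) hβ hr (fun s hs => abs_profileKernel_centre_le hα β hs)
    (by unfold profileKernel centreProfile sideWeight; fun_prop)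
  have hD := fun j => hf.integrable_scales (K := sideKernel α β j) (r := r) (R := R) hα
    (β := j.insertNth (2 * β j) (fun i => β (j.succAbove i))) (fun i => by
      refine Fin.succAboveCases j ?_ (fun i => ?_) i
      · simp only [Fin.insertNth_apply_same]; linarith [hβ j]
      · simp only [Fin.insertNth_apply_succAbove]; exact hβ _) hr
    (fun s hs => abs_sideKernel_le α hβ j hs) (by unfold sideKernel sideWeight; fun_prop)
  have hP : ∀ j, Integrable (fun y : ℝ × (X × (Fin (k + 1) → ℝ × ℝ)) => y.1⁻¹ *
      (cubeProd (fun ζ => f (y.2.1, ζ)) y.2.2 *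
        pairCubeKernel α β j y.1 (σ y.2.1 + mid y.2.2) y.2.2))
      ((volume.restrict (Set.Ioc r R)).prod volume) := fun j => by
    refine ((hT.const_mul (1 / 4)).sub (hD j)).congr (ae_of_all _ fun y => ?_)
    simp only [Pi.sub_apply, pairCubeKernel_eq]; ring
  set ν := (volume.restrict (Set.Ioc r R)).prod (volume : Measure (X × (Fin (k + 1) → ℝ × ℝ)))
    with hν
  have hPI : ∀ j, ∫ s in Set.Ioc r R, s⁻¹ * cubeForm σ f (pairCubeKernel α β j s) =
      1 / 4 * (∫ s in Set.Ioc r R, s⁻¹ * cubeForm σ f (profileKernel (centreProfile α) β s)) -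
        ∫ y, y.1⁻¹ * (cubeProd (fun ζ => f (y.2.1, ζ)) y.2.2 *
          sideKernel α β j y.1 (σ y.2.1 + mid y.2.2) y.2.2) ∂ν := fun j => by
    rw [← (integral_scales_eq (hP j)).2, ← (integral_scales_eq hT).2, ← integral_const_mul,
      ← integral_sub (hT.const_mul _) (hD j)]
    refine integral_congr_ae (ae_of_all _ fun y => ?_)
    simp only [pairCubeKernel_eq]; ring
  -- the scale derivative, whose integral only sees the two end scales
  set g : ℝ × (X × (Fin (k + 1) → ℝ × ℝ)) → ℝ := fun y => y.1⁻¹ *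
    (cubeProd (fun ζ => f (y.2.1, ζ)) y.2.2 *
      (α * profileKernel (centreProfile α) β y.1 (σ y.2.1 + mid y.2.2) y.2.2 +
        ∑ j, β j * sideKernel α β j y.1 (σ y.2.1 + mid y.2.2) y.2.2)) with hg
  have hge : g = fun y => α * (y.1⁻¹ * (cubeProd (fun ζ => f (y.2.1, ζ)) y.2.2 *
      profileKernel (centreProfile α) β y.1 (σ y.2.1 + mid y.2.2) y.2.2)) +
      ∑ j, β j * (y.1⁻¹ * (cubeProd (fun ζ => f (y.2.1, ζ)) y.2.2 *
        sideKernel α β j y.1 (σ y.2.1 + mid y.2.2) y.2.2)) := by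
    ext y
    simp only [hg, mul_add, Finset.mul_sum]
    congr 1
    · ring
    · exact Finset.sum_congr rfl fun j _ => by ring
  have hsumi := integrable_finsetSum (μ := ν) Finset.univ fun j _ => (hD j).const_mul (β j)
  have hgi : Integrable g ν := by
    rw [hge]; exact (hT.const_mul α).add hsumi
  have hgI : ∫ y, g y ∂ν = α * (∫ s in Set.Ioc r R, s⁻¹ *
      cubeForm σ f (profileKernel (centreProfile α) β s)) +
      ∑ j, β j * ∫ y, y.1⁻¹ * (cubeProd (fun ζ => f (y.2.1, ζ)) y.2.2 *
          sideKernel α β j y.1 (σ y.2.1 + mid y.2.2) y.2.2) ∂ν := by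
    rw [hge, integral_add (hT.const_mul α) hsumi, integral_finsetSum _ fun j _ =>
      (hD j).const_mul (β j), ← (integral_scales_eq hT).2]
    simp only [integral_const_mul]; rfl
  have gauss : ∀ s, 0 < s → Integrable (fun p : X × (Fin (k + 1) → ℝ × ℝ) =>
      cubeProd (fun ζ => f (p.1, ζ)) p.2 * (heat (α * s ^ 2) (σ p.1 + mid p.2) *
        sideWeight (fun j => β j * s ^ 2) p.2)) ∧
      |∫ p : X × (Fin (k + 1) → ℝ × ℝ),
      cubeProd (fun ζ => f (p.1, ζ)) p.2 * (heat (α * s ^ 2) (σ p.1 + mid p.2) *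
        sideWeight (fun j => β j * s ^ 2) p.2)| ≤ 1 := fun s hs => by
    have hb : ∀ (z : ℝ) (ω : Fin (k + 1) → ℝ × ℝ), |heat (α * s ^ 2) z *
        sideWeight (fun j => β j * s ^ 2) ω| ≤
        1 * (heat (α * s ^ 2) z * sideWeight (fun j => β j * s ^ 2) ω) := fun z ω => by
      rw [one_mul, abs_of_nonneg (mul_nonneg (heat_nonneg _ _) (sideWeight_nonneg _ _))]
    have hα' : 0 < α * s ^ 2 := by positivity
    have hβ' : ∀ j, 0 < β j * s ^ 2 := fun j => mul_pos (hβ j) (by positivity)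
    exact ⟨hf.integrable hα' hβ' hb (by unfold Function.uncurry; fun_prop),
      hf.abs_cubeForm_le hα' hβ' zero_le_one hb⟩
  have hgb : |∫ y, g y ∂ν| ≤ 2 := by
    have : ∫ y, g y ∂ν = (∫ p : X × (Fin (k + 1) → ℝ × ℝ),
        cubeProd (fun ζ => f (p.1, ζ)) p.2 * (heat (α * R ^ 2) (σ p.1 + mid p.2) *
        sideWeight (fun j => β j * R ^ 2) p.2)) - ∫ p : X × (Fin (k + 1) → ℝ × ℝ),
        cubeProd (fun ζ => f (p.1, ζ)) p.2 * (heat (α * r ^ 2) (σ p.1 + mid p.2) *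
        sideWeight (fun j => β j * r ^ 2) p.2) := by
      rw [integral_prod_symm _ hgi, ← integral_sub (gauss R (hr.trans hrR)).1 (gauss r hr).1]
      refine integral_congr_ae ?_
      filter_upwards [hgi.prod_left_ae] with p hp
      rw [← intervalIntegral.integral_of_le hrR.le]
      refine intervalIntegral.integral_eq_sub_of_hasDerivAt (f := fun s =>
        cubeProd (fun ζ => f (p.1, ζ)) p.2 * (heat (α * s ^ 2) (σ p.1 + mid p.2) *
          sideWeight (fun j => β j * s ^ 2) p.2)) (fun s hs => ?_)
        ((intervalIntegrable_iff_integrableOn_Ioc_of_le hrR.le).2 hp)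
      have hs0 : 0 < s := by
        rw [Set.uIcc_of_le hrR.le] at hs; exact hr.trans_le hs.1
      exact ((hasDerivAt_gaussKernel hα hβ hs0 (σ p.1 + mid p.2) p.2).const_mul _).congr_deriv
        (by simp only [hg]; ring)
    rw [this]
    have h1 := abs_le.1 (gauss R (hr.trans hrR)).2
    have h2 := abs_le.1 (gauss r hr).2
    exact abs_le.2 ⟨by linarith [h1.1, h2.2], by linarith [h1.2, h2.1]⟩
  refine ⟨(integral_scales_eq (hP j)).1, ?_⟩
  have hnn : ∀ i, 0 ≤ ∫ s in Set.Ioc r R, s⁻¹ * cubeForm σ f (pairCubeKernel α β i s) :=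
    fun i => setIntegral_nonneg measurableSet_Ioc fun s hs => mul_nonneg
      (inv_nonneg.2 (hr.trans hs.1).le) (hf.pairForm_nonneg hβ i (hαβ i) (hr.trans hs.1))
  have hsum : ∑ i, β i * ∫ s in Set.Ioc r R, s⁻¹ * cubeForm σ f (pairCubeKernel α β i s) =
      (α + (∑ i, β i) / 4) * (∫ s in Set.Ioc r R, s⁻¹ *
        cubeForm σ f (profileKernel (centreProfile α) β s)) - ∫ y, g y ∂ν := by
    simp only [hgI, hPI, mul_sub, Finset.sum_sub_distrib, ← mul_assoc, ← Finset.sum_mul]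
    ring
  have hβs : 0 ≤ ∑ i, β i := Finset.sum_nonneg fun i _ => (hβ i).le
  calc _ ≤ ∑ i, β i * ∫ s in Set.Ioc r R, s⁻¹ * cubeForm σ f (pairCubeKernel α β i s) :=
        Finset.single_le_sum (f := fun i => β i * ∫ s in Set.Ioc r R, s⁻¹ *
          cubeForm σ f (pairCubeKernel α β i s)) (fun i _ => mul_nonneg (hβ i).le (hnn i))
          (Finset.mem_univ j)
    _ ≤ _ := by
        rw [hsum]
        have := mul_le_mul_of_nonneg_left (le_abs_self (∫ s in Set.Ioc r R, s⁻¹ *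
          cubeForm σ f (profileKernel (centreProfile α) β s)))
          (by positivity : 0 ≤ α + (∑ i, β i) / 4)
        linarith [(abs_le.1 hgb).1]

end

/-! ### Hölder's inequality for simplex systems -/

lemma lintegral_pi_prod {k : ℕ} (g : Fin k → ℝ → ENNReal) (hg : ∀ j, Measurable (g j)) :
    ∫⁻ ζ : Fin k → ℝ, ∏ j, g j (ζ j) = ∏ j, ∫⁻ t, g j t := by
  induction k with
  | zero => simp [volume_pi]
  | succ k ih =>
    have e := (volume_preserving_piFinSuccAbove (fun _ : Fin (k + 1) => ℝ) 0).symm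
      (MeasurableEquiv.piFinSuccAbove _ 0)
    rw [← e.lintegral_comp (by fun_prop), Fin.prod_univ_succ, ← ih _ fun j => hg _,
      ← lintegral_prod_mul (hg 0).aemeasurable (Finset.measurable_prod _ fun j _ =>
        (hg j.succ).comp (measurable_pi_apply j)).aemeasurable]
    refine lintegral_congr fun z => ?_
    simp [MeasurableEquiv.piFinSuccAbove_symm_apply, Fin.insertNthEquiv, Fin.prod_univ_succ]

lemma measurePreserving_vertex_compl {k : ℕ} (ε : Fin k → Bool) :
    MeasurePreserving (fun ω : Fin k → ℝ × ℝ => (vertex ω ε, vertex ω fun j => !ε j))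
      volume volume := by
  have h1 := volume_preserving_pi (f := fun j : Fin k => if ε j then Prod.swap else
    (id : ℝ × ℝ → ℝ × ℝ)) fun j => by
      split_ifs
      · exact Measure.measurePreserving_swap
      · exact MeasurePreserving.id _
  have h2 := (volume_measurePreserving_arrowProdEquivProdArrow ℝ ℝ (Fin k)).comp h1
  refine (congrArg (fun f => MeasurePreserving f volume volume) ?_).mp h2
  funext ω
  refine Prod.ext ?_ ?_ <;> funext j <;>
  · simp only [vertex, MeasurableEquiv.arrowProdEquivProdArrow, Equiv.arrowProdEquivProdArrow,
      Function.comp, MeasurableEquiv.coe_mk, Equiv.coe_fn_mk]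
    by_cases hj : ε j = true <;> simp [hj]

lemma measurePreserving_insertNth_fst {m : ℕ} {Y : Type*} [MeasureSpace Y]
    [SFinite (volume : Measure Y)] (i : Fin (m + 1)) :
    MeasurePreserving (fun z : ((Fin m → ℝ) × Y) × ℝ =>
      ((i.insertNth z.2 z.1.1 : Fin (m + 1) → ℝ), z.1.2))
      ((volume : Measure ((Fin m → ℝ) × Y)).prod volume) volume := by
  have h1 := (volume_preserving_piFinSuccAbove (fun _ : Fin (m + 1) => ℝ) i).symm
    (MeasurableEquiv.piFinSuccAbove _ i)
  have h2 := measurePreserving_prod_swap_right (volume : Measure (Fin m → ℝ))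
    (volume : Measure Y) (volume : Measure ℝ)
  exact ((h1.comp Measure.measurePreserving_swap).prod (MeasurePreserving.id volume)).comp h2

/-- Integrating a function of a single vertex of a cube against a product weight in the sides. -/
lemma lintegral_vertex_mul_sides {X : Type*} [MeasureSpace X] [SFinite (volume : Measure X)]
    {k : ℕ} (ε : Fin k → Bool) {G : X × (Fin k → ℝ) → ENNReal} (hG : Measurable G)
    {h' : Fin k → ℝ → ENNReal} (hh' : ∀ j, Measurable (h' j)) :
    ∫⁻ p : X × (Fin k → ℝ × ℝ), G (p.1, vertex p.2 ε) * ∏ j, h' j ((p.2 j).1 - (p.2 j).2) =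
      (∫⁻ p, G p) * ∏ j, ∫⁻ t, h' j t := by
  have hm := (MeasurePreserving.id (volume : Measure X)).prod (measurePreserving_vertex_compl ε)
  calc _ = ∫⁻ p : X × (Fin k → ℝ × ℝ), (fun q : X × ((Fin k → ℝ) × (Fin k → ℝ)) =>
        G (q.1, q.2.1) * ∏ j, if ε j then h' j (q.2.2 j - q.2.1 j) else
          h' j (q.2.1 j - q.2.2 j)) (Prod.map id
            (fun ω : Fin k → ℝ × ℝ => (vertex ω ε, vertex ω fun j => !ε j)) p) := by
        refine lintegral_congr fun p => ?_
        simp only [Prod.map, id]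
        congr 1
        refine Finset.prod_congr rfl fun j _ => ?_
        cases hj : ε j <;> simp [vertex, hj]
    _ = ∫⁻ q : X × ((Fin k → ℝ) × (Fin k → ℝ)),
        G (q.1, q.2.1) * ∏ j, if ε j then h' j (q.2.2 j - q.2.1 j) else
          h' j (q.2.1 j - q.2.2 j) := by
        refine hm.lintegral_comp (f := fun q : X × ((Fin k → ℝ) × (Fin k → ℝ)) =>
          G (q.1, q.2.1) * ∏ j, if ε j then h' j (q.2.2 j - q.2.1 j) else
          h' j (q.2.1 j - q.2.2 j)) ?_
        refine (hG.comp (by fun_prop)).mul (Finset.measurable_prod _ fun j _ => ?_)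
        split_ifs <;> fun_prop
    _ = ∫⁻ q : (X × (Fin k → ℝ)) × (Fin k → ℝ),
        G q.1 * ∏ j, if ε j then h' j (q.2 j - q.1.2 j) else h' j (q.1.2 j - q.2 j)
          ∂(volume.prod volume) := by
        have ha := measurePreserving_prodAssoc (volume : Measure X)
          (volume : Measure (Fin k → ℝ)) (volume : Measure (Fin k → ℝ))
        refine (ha.lintegral_comp (f := fun q : X × ((Fin k → ℝ) × (Fin k → ℝ)) =>
          G (q.1, q.2.1) * ∏ j, if ε j then h' j (q.2.2 j - q.2.1 j) else
          h' j (q.2.1 j - q.2.2 j)) ?_).symm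
        refine (hG.comp (by fun_prop)).mul (Finset.measurable_prod _ fun j _ => ?_)
        split_ifs <;> fun_prop
    _ = ∫⁻ q : X × (Fin k → ℝ), G q * ∏ j, ∫⁻ t, h' j t := by
        rw [lintegral_prod]
        · refine lintegral_congr fun q => ?_
          dsimp only
          rw [lintegral_const_mul, lintegral_pi_prod fun j t =>
            if ε j then h' j (t - q.2 j) else h' j (q.2 j - t)]
          · congr 1
            refine Finset.prod_congr rfl fun j _ => ?_
            cases ε j
            · simpa using lintegral_sub_left_eq_self (h' j) (q.2 j)
            · simpa using lintegral_sub_right_eq_self (h' j) (q.2 j)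
          · intro j; split_ifs <;> fun_prop
          · refine Finset.measurable_prod _ fun j _ => ?_
            split_ifs <;> fun_prop
        · refine Measurable.aemeasurable ((hG.comp measurable_fst).mul
            (Finset.measurable_prod _ fun j _ => ?_))
          split_ifs <;> fun_prop
    _ = _ := lintegral_mul_const _ hG

/-- The weighted arithmetic–geometric mean inequality for extended norms. -/
lemma enorm_prod_le_sum {ι : Type*} [Fintype ι] (z : ι → ℝ) (p : ι → ℕ) (hp : ∀ i, p i ≠ 0)
    (hsum : ∑ i, ((p i : ℝ))⁻¹ = 1) :
    ‖∏ i, z i‖ₑ ≤ ∑ i, ENNReal.ofReal (p i : ℝ)⁻¹ * ‖z i‖ₑ ^ p i := by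
  have h := Real.geom_mean_le_arith_mean_weighted Finset.univ (fun i => ((p i : ℝ))⁻¹)
    (fun i => |z i| ^ p i) (fun i _ => by positivity) hsum (fun i _ => by positivity)
  simp only [Real.pow_rpow_inv_natCast (abs_nonneg _) (hp _)] at h
  rw [Real.enorm_eq_ofReal_abs, Finset.abs_prod]
  refine (ENNReal.ofReal_le_ofReal h).trans (le_of_eq ?_)
  rw [ENNReal.ofReal_sum_of_nonneg fun i _ => by positivity]
  refine Finset.sum_congr rfl fun i _ => ?_
  rw [ENNReal.ofReal_mul (by positivity), ENNReal.ofReal_pow (abs_nonneg _),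
    Real.enorm_eq_ofReal_abs]

/-- The Lebesgue exponent `2 ^ n` for `i = 0` and `2 ^ (n - i + 1)` for `i ≥ 1`. -/
def simplexExponent (n i : ℕ) : ℕ := 2 ^ (n + 1 - max i 1)

lemma simplexExponent_ne_zero (n i : ℕ) : simplexExponent n i ≠ 0 := by
  unfold simplexExponent; positivity

lemma sum_simplexExponent_inv {m n : ℕ} (hmn : m ≤ n) :
    ∑ i : Fin (m + 1), ((simplexExponent n i : ℕ) : ℝ)⁻¹ = 2 ^ m / 2 ^ n := by
  induction m with
  | zero => simp [simplexExponent]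
  | succ m ih =>
    rw [Fin.sum_univ_castSucc]
    have h := ih (by omega)
    simp only [Fin.val_castSucc, Fin.val_last] at h ⊢
    rw [h]
    have : (2 : ℝ) ^ n = 2 ^ m * 2 ^ (n - m) := by rw [← pow_add]; congr 1; omega
    simp only [simplexExponent, show n + 1 - max (m + 1) 1 = n - m by omega]
    push_cast
    rw [this]; field_simp; ring

/-- The product `∏ i, F i (x_0, …, x_{i-1}, x_{i+1}, …, x_m)`, with the parameter `ζ` in all
factors. -/
def simplexProd {m k : ℕ} (F : Fin (m + 1) → (Fin m → ℝ) × (Fin k → ℝ) → ℝ)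
    (p : (Fin (m + 1) → ℝ) × (Fin k → ℝ)) : ℝ := ∏ i, F i (i.removeNth p.1, p.2)

/-- A tuple of functions in the unit balls of the Lebesgue spaces with exponents
`simplexExponent (m + k) i`. -/
structure Normalized {m k : ℕ} (F : Fin (m + 1) → (Fin m → ℝ) × (Fin k → ℝ) → ℝ) : Prop where
  measurable : ∀ i, Measurable (F i)
  lintegral_le : ∀ i : Fin (m + 1), ∫⁻ p, ‖F i p‖ₑ ^ simplexExponent (m + k) i ≤ 1

lemma measurable_removeNth {m : ℕ} (i : Fin (m + 1)) :
    Measurable fun x : Fin (m + 1) → ℝ => (i.removeNth x : Fin m → ℝ) :=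
  measurable_pi_lambda _ fun _ => measurable_pi_apply _

lemma lintegral_vertex_mul_kernel {m k : ℕ} (i : Fin (m + 1)) (ε : Fin k → Bool)
    {G : (Fin m → ℝ) × (Fin k → ℝ) → ENNReal} (hG : Measurable G) {h : ℝ → ENNReal}
    (hh : Measurable h) {h' : Fin k → ℝ → ENNReal} (hh' : ∀ j, Measurable (h' j)) :
    ∫⁻ p : (Fin (m + 1) → ℝ) × (Fin k → ℝ × ℝ), G (i.removeNth p.1, vertex p.2 ε) *
      (h ((∑ l, p.1 l) + mid p.2) * ∏ j, h' j ((p.2 j).1 - (p.2 j).2)) =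
      (∫⁻ p, G p) * ((∫⁻ t, h t) * ∏ j, ∫⁻ t, h' j t) := by
  have hm := measurePreserving_insertNth_fst (Y := Fin k → ℝ × ℝ) i
  have hr := measurable_removeNth i
  have hv := measurable_vertex ε
  have hmeas : Measurable fun p : (Fin (m + 1) → ℝ) × (Fin k → ℝ × ℝ) =>
      G (i.removeNth p.1, vertex p.2 ε) *
        (h ((∑ l, p.1 l) + mid p.2) * ∏ j, h' j ((p.2 j).1 - (p.2 j).2)) :=
    (hG.comp ((hr.comp measurable_fst).prodMk (hv.comp measurable_snd))).mul (by fun_prop)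
  rw [← hm.lintegral_comp hmeas, lintegral_prod]
  · have key : ∀ q : (Fin m → ℝ) × (Fin k → ℝ × ℝ), ∫⁻ t,
        G (i.removeNth (i.insertNth t q.1 : Fin (m + 1) → ℝ), vertex q.2 ε) *
        (h ((∑ l, (i.insertNth t q.1 : Fin (m + 1) → ℝ) l) + mid q.2) *
          ∏ j, h' j ((q.2 j).1 - (q.2 j).2)) =
        (∫⁻ t, h t) * (G (q.1, vertex q.2 ε) * ∏ j, h' j ((q.2 j).1 - (q.2 j).2)) := by
      intro q
      simp only [Fin.removeNth_insertNth, Fin.sum_univ_succAbove _ i, Fin.insertNth_apply_same,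
        Fin.insertNth_apply_succAbove]
      rw [lintegral_const_mul _ (by fun_prop), lintegral_mul_const _ (by fun_prop)]
      simp only [add_assoc]
      rw [lintegral_add_right_eq_self h]
      ring
    simp only [key]
    rw [lintegral_const_mul, lintegral_vertex_mul_sides ε hG hh']
    · ring
    · exact (hG.comp (by fun_prop)).mul (by fun_prop)
  · exact (hmeas.comp hm.measurable).aemeasurable

lemma Normalized.measurable_simplexProd {m k : ℕ}
    {F : Fin (m + 1) → (Fin m → ℝ) × (Fin k → ℝ) → ℝ} (hF : Normalized F) :
    Measurable (simplexProd F) :=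
  Finset.measurable_prod _ fun i _ => (hF.measurable i).comp
    (((measurable_removeNth i).comp measurable_fst).prodMk measurable_snd)

theorem Normalized.admissible {m k : ℕ} {F : Fin (m + 1) → (Fin m → ℝ) × (Fin k → ℝ) → ℝ}
    (hF : Normalized F) : Admissible (fun x : Fin (m + 1) → ℝ => ∑ i, x i) (simplexProd F) where
  measurable_sum := by fun_prop
  measurable := hF.measurable_simplexProd
  lintegral_le h h' hh hh' := by
    set I := (∫⁻ t, h t) * ∏ j, ∫⁻ t, h' j t with hI
    have hsum : ∑ q : (Fin k → Bool) × Fin (m + 1),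
        ((simplexExponent (m + k) q.2 : ℕ) : ℝ)⁻¹ = 1 := by
      rw [Fintype.sum_prod_type]
      simp only [sum_simplexExponent_inv (Nat.le_add_right m k)]
      simp only [pow_add, Finset.sum_const, Finset.card_univ, Fintype.card_pi, Fintype.card_bool,
        Finset.prod_const, Fintype.card_fin, nsmul_eq_mul]
      push_cast
      field_simp
    have meas : ∀ q : (Fin k → Bool) × Fin (m + 1), Measurable
        fun p : (Fin (m + 1) → ℝ) × (Fin k → ℝ × ℝ) =>
          ‖F q.2 (q.2.removeNth p.1, vertex p.2 q.1)‖ₑ ^ simplexExponent (m + k) q.2 :=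
      fun q => (((hF.measurable q.2).comp (((measurable_removeNth q.2).comp
        measurable_fst).prodMk ((measurable_vertex q.1).comp measurable_snd))).enorm).pow_const _
    calc _ ≤ ∫⁻ p : (Fin (m + 1) → ℝ) × (Fin k → ℝ × ℝ),
          ∑ q : (Fin k → Bool) × Fin (m + 1),
            ENNReal.ofReal ((simplexExponent (m + k) q.2 : ℕ) : ℝ)⁻¹ *
            (‖F q.2 (q.2.removeNth p.1, vertex p.2 q.1)‖ₑ ^ simplexExponent (m + k) q.2 *
            (h ((∑ l, p.1 l) + mid p.2) * ∏ j, h' j ((p.2 j).1 - (p.2 j).2))) := by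
          refine lintegral_mono fun p => ?_
          simp only [← mul_assoc _ _ (h _ * _), ← Finset.sum_mul]
          gcongr
          have := enorm_prod_le_sum (fun q : (Fin k → Bool) × Fin (m + 1) =>
            F q.2 (q.2.removeNth p.1, vertex p.2 q.1)) (fun q => simplexExponent (m + k) q.2)
            (fun q => simplexExponent_ne_zero _ _) hsum
          rw [Fintype.prod_prod_type] at this
          exact this
      _ = ∑ q : (Fin k → Bool) × Fin (m + 1),
            ENNReal.ofReal ((simplexExponent (m + k) q.2 : ℕ) : ℝ)⁻¹ *
            ((∫⁻ p, ‖F q.2 p‖ₑ ^ simplexExponent (m + k) q.2) * I) := by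
          rw [lintegral_finsetSum]
          · refine Finset.sum_congr rfl fun q _ => ?_
            rw [lintegral_const_mul' _ _ ENNReal.ofReal_ne_top,
              ← lintegral_vertex_mul_kernel q.2 q.1 ((hF.measurable q.2).enorm.pow_const _) hh hh']
          · exact fun q _ => ((meas q).mul (by fun_prop)).const_mul _
      _ ≤ ∑ q : (Fin k → Bool) × Fin (m + 1),
            ENNReal.ofReal ((simplexExponent (m + k) q.2 : ℕ) : ℝ)⁻¹ * (1 * I) := by
          gcongr with q
          exact hF.lintegral_le q.2
      _ = I := by
          rw [← Finset.sum_mul, ← ENNReal.ofReal_sum_of_nonneg fun _ _ => by positivity, hsum]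
          simp

/-- The square of a function in the unit ball of `L ^ (2 ^ (k + 1))`, multiplied over all vertices
of a `k`-dimensional cube and weighted by Gaussians in the sides, has integral at most one. -/
lemma lintegral_cubeProd_sq_le {X : Type*} [MeasureSpace X] [SFinite (volume : Measure X)]
    {k : ℕ} {b : X × (Fin k → ℝ) → ℝ} (hb : Measurable b)
    (hb1 : ∫⁻ p, ‖b p‖ₑ ^ 2 ^ (k + 1) ≤ 1) {B : Fin k → ℝ} (hB : ∀ j, 0 < B j) :
    ∫⁻ q : X × (Fin k → ℝ × ℝ), ‖cubeProd (fun ζ => b (q.1, ζ)) q.2‖ₑ ^ 2 *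
      ENNReal.ofReal (sideWeight B q.2) ≤ 1 := by
  have hsum : ∑ _ε : Fin k → Bool, (((2 ^ k : ℕ) : ℝ))⁻¹ = 1 := by simp
  calc _ ≤ ∫⁻ q : X × (Fin k → ℝ × ℝ), ∑ ε : Fin k → Bool,
        ENNReal.ofReal ((2 ^ k : ℕ) : ℝ)⁻¹ * (‖b (q.1, vertex q.2 ε)‖ₑ ^ 2 ^ (k + 1) *
          ∏ j, ENNReal.ofReal (heat (B j) ((q.2 j).1 - (q.2 j).2))) := by
        refine lintegral_mono fun q => ?_
        simp only [← mul_assoc _ _ (∏ j, _), ← Finset.sum_mul]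
        rw [sideWeight, ENNReal.ofReal_prod_of_nonneg fun _ _ => heat_nonneg _ _]
        gcongr
        have := enorm_prod_le_sum (fun ε : Fin k → Bool => b (q.1, vertex q.2 ε) ^ 2)
          (fun _ => 2 ^ k) (fun _ => by positivity) hsum
        rw [Finset.prod_pow, enorm_pow] at this
        refine this.trans (le_of_eq ?_)
        refine Finset.sum_congr rfl fun ε _ => ?_
        rw [enorm_pow, ← pow_mul, pow_succ']
    _ = ∑ _ε : Fin k → Bool, ENNReal.ofReal ((2 ^ k : ℕ) : ℝ)⁻¹ *
          (∫⁻ p, ‖b p‖ₑ ^ 2 ^ (k + 1)) := by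
        rw [lintegral_finsetSum]
        · refine Finset.sum_congr rfl fun ε _ => ?_
          rw [lintegral_const_mul' _ _ ENNReal.ofReal_ne_top,
            lintegral_vertex_mul_sides ε (hb.enorm.pow_const _)
              (h' := fun j t => ENNReal.ofReal (heat (B j) t)) (fun j => by fun_prop)]
          simp [lintegral_heat (hB _)]
        · exact fun ε _ => ((((hb.comp (measurable_fst.prodMk ((measurable_vertex ε).comp
            measurable_snd))).enorm).pow_const _).mul (by fun_prop)).const_mul _
    _ ≤ ∑ _ε : Fin k → Bool, ENNReal.ofReal ((2 ^ k : ℕ) : ℝ)⁻¹ * 1 := by gcongr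
    _ = 1 := by
        rw [← Finset.sum_mul, ← ENNReal.ofReal_sum_of_nonneg fun _ _ => by positivity, hsum]
        simp

/-! ### Elimination of one function -/

/-- The system obtained by discarding the last function and doubling the last variable, which
becomes the parameter with index `0`. -/
def reduceSystem {m k : ℕ} (F : Fin (m + 2) → (Fin (m + 1) → ℝ) × (Fin k → ℝ) → ℝ)
    (i : Fin (m + 1)) (p : (Fin m → ℝ) × (Fin (k + 1) → ℝ)) : ℝ :=
  F i.castSucc ((Fin.last m).insertNth (p.2 0) p.1, fun j => p.2 j.succ)

lemma removeNth_insertNth_last {m : ℕ} (i : Fin (m + 1)) (x : Fin (m + 1) → ℝ) (t : ℝ) :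
    i.castSucc.removeNth ((Fin.last (m + 1)).insertNth t x : Fin (m + 2) → ℝ) =
      ((Fin.last m).insertNth t (i.removeNth x) : Fin (m + 1) → ℝ) := by
  ext j
  refine Fin.lastCases ?_ (fun j => ?_) j
  · simp [Fin.removeNth]
  · simp [Fin.removeNth, Fin.insertNth_last', Fin.castSucc_succAbove_castSucc]

lemma simplexProd_insertNth_last {m k : ℕ} (F : Fin (m + 2) → (Fin (m + 1) → ℝ) × (Fin k → ℝ) → ℝ)
    (x : Fin (m + 1) → ℝ) (t : ℝ) (ζ : Fin k → ℝ) :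
    simplexProd F ((Fin.last (m + 1)).insertNth t x, ζ) =
      simplexProd (reduceSystem F) (x, Fin.insertNth 0 t ζ) * F (Fin.last (m + 1)) (x, ζ) := by
  simp only [simplexProd, Fin.prod_univ_castSucc (n := m + 1), reduceSystem,
    removeNth_insertNth_last, Fin.removeNth_insertNth]
  simp

lemma measurePreserving_reduce (m k : ℕ) :
    MeasurePreserving (fun p : (Fin m → ℝ) × (Fin (k + 1) → ℝ) =>
      (((Fin.last m).insertNth (p.2 0) p.1 : Fin (m + 1) → ℝ), fun j => p.2 (Fin.succ j)))
      volume volume := by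
  have h1 := (MeasurePreserving.id (volume : Measure (Fin m → ℝ))).prod
    (Measure.measurePreserving_swap.comp
      (volume_preserving_piFinSuccAbove (fun _ : Fin (k + 1) => ℝ) 0))
  have h2 := (measurePreserving_prodAssoc (volume : Measure (Fin m → ℝ))
    (volume : Measure (Fin k → ℝ)) (volume : Measure ℝ)).symm MeasurableEquiv.prodAssoc
  exact ((measurePreserving_insertNth_fst (Y := Fin k → ℝ) (Fin.last m)).comp h2).comp h1

lemma Normalized.reduce {m k : ℕ} {F : Fin (m + 2) → (Fin (m + 1) → ℝ) × (Fin k → ℝ) → ℝ}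
    (hF : Normalized F) : Normalized (reduceSystem F) where
  measurable i := (hF.measurable _).comp (measurePreserving_reduce m k).measurable
  lintegral_le i := by
    have h := hF.lintegral_le i.castSucc
    rw [← (measurePreserving_reduce m k).lintegral_comp
      ((hF.measurable _).enorm.pow_const _)] at h
    rwa [show m + 1 + k = m + (k + 1) by ring] at h

/-- A cancelling kernel is a convolution of the derivative of the heat kernel with a kernel
dominated by a Gaussian. -/
lemma Cancelling.exists_conv {w : ℝ} {φ : ℝ → ℝ → ℝ} (hφ : Cancelling w φ) (hw : 0 < w) :
    ∃ C : ℝ, 0 ≤ C ∧ ∀ s, 0 < s → ∃ E : ℝ → ℝ, Measurable E ∧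
      (∀ t, |E t| ≤ C * heat (4 * (w * s ^ 2)) t) ∧
      ∀ t u, φ s (t + u) = ∫ v, s * heat1 (w * s ^ 2) (t + v) * E (u - v) := by
  obtain ⟨C, κ, hC, hκ, h⟩ := hφ
  refine ⟨C * (√2 / √w), by positivity, fun s hs => ?_⟩
  obtain ⟨hb, hrep⟩ := h s hs
  have hκs := hκ s
  have hv : 0 < 2 * (w * s ^ 2) := by positivity
  refine ⟨fun y => ∫ v', κ s v' * (s * heat1 (w * s ^ 2) (y - v')), ?_, fun t => ?_,
    fun t u => ?_⟩
  · exact (StronglyMeasurable.integral_prod_right (f := fun (y v' : ℝ) =>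
      κ s v' * (s * heat1 (w * s ^ 2) (y - v'))) (Measurable.stronglyMeasurable (by
        unfold Function.uncurry; fun_prop))).measurable
  · have e := integral_heat_mul_heat hv hv t 0
    rw [show 2 * (w * s ^ 2) + 2 * (w * s ^ 2) = 4 * (w * s ^ 2) by ring, add_zero] at e
    rw [← e, ← integral_const_mul, ← Real.norm_eq_abs]
    refine norm_integral_le_of_norm_le (Integrable.const_mul (Integrable.of_integral_ne_zero ?_) _)
      (ae_of_all _ fun v => ?_)
    · rw [e]; exact (heat_pos (by positivity) _).ne'
    · rw [Real.norm_eq_abs, abs_mul, add_zero]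
      calc _ ≤ (C * heat (2 * (w * s ^ 2)) v) * (√2 / √w * heat (2 * (w * s ^ 2)) (t - v)) :=
            mul_le_mul (hb _) (abs_mul_heat1_le hw hs _) (abs_nonneg _)
              (mul_nonneg hC (heat_nonneg _ _))
        _ = _ := by ring
  · rw [hrep]
    congr 1; ext v; congr 1
    dsimp only
    rw [← integral_sub_right_eq_self (fun v' => κ s v' * (s * heat1 (w * s ^ 2) (u - v - v'))) v]
    congr 1; ext v'
    rw [show u - v - (v' - v) = u - v' by ring]

/-- One Cauchy–Schwarz step: the last function is eliminated and the last variable is doubled. -/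
theorem Cancelling.abs_cubeForm_le {w : ℝ} {φ : ℝ → ℝ → ℝ} (hφ : Cancelling w φ) (hw : 0 < w) :
    ∃ C : ℝ, 0 ≤ C ∧ ∀ {m k : ℕ} {F : Fin (m + 2) → (Fin (m + 1) → ℝ) × (Fin k → ℝ) → ℝ},
      Normalized F → ∀ {β : Fin k → ℝ}, (∀ j, 0 < β j) → ∀ s l : ℝ, 0 < s → 0 < l →
      |cubeForm (fun x => ∑ i, x i) (simplexProd F) (profileKernel φ β s)| ≤
        C * (l + l⁻¹ * cubeForm (fun x => ∑ i, x i) (simplexProd (reduceSystem F))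
          (pairCubeKernel (9 / 2 * w) (Fin.insertNth 0 (2 * w) β) 0 s)) := by
  obtain ⟨C, hC, h⟩ := hφ.exists_conv hw
  refine ⟨C, hC, fun {m k F} hF {β} hβ s l hs hl => ?_⟩
  obtain ⟨E, hE, hEb, hrep⟩ := h s hs
  have hv : 0 < w * s ^ 2 := by positivity
  have hF' := hF.reduce
  have hβ' : ∀ j, 0 < (Fin.insertNth 0 (2 * w) β : Fin (k + 1) → ℝ) j := by
    intro j
    refine Fin.cases ?_ (fun j => ?_) j
    · simpa using hw
    · simpa using hβ j
  have hm := measurePreserving_insertNth_fst (Y := Fin k → ℝ × ℝ) (Fin.last (m + 1))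
  have hβs : ∀ j, 0 < β j * s ^ 2 := fun j => mul_pos (hβ j) (by positivity)
  set a : ((Fin (m + 1) → ℝ) × (Fin k → ℝ × ℝ)) × ℝ → ℝ := fun z =>
    cubeProd (fun ζ => simplexProd (reduceSystem F) (z.1.1, Fin.insertNth 0 z.2 ζ)) z.1.2 with ha
  set b : (Fin (m + 1) → ℝ) × (Fin k → ℝ × ℝ) → ℝ := fun q =>
    cubeProd (fun ζ => F (Fin.last (m + 1)) (q.1, ζ)) q.2 with hb
  have ham : Measurable a := measurable_cubeProd_insertNth hF'.measurable_simplexProd 0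
  have hbm : Measurable b := measurable_cubeProd (hF.measurable _)
  have hab : ∀ z : ((Fin (m + 1) → ℝ) × (Fin k → ℝ × ℝ)) × ℝ,
      cubeProd (fun ζ => simplexProd F ((Fin.last (m + 1)).insertNth z.2 z.1.1, ζ)) z.1.2 =
      a z * b z.1 := fun z => by
    simp only [simplexProd_insertNth_last]
    simp only [ha, hb, cubeProd, Finset.prod_mul_distrib]
  have hsum : ∀ z : ((Fin (m + 1) → ℝ) × (Fin k → ℝ × ℝ)) × ℝ,
      ∑ i, ((Fin.last (m + 1)).insertNth z.2 z.1.1 : Fin (m + 2) → ℝ) i = z.2 + ∑ i, z.1.1 i :=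
    fun z => by simp [Fin.sum_univ_succAbove _ (Fin.last (m + 1))]
  -- the pair form of the reduced system is the integral of squares
  obtain ⟨hJ, hJe⟩ := hF'.admissible.pairForm_eq (α := 9 / 2 * w)
    (β := Fin.insertNth 0 (2 * w) β) hβ' 0 (by simp; linarith) hs
  have hsq : squareIntegrand (fun x : Fin (m + 1) → ℝ => ∑ i, x i)
      (simplexProd (reduceSystem F)) (9 / 2 * w) (Fin.insertNth 0 (2 * w) β) 0 s = fun y =>
      sideWeight (fun j => β j * s ^ 2) y.1.2 *
        heat (4 * (w * s ^ 2)) ((∑ i, y.1.1 i) + mid y.1.2 - y.2) *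
        (∫ t, a (y.1, t) * heat1 (w * s ^ 2) (t + y.2)) ^ 2 := by
    ext y
    simp only [squareIntegrand, Fin.insertNth_apply_same, Fin.insertNth_apply_succAbove]
    rw [show (9 / 2 * w - 2 * w / 4) * s ^ 2 = 4 * (w * s ^ 2) by ring,
      show 2 * w / 2 * s ^ 2 = w * s ^ 2 by ring]
  rw [hsq] at hJ hJe
  have hfin := hF.admissible.lintegral_enorm_le (K := fun z ω => heat (6 * (w * s ^ 2)) z *
    sideWeight (fun j => β j * s ^ 2) ω) (A := 6 * (w * s ^ 2)) (C := 1)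
    (by positivity) hβs
    (fun z ω => by rw [one_mul, abs_of_nonneg (mul_nonneg (heat_nonneg _ _)
      (sideWeight_nonneg _ _))])
  have hcm := measurable_cubeProd hF.measurable_simplexProd
  rw [← hm.map_eq, lintegral_map' (by fun_prop) hm.measurable.aemeasurable] at hfin
  simp only [hab, hsum] at hfin
  have key := abs_integral_mul_conv_le (μ := (volume : Measure ((Fin (m + 1) → ℝ) ×
    (Fin k → ℝ × ℝ)))) ham hbm (u := fun q => (∑ i, q.1 i) + mid q.2)
    (W := fun q => sideWeight (fun j => β j * s ^ 2) q.2) (by fun_prop) (by fun_prop)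
    (fun q => sideWeight_nonneg _ _) (φ := φ s) hE (B := 1) hv hC hl hrep hEb (by
      refine ne_top_of_le_ne_top ENNReal.ofReal_ne_top (le_trans (le_of_eq ?_) hfin)
      refine lintegral_congr fun p => ?_
      rw [enorm_mul (a p * b p.1), Real.enorm_of_nonneg (mul_nonneg (heat_nonneg _ _)
        (sideWeight_nonneg _ _)), add_assoc]) zero_le_one (by
      rw [ENNReal.ofReal_one]
      refine lintegral_cubeProd_sq_le (hF.measurable _) ?_ hβs
      have := hF.lintegral_le (Fin.last (m + 1))
      rwa [simplexExponent, Fin.val_last,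
        show m + 1 + k + 1 - max (m + 1) 1 = k + 1 by omega] at this) hJ
  rw [hJe]
  rw [mul_one] at key
  refine le_trans (le_of_eq ?_) key
  congr 1
  rw [cubeForm, ← hm.map_eq, integral_map hm.measurable.aemeasurable]
  · refine integral_congr_ae (ae_of_all _ fun p => ?_)
    dsimp only
    rw [hab, hsum, profileKernel, add_assoc]
  · have hφm : Measurable (φ s) := by
      have : φ s = fun t => ∫ v, s * heat1 (w * s ^ 2) (t + v) * E (0 - v) := by
        ext t; rw [← hrep, add_zero]
      rw [this]
      exact (StronglyMeasurable.integral_prod_right (f := fun (t v : ℝ) =>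
        s * heat1 (w * s ^ 2) (t + v) * E (0 - v)) (Measurable.stronglyMeasurable (by
        unfold Function.uncurry; fun_prop))).measurable
    unfold profileKernel
    exact Measurable.aestronglyMeasurable (by fun_prop)

/-! ### Elimination of both functions in degree one -/

lemma integrable_of_integrable_mul_heat_shift {Q : Type*} [MeasurableSpace Q] {μ : Measure Q}
    {g : Q → ℝ} (hg : Measurable g) {c : Q → ℝ} (hc : Measurable c) {τ : ℝ} (hτ : 0 < τ)
    (h : Integrable (fun y : Q × ℝ => g y.1 * heat τ (c y.1 - y.2)) (μ.prod volume)) :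
    Integrable g μ := by
  refine ⟨hg.aestronglyMeasurable, ?_⟩
  have h2 := h.2
  rw [hasFiniteIntegral_iff_enorm] at h2 ⊢
  simp only [enorm_mul, Real.enorm_of_nonneg (heat_nonneg _ _)] at h2
  rwa [lintegral_mul_heat_shift (g := fun q => ‖g q‖ₑ) (by fun_prop) hc hτ] at h2

lemma measurePreserving_const_fst (Y : Type*) [MeasureSpace Y] [SFinite (volume : Measure Y)] :
    MeasurePreserving (fun z : (Y × ℝ) × ℝ => (((fun _ => z.2 : Fin 1 → ℝ), z.1.1), z.1.2))
      ((volume : Measure (Y × ℝ)).prod volume) volume := by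
  have h0 := (volume_preserving_funUnique (Fin 1) ℝ).symm (MeasurableEquiv.funUnique (Fin 1) ℝ)
  have h1 := (Measure.measurePreserving_swap (μ := (volume : Measure (Y × ℝ)))
    (ν := (volume : Measure ℝ)))
  have h2 := (measurePreserving_prodAssoc (volume : Measure (Fin 1 → ℝ)) (volume : Measure Y)
    (volume : Measure ℝ)).symm MeasurableEquiv.prodAssoc
  exact (h2.comp (h0.prod (MeasurePreserving.id _))).comp h1

/-- The pair form of a reduced system of degree zero is a diagonal form. -/
lemma Normalized.pairForm_reduce_eq {k : ℕ} {F : Fin 2 → (Fin 1 → ℝ) × (Fin k → ℝ) → ℝ}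
    (hF : Normalized F) {w s : ℝ} (hw : 0 < w) {β : Fin k → ℝ} (hβ : ∀ j, 0 < β j) (hs : 0 < s) :
    Integrable (fun y : (Fin k → ℝ × ℝ) × ℝ => sideWeight (fun j => β j * s ^ 2) y.1 *
      (∫ t, cubeProd (fun ζ => F 0 (fun _ => t, ζ)) y.1 * heat1 (w * s ^ 2) (t + y.2)) ^ 2) ∧
    cubeForm (fun x => ∑ i, x i) (simplexProd (reduceSystem F))
      (pairCubeKernel (9 / 2 * w) (Fin.insertNth 0 (2 * w) β) 0 s) =
    s ^ 2 * ∫ y : (Fin k → ℝ × ℝ) × ℝ, sideWeight (fun j => β j * s ^ 2) y.1 *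
      (∫ t, cubeProd (fun ζ => F 0 (fun _ => t, ζ)) y.1 * heat1 (w * s ^ 2) (t + y.2)) ^ 2 := by
  have hF' := hF.reduce
  have hβ' : ∀ j, 0 < (Fin.insertNth 0 (2 * w) β : Fin (k + 1) → ℝ) j := by
    intro j
    refine Fin.cases ?_ (fun j => ?_) j
    · simpa using hw
    · simpa using hβ j
  obtain ⟨hJ, hJe⟩ := hF'.admissible.pairForm_eq (α := 9 / 2 * w)
    (β := Fin.insertNth 0 (2 * w) β) hβ' 0 (by simp; linarith) hs
  set g : (Fin k → ℝ × ℝ) × ℝ → ℝ := fun y => sideWeight (fun j => β j * s ^ 2) y.1 *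
    (∫ t, cubeProd (fun ζ => F 0 (fun _ => t, ζ)) y.1 * heat1 (w * s ^ 2) (t + y.2)) ^ 2 with hg
  have ham : Measurable fun z : (Fin k → ℝ × ℝ) × ℝ =>
      cubeProd (fun ζ => F 0 (fun _ => z.2, ζ)) z.1 := by
    unfold cubeProd
    exact Finset.measurable_prod _ fun ε _ => (hF.measurable 0).comp
      ((measurable_pi_lambda _ fun _ => measurable_snd).prodMk
        ((measurable_vertex ε).comp measurable_fst))
  have hgm : Measurable g := by
    have := measurable_integral_mul_heat1 ham (w * s ^ 2)
    fun_prop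
  have hv : 0 < 4 * (w * s ^ 2) := by positivity
  have hm := measurePreserving_const_fst (Fin k → ℝ × ℝ)
  have hpoint : ∀ z : ((Fin k → ℝ × ℝ) × ℝ) × ℝ,
      squareIntegrand (fun x : Fin 1 → ℝ => ∑ i, x i) (simplexProd (reduceSystem F)) (9 / 2 * w)
        (Fin.insertNth 0 (2 * w) β) 0 s (((fun _ => z.2 : Fin 1 → ℝ), z.1.1), z.1.2) =
      g z.1 * heat (4 * (w * s ^ 2)) (z.1.2 - mid z.1.1 - z.2) := fun z => by
    have e : ∀ (t : ℝ) (ζ : Fin k → ℝ), simplexProd (reduceSystem F)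
        ((fun _ => z.2 : Fin 1 → ℝ), Fin.insertNth 0 t ζ) = F 0 (fun _ => t, ζ) := by
      intro t ζ
      refine (Fin.prod_univ_one _).trans (congrArg (F 0) (Prod.ext ?_ ?_))
      · ext j; rw [Fin.fin_one_eq_zero j]; rfl
      · ext j; simp
    simp only [squareIntegrand, Fin.insertNth_apply_same, Fin.insertNth_apply_succAbove, e, hg]
    rw [show (9 / 2 * w - 2 * w / 4) * s ^ 2 = 4 * (w * s ^ 2) by ring,
      show 2 * w / 2 * s ^ 2 = w * s ^ 2 by ring, ← heat_neg]
    simp only [Finset.univ_unique, Finset.sum_const, Finset.card_singleton, one_smul]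
    rw [show -(z.2 + mid z.1.1 - z.1.2) = z.1.2 - mid z.1.1 - z.2 by ring]
    ring
  have hJ' := hm.integrable_comp_of_integrable hJ
  have hJ'' : Integrable (fun z : ((Fin k → ℝ × ℝ) × ℝ) × ℝ =>
      g z.1 * heat (4 * (w * s ^ 2)) (z.1.2 - mid z.1.1 - z.2)) (volume.prod volume) :=
    hJ'.congr (ae_of_all _ hpoint)
  have hc : Measurable fun y : (Fin k → ℝ × ℝ) × ℝ => y.2 - mid y.1 := by fun_prop
  have hgi := integrable_of_integrable_mul_heat_shift hgm hc hv hJ''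
  refine ⟨hgi, ?_⟩
  rw [hJe, ← integral_mul_heat_shift hgm hgi hc hv, ← hm.integral_comp_of_integrable
    hJ.aestronglyMeasurable]
  congr 1
  exact integral_congr_ae (ae_of_all _ hpoint)

lemma Normalized.rev {k : ℕ} {F : Fin 2 → (Fin 1 → ℝ) × (Fin k → ℝ) → ℝ} (hF : Normalized F) :
    Normalized fun i => F i.rev where
  measurable i := hF.measurable _
  lintegral_le i := by
    have h := hF.lintegral_le i.rev
    fin_cases i <;> simpa [simplexExponent] using h

lemma measurePreserving_pair_fst (Y : Type*) [MeasureSpace Y] [SFinite (volume : Measure Y)] :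
    MeasurePreserving (fun z : Y × (ℝ × ℝ) => (![z.2.2, z.2.1], z.1))
      (volume.prod volume) volume := by
  have h0 := (volume_preserving_finTwoArrow ℝ).symm MeasurableEquiv.finTwoArrow
  have h1 := (Measure.measurePreserving_swap (μ := (volume : Measure Y))
    (ν := (volume : Measure (ℝ × ℝ))))
  have h2 := (h0.comp Measure.measurePreserving_swap).prod
    (MeasurePreserving.id (volume : Measure Y))
  exact h2.comp h1

/-- In degree one both functions carry a derivative, and no logarithm is lost. -/
theorem Cancelling.abs_cubeForm_one_le {w : ℝ} {φ : ℝ → ℝ → ℝ} (hφ : Cancelling w φ)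
    (hw : 0 < w) :
    ∃ C : ℝ, 0 ≤ C ∧ ∀ {k : ℕ} {F : Fin 2 → (Fin 1 → ℝ) × (Fin k → ℝ) → ℝ},
      Normalized F → ∀ {β : Fin k → ℝ}, (∀ j, 0 < β j) → ∀ s : ℝ, 0 < s →
      |cubeForm (fun x => ∑ i, x i) (simplexProd F) (profileKernel φ β s)| ≤
        C * (cubeForm (fun x => ∑ i, x i) (simplexProd (reduceSystem F))
          (pairCubeKernel (9 / 2 * w) (Fin.insertNth 0 (2 * w) β) 0 s) +
        cubeForm (fun x => ∑ i, x i) (simplexProd (reduceSystem fun i => F i.rev))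
          (pairCubeKernel (9 / 2 * w) (Fin.insertNth 0 (2 * w) β) 0 s)) := by
  obtain ⟨_, _, hconv⟩ := hφ.exists_conv hw
  obtain ⟨C, κ, hC, hκ, h⟩ := hφ
  refine ⟨C, hC, fun {k F} hF {β} hβ s hs => ?_⟩
  obtain ⟨hκb, hrep⟩ := h s hs
  have hv : 0 < w * s ^ 2 := by positivity
  have hβs : ∀ j, 0 < β j * s ^ 2 := fun j => mul_pos (hβ j) (by positivity)
  obtain ⟨ia, ea⟩ := hF.pairForm_reduce_eq hw hβ hs
  obtain ⟨ib, eb⟩ := hF.rev.pairForm_reduce_eq hw hβ hs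
  have hm := measurePreserving_pair_fst (Fin k → ℝ × ℝ)
  have ham : ∀ i, Measurable fun z : (Fin k → ℝ × ℝ) × ℝ =>
      cubeProd (fun ζ => F i (fun _ => z.2, ζ)) z.1 := fun i => by
    unfold cubeProd
    exact Finset.measurable_prod _ fun ε _ => (hF.measurable i).comp
      ((measurable_pi_lambda _ fun _ => measurable_snd).prodMk
        ((measurable_vertex ε).comp measurable_fst))
  have hprod : ∀ z : (Fin k → ℝ × ℝ) × (ℝ × ℝ),
      cubeProd (fun ζ => simplexProd F (![z.2.2, z.2.1], ζ)) z.1 =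
        cubeProd (fun ζ => F 0 (fun _ => z.2.1, ζ)) z.1 *
        cubeProd (fun ζ => F 1 (fun _ => z.2.2, ζ)) z.1 := fun z => by
    have e0 : (Fin.removeNth 0 ![z.2.2, z.2.1] : Fin 1 → ℝ) = fun _ => z.2.1 := by
      ext j; rw [Fin.fin_one_eq_zero j]; rfl
    have e1 : (Fin.removeNth 1 ![z.2.2, z.2.1] : Fin 1 → ℝ) = fun _ => z.2.2 := by
      ext j; rw [Fin.fin_one_eq_zero j]; rfl
    have e : ∀ ζ, simplexProd F (![z.2.2, z.2.1], ζ) =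
        F 0 (fun _ => z.2.1, ζ) * F 1 (fun _ => z.2.2, ζ) := fun ζ => by
      rw [← e0, ← e1]; exact Fin.prod_univ_two _
    simp only [e, cubeProd, Finset.prod_mul_distrib]
  have hsum : ∀ z : (Fin k → ℝ × ℝ) × (ℝ × ℝ), ∑ i, ![z.2.2, z.2.1] i = z.2.2 + z.2.1 :=
    fun z => by simp [Fin.sum_univ_two]
  have hfin := hF.admissible.lintegral_enorm_le (K := fun z ω => heat (6 * (w * s ^ 2)) z *
    sideWeight (fun j => β j * s ^ 2) ω) (A := 6 * (w * s ^ 2)) (C := 1) (by positivity) hβs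
    (fun z ω => by rw [one_mul, abs_of_nonneg (mul_nonneg (heat_nonneg _ _)
      (sideWeight_nonneg _ _))])
  have hcm := measurable_cubeProd hF.measurable_simplexProd
  rw [← hm.map_eq, lintegral_map' (by fun_prop) hm.measurable.aemeasurable] at hfin
  simp only [hprod, hsum] at hfin
  have hassoc : ∀ z : (Fin k → ℝ × ℝ) × (ℝ × ℝ), z.2.2 + z.2.1 + mid z.1 =
      z.2.1 + (z.2.2 + mid z.1) := fun z => by ring
  have key := abs_integral_mul_conv_conv_le (μ := (volume : Measure (Fin k → ℝ × ℝ)))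
    (ham 0) (ham 1) (u := mid) (W := sideWeight (fun j => β j * s ^ 2)) (by fun_prop)
    (by fun_prop) (fun q => sideWeight_nonneg _ _) (φ := φ s) (hκ s) hv hC hrep hκb (by
      refine ne_top_of_le_ne_top ENNReal.ofReal_ne_top (le_trans (le_of_eq ?_) hfin)
      refine lintegral_congr fun p => ?_
      rw [enorm_mul (cubeProd _ _ * cubeProd _ _), Real.enorm_of_nonneg (mul_nonneg
        (heat_nonneg _ _) (sideWeight_nonneg _ _)), hassoc]) ia ib
  rw [ea, eb]
  refine le_trans (le_of_eq ?_) key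
  congr 1
  rw [cubeForm, ← hm.map_eq, integral_map hm.measurable.aemeasurable]
  · refine integral_congr_ae (ae_of_all _ fun p => ?_)
    dsimp only
    rw [hprod, hsum, profileKernel, hassoc]
  · obtain ⟨E, hE, -, hE'⟩ := hconv s hs
    have hφm : Measurable (φ s) := by
      have : φ s = fun t => ∫ v, s * heat1 (w * s ^ 2) (t + v) * E (0 - v) := by
        ext t; rw [← hE', add_zero]
      rw [this]
      exact (StronglyMeasurable.integral_prod_right (f := fun (t v : ℝ) =>
        s * heat1 (w * s ^ 2) (t + v) * E (0 - v)) (Measurable.stronglyMeasurable (by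
        unfold Function.uncurry; fun_prop))).measurable
    unfold profileKernel
    exact Measurable.aestronglyMeasurable (by fun_prop)

/-! ### Induction on the degree -/

/-- The power of the logarithm lost in degree `m`. -/
noncomputable def growthExponent : ℕ → ℝ
  | 0 => 0
  | m + 1 => 1 - (1 / 2) ^ m

lemma growthExponent_nonneg (m : ℕ) : 0 ≤ growthExponent m := by
  cases m with
  | zero => exact le_rfl
  | succ m => exact sub_nonneg.2 (pow_le_one₀ (by norm_num) (by norm_num))

lemma growthExponent_le_one (m : ℕ) : growthExponent m ≤ 1 := by
  cases m with
  | zero => exact zero_le_one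
  | succ m => exact sub_le_self _ (by positivity)

lemma growthExponent_add_two (m : ℕ) :
    growthExponent (m + 2) = (1 + growthExponent (m + 1)) / 2 := by
  simp only [growthExponent, pow_succ]; ring

/-- The number of scales between `r` and `R`, bounded below by `1`. -/
noncomputable def scaleCount (r R : ℝ) : ℝ := max 1 (Real.log (R / r))

lemma one_le_scaleCount (r R : ℝ) : 1 ≤ scaleCount r R := le_max_left _ _

lemma one_le_scaleCount_rpow (r R : ℝ) (m : ℕ) : 1 ≤ scaleCount r R ^ growthExponent m :=
  Real.one_le_rpow (one_le_scaleCount r R) (growthExponent_nonneg m)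

/-- The bound in degree `m` for a pair form integrated over scales. -/
def PairBound (m : ℕ) : Prop :=
  ∀ (k : ℕ) (α : ℝ) (β : Fin (k + 1) → ℝ), 0 < α → (∀ j, 0 < β j) → (∀ j, β j < 4 * α) →
    ∃ C : ℝ, 0 ≤ C ∧ ∀ F : Fin (m + 1) → (Fin m → ℝ) × (Fin (k + 1) → ℝ) → ℝ, Normalized F →
      ∀ r R : ℝ, 0 < r → r < R →
        ∫ s in Set.Ioc r R, s⁻¹ * cubeForm (fun x => ∑ i, x i) (simplexProd F)
          (pairCubeKernel α β 0 s) ≤ C * scaleCount r R ^ growthExponent m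

/-- The bound in degree `m` for forms with a cancelling profile, integrated over scales with
absolute values. -/
def ProfileBound (m : ℕ) : Prop :=
  ∀ (k : ℕ) (w : ℝ) (φ : ℝ → ℝ → ℝ) (β : Fin k → ℝ), 0 < w → Cancelling w φ → (∀ j, 0 < β j) →
    (∀ j, β j < 18 * w) →
    ∃ C : ℝ, 0 ≤ C ∧ ∀ F : Fin (m + 1) → (Fin m → ℝ) × (Fin k → ℝ) → ℝ, Normalized F →
      ∀ r R : ℝ, 0 < r → r < R →
        ∫ s in Set.Ioc r R, s⁻¹ * |cubeForm (fun x => ∑ i, x i) (simplexProd F)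
          (profileKernel φ β s)| ≤ C * scaleCount r R ^ growthExponent m

lemma integral_heat2_add {v : ℝ} (hv : 0 < v) (c : ℝ) : ∫ t, heat2 v (t + c) = 0 := by
  have h := integral_cubic_mul_heat hv (-c) (-(1 / v)) 0 (1 / v ^ 2) 0
  rw [show -(1 / v) + 1 / v ^ 2 * v = 0 by field_simp; ring] at h
  rw [← h]
  congr 1; ext t
  simp only [heat2, sub_neg_eq_add]; ring

/-- In degree zero the form with the profile `centreProfile` vanishes, since the only function does
not depend on the variable that is integrated. -/
lemma cubeForm_centreProfile_eq_zero {k : ℕ} {F : Fin 1 → (Fin 0 → ℝ) × (Fin k → ℝ) → ℝ}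
    (hF : Normalized F) {α s : ℝ} (hα : 0 < α) (hs : 0 < s) (β : Fin k → ℝ) :
    cubeForm (fun x => ∑ i, x i) (simplexProd F) (profileKernel (centreProfile α) β s) = 0 := by
  have hm := measurePreserving_insertNth_fst (Y := Fin k → ℝ × ℝ) (0 : Fin 1)
  have hcm := measurable_cubeProd hF.measurable_simplexProd
  rw [cubeForm, ← hm.integral_comp_of_integrable
    (Measurable.aestronglyMeasurable (by unfold profileKernel centreProfile; fun_prop))]
  by_cases hi : Integrable (fun z : ((Fin 0 → ℝ) × (Fin k → ℝ × ℝ)) × ℝ =>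
      cubeProd (fun ζ => simplexProd F (((0 : Fin 1).insertNth z.2 z.1.1 : Fin 1 → ℝ), ζ)) z.1.2 *
      profileKernel (centreProfile α) β s
        ((∑ i, ((0 : Fin 1).insertNth z.2 z.1.1 : Fin 1 → ℝ) i) + mid z.1.2) z.1.2)
      (volume.prod volume)
  · rw [integral_prod _ hi]
    refine integral_eq_zero_of_ae (ae_of_all _ fun q => ?_)
    have e : ∀ (t : ℝ) (ζ : Fin k → ℝ),
        simplexProd F (((0 : Fin 1).insertNth t q.1 : Fin 1 → ℝ), ζ) = F 0 (q.1, ζ) := fun t ζ => by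
      refine (Fin.prod_univ_one _).trans ?_
      simp only [Fin.removeNth_insertNth]
    have e' : ∀ t : ℝ, ∑ i, ((0 : Fin 1).insertNth t q.1 : Fin 1 → ℝ) i = t := fun t =>
      (Fin.sum_univ_one _).trans (Fin.insertNth_apply_same (α := fun _ => ℝ) 0 t q.1)
    simp only [e, e', profileKernel, centreProfile, Pi.zero_apply]
    simp only [mul_comm _ (sideWeight _ _)]
    rw [integral_const_mul, integral_const_mul, integral_const_mul,
      integral_heat2_add (by positivity)]
    simp
  · exact integral_undef hi

lemma pairBound_zero : PairBound 0 := by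
  intro k α β hα hβ hαβ
  refine ⟨2 / β 0, div_nonneg zero_le_two (hβ 0).le, fun F hF r R hr hrR => ?_⟩
  obtain ⟨-, h⟩ := hF.admissible.integral_pairForm_le hα hβ hαβ hr hrR 0
  have h0 : ∫ s in Set.Ioc r R, s⁻¹ * cubeForm (fun x => ∑ i, x i) (simplexProd F)
      (profileKernel (centreProfile α) β s) = 0 := by
    refine setIntegral_eq_zero_of_forall_eq_zero fun s hs => ?_
    rw [cubeForm_centreProfile_eq_zero hF hα (hr.trans hs.1), mul_zero]
  rw [h0, abs_zero, mul_zero] at h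
  rw [growthExponent, Real.rpow_zero, mul_one, le_div_iff₀ (hβ 0)]
  linarith

lemma pairBound_succ {m : ℕ} (h : ProfileBound (m + 1)) : PairBound (m + 1) := by
  intro k α β hα hβ hαβ
  obtain ⟨C, hC, hb⟩ := h (k + 1) (α / 3) (centreProfile α) β (by positivity)
    (by
      have := cancelling_heat2 (w := α / 3) (by positivity)
      rwa [show 3 * (α / 3) = α by ring] at this) hβ
    (fun j => by linarith [hαβ j])
  have hA : 0 ≤ α + (∑ i, β i) / 4 := by
    have : 0 ≤ ∑ i, β i := Finset.sum_nonneg fun i _ => (hβ i).le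
    positivity
  refine ⟨((α + (∑ i, β i) / 4) * C + 2) / β 0, div_nonneg (by positivity) (hβ 0).le,
    fun F hF r R hr hrR => ?_⟩
  obtain ⟨-, hp⟩ := hF.admissible.integral_pairForm_le hα hβ hαβ hr hrR 0
  have hM := one_le_scaleCount_rpow r R (m + 1)
  have habs : |∫ s in Set.Ioc r R, s⁻¹ * cubeForm (fun x => ∑ i, x i) (simplexProd F)
      (profileKernel (centreProfile α) β s)| ≤ C * scaleCount r R ^ growthExponent (m + 1) := by
    refine le_trans (abs_integral_le_integral_abs.trans_eq ?_) (hb F hF r R hr hrR)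
    refine setIntegral_congr_fun measurableSet_Ioc fun s hs => ?_
    rw [abs_mul, abs_of_pos (inv_pos.2 (hr.trans hs.1))]
  rw [div_mul_eq_mul_div, le_div_iff₀ (hβ 0), mul_comm]
  refine hp.trans ?_
  have := mul_le_mul_of_nonneg_left habs hA
  nlinarith

lemma insertNth_side_pos {k : ℕ} {w : ℝ} (hw : 0 < w) {β : Fin k → ℝ} (hβ : ∀ j, 0 < β j)
    (j : Fin (k + 1)) : 0 < (Fin.insertNth 0 (2 * w) β : Fin (k + 1) → ℝ) j := by
  refine Fin.cases ?_ (fun j => ?_) j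
  · simpa using hw
  · simpa using hβ j

lemma insertNth_side_lt {k : ℕ} {w : ℝ} (hw : 0 < w) {β : Fin k → ℝ} (hβ : ∀ j, β j < 18 * w)
    (j : Fin (k + 1)) :
    (Fin.insertNth 0 (2 * w) β : Fin (k + 1) → ℝ) j < 4 * (9 / 2 * w) := by
  refine Fin.cases ?_ (fun j => ?_) j
  · simp only [Fin.insertNth_apply_same]; linarith
  · have := hβ j
    simp only [Fin.insertNth_zero', Fin.cons_succ]; linarith

lemma integrableOn_inv_Ioc {r R : ℝ} (hr : 0 < r) :
    IntegrableOn (fun s : ℝ => s⁻¹) (Set.Ioc r R) :=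
  (ContinuousOn.integrableOn_Icc (continuousOn_inv₀.mono fun _ hs =>
    (hr.trans_le hs.1).ne')).mono_set Set.Ioc_subset_Icc_self

lemma integral_inv_Ioc {r R : ℝ} (hr : 0 < r) (hrR : r < R) :
    ∫ s in Set.Ioc r R, s⁻¹ = Real.log (R / r) := by
  rw [← intervalIntegral.integral_of_le hrR.le, integral_inv_of_pos hr (hr.trans hrR)]

lemma profileBound_one : ProfileBound 1 := by
  intro k w φ β hw hφ hβ hβw
  obtain ⟨C, hC, h⟩ := hφ.abs_cubeForm_one_le hw
  have hβ' := insertNth_side_pos hw hβ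
  have hlt := insertNth_side_lt hw hβw
  obtain ⟨C', hC', h'⟩ := pairBound_zero k (9 / 2 * w) _ (by positivity) hβ' hlt
  refine ⟨C * (C' + C'), by positivity, fun F hF r R hr hrR => ?_⟩
  have i1 := (hF.reduce.admissible.integral_pairForm_le (by positivity) hβ' hlt hr hrR 0).1
  have i2 := (hF.rev.reduce.admissible.integral_pairForm_le (by positivity) hβ' hlt hr hrR 0).1
  have b1 := h' _ hF.reduce r R hr hrR
  have b2 := h' _ hF.rev.reduce r R hr hrR
  rw [growthExponent, Real.rpow_zero, mul_one] at b1 b2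
  have hmono := integral_mono_of_nonneg (μ := volume.restrict (Set.Ioc r R))
    (f := fun s => s⁻¹ * |cubeForm (fun x => ∑ i, x i) (simplexProd F) (profileKernel φ β s)|)
    (ae_restrict_of_forall_mem measurableSet_Ioc fun s hs =>
      mul_nonneg (inv_nonneg.2 (hr.trans hs.1).le) (abs_nonneg _))
    ((i1.add i2).const_mul C) (ae_restrict_of_forall_mem measurableSet_Ioc fun s hs => by
      have hs0 : 0 < s := hr.trans hs.1
      refine (mul_le_mul_of_nonneg_left (h hF hβ s hs0) (inv_nonneg.2 hs0.le)).trans_eq ?_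
      simp only [Pi.add_apply]
      ring)
  refine hmono.trans ?_
  rw [integral_const_mul, integral_add' i1 i2, mul_assoc]
  have hM := one_le_scaleCount_rpow r R 1
  refine mul_le_mul_of_nonneg_left ?_ hC
  nlinarith

lemma profileBound_succ {m : ℕ} (hP : PairBound (m + 1)) : ProfileBound (m + 2) := by
  intro k w φ β hw hφ hβ hβw
  obtain ⟨C, hC, h⟩ := hφ.abs_cubeForm_le hw
  have hβ' := insertNth_side_pos hw hβ
  have hlt := insertNth_side_lt hw hβw
  obtain ⟨C', hC', h'⟩ := hP k (9 / 2 * w) _ (by positivity) hβ' hlt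
  refine ⟨C * (1 + C'), by positivity, fun F hF r R hr hrR => ?_⟩
  set M := scaleCount r R with hM
  set e := growthExponent (m + 1) with he
  have hM0 : 0 < M := zero_lt_one.trans_le (one_le_scaleCount r R)
  -- this choice of `l` balances the logarithm against the growth in the lower degree
  set l : ℝ := M ^ ((e - 1) / 2) with hl
  have hl0 : 0 < l := Real.rpow_pos_of_pos hM0 _
  have i1 := (hF.reduce.admissible.integral_pairForm_le (by positivity) hβ' hlt hr hrR 0).1
  have b1 := h' _ hF.reduce r R hr hrR
  have i0 := integrableOn_inv_Ioc (R := R) hr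
  have hmono := integral_mono_of_nonneg (μ := volume.restrict (Set.Ioc r R))
    (f := fun s => s⁻¹ * |cubeForm (fun x => ∑ i, x i) (simplexProd F) (profileKernel φ β s)|)
    (ae_restrict_of_forall_mem measurableSet_Ioc fun s hs =>
      mul_nonneg (inv_nonneg.2 (hr.trans hs.1).le) (abs_nonneg _))
    (((i0.const_mul l).add (i1.const_mul l⁻¹)).const_mul C)
    (ae_restrict_of_forall_mem measurableSet_Ioc fun s hs => by
      have hs0 : 0 < s := hr.trans hs.1
      refine (mul_le_mul_of_nonneg_left (h hF hβ s l hs0 hl0) (inv_nonneg.2 hs0.le)).trans_eq ?_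
      simp only [Pi.add_apply]
      ring)
  refine hmono.trans ?_
  rw [integral_const_mul, integral_add' (i0.const_mul l) (i1.const_mul l⁻¹), integral_const_mul,
    integral_const_mul, integral_inv_Ioc hr hrR, mul_assoc]
  refine mul_le_mul_of_nonneg_left ?_ hC
  have e1 : l * M = M ^ growthExponent (m + 2) := by
    rw [growthExponent_add_two, hl, ← Real.rpow_add_one hM0.ne']; congr 1; ring
  have e2 : l⁻¹ * M ^ e = M ^ growthExponent (m + 2) := by
    rw [growthExponent_add_two, hl, ← Real.rpow_neg hM0.le, ← Real.rpow_add hM0]; congr 1; ring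
  have t1 : l * Real.log (R / r) ≤ l * M :=
    mul_le_mul_of_nonneg_left (le_max_right _ _) hl0.le
  have t2 := mul_le_mul_of_nonneg_left b1 (inv_nonneg.2 hl0.le)
  calc _ ≤ l * M + l⁻¹ * (C' * M ^ e) := add_le_add t1 t2
    _ = l * M + C' * (l⁻¹ * M ^ e) := by ring
    _ = _ := by rw [e1, e2]; ring

/-- The bound for cancelling profiles in every positive degree. -/
theorem profileBound (m : ℕ) : ProfileBound (m + 1) := by
  induction m with
  | zero => exact profileBound_one
  | succ m ih => exact profileBound_succ (pairBound_succ ih)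

/-! ### Truncations of the reciprocal -/

/-- The reciprocal truncated to `r ≤ |t| ≤ R`. -/
noncomputable def truncatedInv (r R : ℝ) : ℝ → ℝ :=
  {t : ℝ | r ≤ |t| ∧ |t| ≤ R}.indicator fun t => 1 / t

lemma measurableSet_annulus (r R : ℝ) : MeasurableSet {t : ℝ | r ≤ |t| ∧ |t| ≤ R} :=
  (measurableSet_le measurable_const measurable_abs).inter
    (measurableSet_le measurable_abs measurable_const)

@[fun_prop]
lemma measurable_truncatedInv (r R : ℝ) : Measurable (truncatedInv r R) :=
  (by fun_prop : Measurable fun t : ℝ => 1 / t).indicator (measurableSet_annulus r R)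

lemma abs_cube_mul_heat3_le {s : ℝ} (hs : 0 < s) (t : ℝ) :
    |s ^ 3 * heat3 (s ^ 2) t| ≤ 24 * heat (2 * s ^ 2) t := by
  have hv : 0 < s ^ 2 := by positivity
  have hsq : √2 ≤ 3 / 2 := Real.sqrt_le_iff.2 ⟨by norm_num, by norm_num⟩
  set y : ℝ := |t| / s with hy
  have hy0 : 0 ≤ y := by positivity
  have hy2 : t ^ 2 / s ^ 2 = y ^ 2 := by rw [hy, div_pow, sq_abs]
  have e1 : |s ^ 3 * (3 * t / (s ^ 2) ^ 2 - t ^ 3 / (s ^ 2) ^ 3)| = |3 * y - y ^ 3| := by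
    have : s ^ 3 * (3 * t / (s ^ 2) ^ 2 - t ^ 3 / (s ^ 2) ^ 3) =
        (t / s) * (3 - (t / s) ^ 2) := by field_simp
    rw [this, show 3 * y - y ^ 3 = y * (3 - y ^ 2) by ring, abs_mul, abs_mul, abs_div,
      abs_of_pos hs, abs_of_nonneg hy0, ← hy2, div_pow]
  have key : |3 * y - y ^ 3| * Real.exp (-(y ^ 2 / 4)) ≤ 16 := by
    have hexp : 1 + y ^ 2 / 4 + (y ^ 2 / 4) ^ 2 / 2 ≤ Real.exp (y ^ 2 / 4) :=
      Real.quadratic_le_exp_of_nonneg (by positivity)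
    rw [Real.exp_neg, ← div_eq_mul_inv, div_le_iff₀ (Real.exp_pos _)]
    have hb : |3 * y - y ^ 3| ≤ 3 * y + y ^ 3 := by
      rw [abs_le]; constructor <;> nlinarith [pow_nonneg hy0 3]
    nlinarith [sq_nonneg (y - 1), sq_nonneg (y ^ 2 - y), sq_nonneg (y ^ 2 - 2 * y), sq_nonneg y]
  rw [heat3, ← mul_assoc, abs_mul, e1, abs_of_nonneg (heat_nonneg _ _),
    heat_eq_exp_mul_heat_two_mul hv, hy2]
  calc _ = √2 * (|3 * y - y ^ 3| * Real.exp (-(y ^ 2 / 4))) * heat (2 * s ^ 2) t := by ring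
    _ ≤ 24 * heat (2 * s ^ 2) t := by
      refine mul_le_mul_of_nonneg_right ?_ (heat_nonneg _ _)
      nlinarith [Real.sqrt_nonneg 2]

/-- Up to a constant, the differentiated function is the second derivative of the Gaussian,
evaluated at `t / s`. -/
lemma hasDerivAt_scale_heat3 {s : ℝ} (hs : 0 < s) (t : ℝ) :
    HasDerivAt (fun s : ℝ => (1 - (t / s) ^ 2) * Real.exp (-(t / s) ^ 2 / 2))
      (t * (√(2 * Real.pi) * (s⁻¹ * (s ^ 3 * heat3 (s ^ 2) t)))) s := by
  have h0 : HasDerivAt (fun s : ℝ => t / s) (-(t / s ^ 2)) s := by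
    have := (hasDerivAt_inv hs.ne').const_mul t
    exact this.congr_deriv (by ring)
  have h1 := h0.pow 2
  have h2 := ((h1.const_sub 1).mul (h1.neg.div_const 2).exp)
  refine h2.congr_deriv ?_
  have hp := Real.pi_pos
  have e : √(2 * Real.pi * s ^ 2) = √(2 * Real.pi) * s := by
    rw [Real.sqrt_mul (by positivity), Real.sqrt_sq hs.le]
  have hq : √(2 * Real.pi) ≠ 0 := by positivity
  have e' : -t ^ 2 / (2 * s ^ 2) = -(t / s) ^ 2 / 2 := by field_simp
  have hs' := hs.ne'
  simp only [heat3, heat, e, e', Pi.pow_apply, Pi.neg_apply]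
  generalize Real.exp (-(t / s) ^ 2 / 2) = X
  push_cast
  field_simp
  ring

lemma abs_sub_mexicanHat_le {u b : ℝ} (h : b = 1 ∧ |u| ≤ 1 ∨ b = 0 ∧ 1 ≤ |u|) :
    |b - (1 - u ^ 2) * Real.exp (-u ^ 2 / 2)| ≤ 4 * (|u| * Real.exp (-u ^ 2 / 4)) := by
  have hu : u ^ 2 = |u| ^ 2 := (sq_abs u).symm
  have h0 := abs_nonneg u
  rw [hu]
  set y := |u|
  rcases h with ⟨rfl, hy⟩ | ⟨rfl, hy⟩
  · have e1 : 1 - y ^ 2 / 2 ≤ Real.exp (-y ^ 2 / 2) := by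
      have := Real.add_one_le_exp (-y ^ 2 / 2); linarith
    have e2 : Real.exp (-y ^ 2 / 2) ≤ 1 := Real.exp_le_one_iff.2 (by nlinarith)
    have e3 : 1 - y ^ 2 / 4 ≤ Real.exp (-y ^ 2 / 4) := by
      have := Real.add_one_le_exp (-y ^ 2 / 4); linarith
    have hy2 : y ^ 2 ≤ y := by nlinarith
    have e4 : y * (3 / 4) ≤ y * Real.exp (-y ^ 2 / 4) :=
      mul_le_mul_of_nonneg_left (by nlinarith) h0
    rw [abs_le]; constructor <;> nlinarith [Real.exp_pos (-y ^ 2 / 2)]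
  · have e1 : Real.exp (-y ^ 2 / 2) = Real.exp (-y ^ 2 / 4) * Real.exp (-y ^ 2 / 4) := by
      rw [← Real.exp_add]; ring_nf
    have e2 : (y ^ 2 - 1) * Real.exp (-y ^ 2 / 4) ≤ 4 := by
      rw [neg_div, Real.exp_neg, ← div_eq_mul_inv, div_le_iff₀ (Real.exp_pos _)]
      have := Real.add_one_le_exp (y ^ 2 / 4); linarith
    have e3 := Real.exp_pos (-y ^ 2 / 4)
    rw [zero_sub, ← neg_mul, neg_sub, e1, abs_of_nonneg (by
      have : 0 ≤ y ^ 2 - 1 := by nlinarith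
      positivity)]
    nlinarith [mul_le_mul_of_nonneg_right e2 e3.le, mul_nonneg (sub_nonneg.2 hy) e3.le]

/-- The truncated reciprocal is a superposition of cancelling kernels, up to errors on the two end
scales which are dominated by Gaussians. -/
lemma abs_truncatedInv_sub_le {r R : ℝ} (hr : 0 < r) (hrR : r < R) (t : ℝ) :
    |truncatedInv r R t - √(2 * Real.pi) *
      ∫ s in Set.Ioc r R, s⁻¹ * (s ^ 3 * heat3 (s ^ 2) t)| ≤
      4 * √(4 * Real.pi) * (heat (2 * R ^ 2) t + heat (2 * r ^ 2) t) := by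
  have hR := hr.trans hrR
  have hp := Real.pi_pos
  rcases eq_or_ne t 0 with rfl | ht
  · have : truncatedInv r R 0 = 0 := by simp [truncatedInv, Set.indicator]
    simp only [this, heat3]
    simp only [mul_zero, zero_div, ne_eq, OfNat.ofNat_ne_zero, not_false_eq_true, zero_pow,
      sub_zero, zero_mul, integral_zero, abs_zero]
    have := heat_nonneg (2 * R ^ 2) 0
    have := heat_nonneg (2 * r ^ 2) 0
    positivity
  set E : ℝ → ℝ := fun u => (1 - u ^ 2) * Real.exp (-u ^ 2 / 2) with hE
  have hint : √(2 * Real.pi) * ∫ s in Set.Ioc r R, s⁻¹ * (s ^ 3 * heat3 (s ^ 2) t) =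
      t⁻¹ * (E (t / R) - E (t / r)) := by
    rw [← intervalIntegral.integral_of_le hrR.le, eq_inv_mul_iff_mul_eq₀ ht,
      ← intervalIntegral.integral_const_mul, ← intervalIntegral.integral_const_mul]
    refine intervalIntegral.integral_eq_sub_of_hasDerivAt (f := fun s => E (t / s))
      (fun s hs => ?_) (ContinuousOn.intervalIntegrable ?_)
    · rw [Set.uIcc_of_le hrR.le] at hs
      exact hasDerivAt_scale_heat3 (hr.trans_le hs.1) t
    · rw [Set.uIcc_of_le hrR.le]
      intro s hs
      have hs0 : 0 < s := hr.trans_le hs.1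
      have : √(2 * Real.pi * s ^ 2) ≠ 0 := by positivity
      have : 2 * s ^ 2 ≠ 0 := by positivity
      have : (s ^ 2) ^ 2 ≠ 0 := by positivity
      have : (s ^ 2) ^ 3 ≠ 0 := by positivity
      have := hs0.ne'
      refine ContinuousAt.continuousWithinAt ?_
      unfold heat3 heat
      fun_prop (disch := assumption)
  have hgauss : ∀ a : ℝ, 0 < a → |t|⁻¹ * (4 * (|t / a| * Real.exp (-(t / a) ^ 2 / 4))) =
      4 * √(4 * Real.pi) * heat (2 * a ^ 2) t := fun a ha => by
    have e : √(2 * Real.pi * (2 * a ^ 2)) = √(4 * Real.pi) * a := by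
      rw [show 2 * Real.pi * (2 * a ^ 2) = 4 * Real.pi * a ^ 2 by ring,
        Real.sqrt_mul (by positivity), Real.sqrt_sq ha.le]
    have hq : √(4 * Real.pi) ≠ 0 := by positivity
    have ht' : |t| ≠ 0 := abs_ne_zero.2 ht
    have e' : -t ^ 2 / (2 * (2 * a ^ 2)) = -(t / a) ^ 2 / 4 := by field_simp; norm_num
    rw [heat, e, e', abs_div, abs_of_pos ha]
    field_simp
  have hdiv : ∀ a : ℝ, 0 < a → |t / a| = |t| / a := fun a ha => by rw [abs_div, abs_of_pos ha]
  obtain ⟨b, b', hb, hb', hbb⟩ : ∃ b b' : ℝ, (b = 1 ∧ |t / R| ≤ 1 ∨ b = 0 ∧ 1 ≤ |t / R|) ∧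
      (b' = 1 ∧ |t / r| ≤ 1 ∨ b' = 0 ∧ 1 ≤ |t / r|) ∧ truncatedInv r R t = t⁻¹ * (b - b') := by
    simp only [hdiv _ hr, hdiv _ hR, div_le_one hr, div_le_one hR, one_le_div hr, one_le_div hR]
    by_cases h1 : r ≤ |t|
    · by_cases h2 : |t| ≤ R
      · exact ⟨1, 0, .inl ⟨rfl, h2⟩, .inr ⟨rfl, h1⟩, by simp [truncatedInv, h1, h2]⟩
      · exact ⟨0, 0, .inr ⟨rfl, (not_le.1 h2).le⟩, .inr ⟨rfl, h1⟩, by simp [truncatedInv, h2]⟩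
    · have h1' := (not_le.1 h1).le
      exact ⟨1, 1, .inl ⟨rfl, h1'.trans hrR.le⟩, .inl ⟨rfl, h1'⟩, by simp [truncatedInv, h1]⟩
  rw [hint, hbb, ← mul_sub, abs_mul, abs_inv, mul_add, ← hgauss R hR, ← hgauss r hr, ← mul_add]
  refine mul_le_mul_of_nonneg_left ?_ (by positivity)
  rw [show b - b' - (E (t / R) - E (t / r)) = (b - E (t / R)) - (b' - E (t / r)) by ring]
  exact (abs_sub _ _).trans (add_le_add (abs_sub_mexicanHat_le hb) (abs_sub_mexicanHat_le hb'))

lemma lintegral_truncatedInv {r R : ℝ} (hr : 0 < r) (hrR : r < R) :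
    ∫⁻ t, ‖truncatedInv r R t‖ₑ ≤ ENNReal.ofReal (2 * Real.log (R / r)) := by
  have hi := integrableOn_inv_Ioc (R := R) hr
  have hIcc : ∫⁻ t in Set.Icc r R, ‖t⁻¹‖ₑ = ENNReal.ofReal (Real.log (R / r)) := by
    rw [setLIntegral_congr Ioc_ae_eq_Icc.symm, ← integral_inv_Ioc hr hrR,
      ofReal_integral_eq_lintegral_ofReal hi (ae_restrict_of_forall_mem measurableSet_Ioc
        fun s hs => inv_nonneg.2 (hr.trans hs.1).le)]
    exact setLIntegral_congr_fun measurableSet_Ioc fun s hs =>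
      Real.enorm_of_nonneg (inv_nonneg.2 (hr.trans hs.1).le)
  have hneg : ∫⁻ t in Set.Icc (-R) (-r), ‖t⁻¹‖ₑ = ENNReal.ofReal (Real.log (R / r)) := by
    rw [← hIcc, ← lintegral_indicator measurableSet_Icc, ← lintegral_indicator measurableSet_Icc,
      ← lintegral_neg_eq_self]
    refine lintegral_congr fun t => ?_
    simp only [Set.indicator, Set.mem_Icc, neg_le_neg_iff, inv_neg, enorm_neg]
    simp only [and_comm]
  have hset : {t : ℝ | r ≤ |t| ∧ |t| ≤ R} ⊆ Set.Icc r R ∪ Set.Icc (-R) (-r) := by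
    rintro t ⟨h1, h2⟩
    rcases le_total 0 t with h | h
    · rw [abs_of_nonneg h] at h1 h2; exact .inl ⟨h1, h2⟩
    · rw [abs_of_nonpos h] at h1 h2; exact .inr ⟨by linarith, by linarith⟩
  have hlog := (Real.log_pos ((one_lt_div hr).2 hrR)).le
  calc _ = ∫⁻ t in {t : ℝ | r ≤ |t| ∧ |t| ≤ R}, ‖t⁻¹‖ₑ := by
        rw [← lintegral_indicator (measurableSet_annulus r R)]
        refine lintegral_congr fun t => ?_
        rw [truncatedInv, enorm_indicator_eq_indicator_enorm]; simp only [one_div]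
    _ ≤ ∫⁻ t in Set.Icc r R ∪ Set.Icc (-R) (-r), ‖t⁻¹‖ₑ := lintegral_mono_set hset
    _ ≤ _ := lintegral_union_le _ _ _
    _ = _ := by rw [hIcc, hneg, ← ENNReal.ofReal_add hlog hlog]; congr 1; ring

/-! ### The truncated form for real functions -/

lemma Admissible.integral_abs_mul_heat_le {X : Type*} [MeasureSpace X] {k : ℕ} {σ : X → ℝ}
    {f : X × (Fin k → ℝ) → ℝ} (hf : Admissible σ f) {A : ℝ} {B : Fin k → ℝ} (hA : 0 < A)
    (hB : ∀ j, 0 < B j) :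
    Integrable (fun p : X × (Fin k → ℝ × ℝ) => |cubeProd (fun ζ => f (p.1, ζ)) p.2| *
      (heat A (σ p.1 + mid p.2) * sideWeight B p.2)) ∧
    ∫ p : X × (Fin k → ℝ × ℝ), |cubeProd (fun ζ => f (p.1, ζ)) p.2| *
      (heat A (σ p.1 + mid p.2) * sideWeight B p.2) ≤ 1 := by
  have hb : ∀ (z : ℝ) (ω : Fin k → ℝ × ℝ),
      |heat A z * sideWeight B ω| ≤ 1 * (heat A z * sideWeight B ω) := fun z ω => by
    rw [one_mul, abs_of_nonneg (mul_nonneg (heat_nonneg _ _) (sideWeight_nonneg _ _))]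
  have hi := hf.integrable hA hB hb (by unfold Function.uncurry; fun_prop)
  have he : (fun p : X × (Fin k → ℝ × ℝ) => |cubeProd (fun ζ => f (p.1, ζ)) p.2| *
      (heat A (σ p.1 + mid p.2) * sideWeight B p.2)) = fun p => ‖cubeProd (fun ζ => f (p.1, ζ)) p.2 *
      (heat A (σ p.1 + mid p.2) * sideWeight B p.2)‖ := by
    ext p
    rw [norm_mul, Real.norm_eq_abs, Real.norm_of_nonneg
      (mul_nonneg (heat_nonneg _ _) (sideWeight_nonneg _ _))]
  rw [he]
  refine ⟨hi.norm, ?_⟩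
  rw [integral_norm_eq_lintegral_enorm hi.aestronglyMeasurable]
  exact ENNReal.toReal_le_of_le_ofReal zero_le_one (hf.lintegral_enorm_le hA hB hb)

lemma Admissible.truncated {X : Type*} [MeasureSpace X] {σ : X → ℝ}
    {f : X × (Fin 0 → ℝ) → ℝ} (hf : Admissible σ f) {r R : ℝ} (hr : 0 < r) (hrR : r < R) :
    Integrable (fun p : X × (Fin 0 → ℝ × ℝ) => cubeProd (fun ζ => f (p.1, ζ)) p.2 *
      truncatedInv r R (σ p.1 + mid p.2)) ∧
    |cubeForm σ f fun z _ => truncatedInv r R z| ≤ 2 * Real.log (R / r) := by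
  have h := hf.lintegral_le (fun t => ‖truncatedInv r R t‖ₑ) (fun _ _ => 1) (by fun_prop)
    fun _ => measurable_const
  simp only [Finset.univ_eq_empty, Finset.prod_empty, mul_one, ← enorm_mul] at h
  replace h := h.trans (lintegral_truncatedInv hr hrR)
  have h1 := measurable_cubeProd hf.measurable
  have h2 := hf.measurable_sum
  refine ⟨⟨by fun_prop, h.trans_lt ENNReal.ofReal_lt_top⟩, ?_⟩
  rw [← Real.norm_eq_abs, ← toReal_enorm]
  exact ENNReal.toReal_le_of_le_ofReal
    (mul_nonneg zero_le_two (Real.log_pos ((one_lt_div hr).2 hrR)).le)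
    ((enorm_integral_le_lintegral_enorm _).trans h)

/-- Comparison of the truncated form with a superposition of forms with cancelling profiles. -/
lemma Admissible.abs_truncated_le {X : Type*} [MeasureSpace X] [SFinite (volume : Measure X)]
    {σ : X → ℝ} {f : X × (Fin 0 → ℝ) → ℝ} (hf : Admissible σ f) {r R : ℝ} (hr : 0 < r)
    (hrR : r < R) (β : Fin 0 → ℝ) :
    |cubeForm σ f fun z _ => truncatedInv r R z| ≤
      √(2 * Real.pi) * (∫ s in Set.Ioc r R, s⁻¹ *
        |cubeForm σ f (profileKernel (fun s t => s ^ 3 * heat3 (s ^ 2) t) β s)|) +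
      8 * √(4 * Real.pi) := by
  have hR := hr.trans hrR
  have hside : ∀ (B : Fin 0 → ℝ) (ω : Fin 0 → ℝ × ℝ), sideWeight B ω = 1 := fun B ω => by
    simp [sideWeight]
  have hT := hf.integrable_scales (K := profileKernel (fun s t => s ^ 3 * heat3 (s ^ 2) t) β)
    (α := 2) (C := 24) (r := r) (R := R) (β := β) two_pos (fun j => j.elim0) hr
    (fun s hs z ω => by
      rw [profileKernel, hside, mul_one, mul_one]; exact abs_cube_mul_heat3_le hs z)
    (by unfold profileKernel sideWeight; fun_prop)
  have hI := (integral_scales_eq hT).2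
  rw [integral_prod_symm _ hT] at hI
  have hTi := hT.integral_prod_right
  simp only [profileKernel, hside, mul_one, mul_left_comm _ (cubeProd _ _), integral_const_mul]
    at hI hTi
  have hsplit : (cubeForm σ f fun z _ => truncatedInv r R z) =
      √(2 * Real.pi) * (∫ s in Set.Ioc r R, s⁻¹ *
        cubeForm σ f (profileKernel (fun s t => s ^ 3 * heat3 (s ^ 2) t) β s)) +
      ∫ p : X × (Fin 0 → ℝ × ℝ), cubeProd (fun ζ => f (p.1, ζ)) p.2 *
        (truncatedInv r R (σ p.1 + mid p.2) - √(2 * Real.pi) *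
          ∫ s in Set.Ioc r R, s⁻¹ * (s ^ 3 * heat3 (s ^ 2) (σ p.1 + mid p.2))) := by
    rw [← hI, ← integral_const_mul, ← integral_add (hTi.const_mul _), cubeForm]
    · refine integral_congr_ae (ae_of_all _ fun p => ?_)
      dsimp only
      ring
    · refine ((hf.truncated hr hrR).1.sub (hTi.const_mul √(2 * Real.pi))).congr
        (ae_of_all _ fun p => ?_)
      simp only [Pi.sub_apply]
      ring
  have hgR := hf.integral_abs_mul_heat_le (A := 2 * R ^ 2) (B := β) (by positivity)
    fun j => j.elim0
  have hgr := hf.integral_abs_mul_heat_le (A := 2 * r ^ 2) (B := β) (by positivity)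
    fun j => j.elim0
  simp only [hside, mul_one] at hgR hgr
  have herr : |∫ p : X × (Fin 0 → ℝ × ℝ), cubeProd (fun ζ => f (p.1, ζ)) p.2 *
        (truncatedInv r R (σ p.1 + mid p.2) - √(2 * Real.pi) *
          ∫ s in Set.Ioc r R, s⁻¹ * (s ^ 3 * heat3 (s ^ 2) (σ p.1 + mid p.2)))| ≤
      8 * √(4 * Real.pi) := by
    rw [← Real.norm_eq_abs]
    refine (norm_integral_le_of_norm_le ((hgR.1.add hgr.1).const_mul (4 * √(4 * Real.pi)))
      (ae_of_all _ fun p => ?_)).trans ?_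
    · rw [norm_mul, Real.norm_eq_abs, Real.norm_eq_abs]
      refine (mul_le_mul_of_nonneg_left (abs_truncatedInv_sub_le hr hrR _)
        (abs_nonneg _)).trans_eq ?_
      simp only [Pi.add_apply]; ring
    · rw [integral_const_mul, integral_add' hgR.1 hgr.1]
      nlinarith [hgR.2, hgr.2, Real.sqrt_nonneg (4 * Real.pi)]
  rw [hsplit]
  refine (abs_add_le _ _).trans (add_le_add ?_ herr)
  rw [abs_mul, abs_of_nonneg (Real.sqrt_nonneg _)]
  refine mul_le_mul_of_nonneg_left (abs_integral_le_integral_abs.trans_eq ?_) (Real.sqrt_nonneg _)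
  refine setIntegral_congr_fun measurableSet_Ioc fun s hs => ?_
  rw [abs_mul, abs_of_pos (inv_pos.2 (hr.trans hs.1))]

/-- The main bound for normalized real functions. -/
theorem exists_abs_truncated_le (m : ℕ) : ∃ C : ℝ, 0 ≤ C ∧
    ∀ F : Fin (m + 2) → (Fin (m + 1) → ℝ) × (Fin 0 → ℝ) → ℝ, Normalized F →
      ∀ r R : ℝ, 0 < r → r < R →
        |cubeForm (fun x => ∑ i, x i) (simplexProd F) fun z _ => truncatedInv r R z| ≤
          C * Real.log (R / r) ^ growthExponent (m + 1) := by
  obtain ⟨C, hC, h⟩ := profileBound m 0 (1 / 3) (fun s t => s ^ 3 * heat3 (s ^ 2) t) Fin.elim0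
    (by norm_num)
    (by simpa using cancelling_heat3 (w := 1 / 3) (by norm_num))
    (fun j => j.elim0) fun j => j.elim0
  refine ⟨√(2 * Real.pi) * C + 8 * √(4 * Real.pi) + 2, by positivity, fun F hF r R hr hrR => ?_⟩
  have hL := Real.log_pos ((one_lt_div hr).2 hrR)
  rcases le_total (Real.log (R / r)) 1 with hL1 | hL1
  · -- few scales: absolute values suffice
    have h1 : Real.log (R / r) ≤ Real.log (R / r) ^ growthExponent (m + 1) := by
      simpa using Real.rpow_le_rpow_of_exponent_ge hL hL1 (growthExponent_le_one (m + 1))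
    have h2 := (hF.admissible.truncated hr hrR).2
    have h3 : 0 ≤ √(2 * Real.pi) * C + 8 * √(4 * Real.pi) := by positivity
    nlinarith
  · have h1 := hF.admissible.abs_truncated_le hr hrR Fin.elim0
    have h2 := h F hF r R hr hrR
    have h3 := one_le_scaleCount_rpow r R (m + 1)
    rw [scaleCount, max_eq_right hL1] at h2 h3
    have h4 := mul_le_mul_of_nonneg_left h2 (Real.sqrt_nonneg (2 * Real.pi))
    nlinarith [Real.sqrt_nonneg (4 * Real.pi)]


lemma measurePreserving_prodMk_empty {X Y : Type*} [MeasureSpace X] [SFinite (volume : Measure X)]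
    [MeasureSpace Y] [SigmaFinite (volume : Measure Y)] (y : Fin 0 → Y) :
    MeasurePreserving (fun x : X => (x, y)) volume volume :=
  ⟨by fun_prop, by rw [Measure.volume_eq_prod, Measure.volume_pi_eq_dirac y, Measure.prod_dirac]⟩

lemma measurableSet_truncationRegion (n : ℕ) (r R : ℝ) :
    MeasurableSet (truncationRegion n r R) :=
  (by fun_prop : Measurable fun x : Fin (n + 1) → ℝ => ∑ i, x i) (measurableSet_annulus r R)

/-- The bound for real functions in the unit balls of the Lebesgue spaces. -/
theorem exists_abs_integral_simplex_le (m : ℕ) : ∃ C : ℝ, 0 ≤ C ∧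
    ∀ g : Fin (m + 2) → (Fin (m + 1) → ℝ) → ℝ, (∀ i, Measurable (g i)) →
      (∀ i : Fin (m + 2), ∫⁻ x, ‖g i x‖ₑ ^ simplexExponent (m + 1) i ≤ 1) →
      ∀ r R : ℝ, 0 < r → r < R →
        IntegrableOn (fun x => (∏ i, g i (i.removeNth x)) * (1 / ∑ i, x i))
          (truncationRegion (m + 1) r R) ∧
        |∫ x in truncationRegion (m + 1) r R, (∏ i, g i (i.removeNth x)) * (1 / ∑ i, x i)| ≤
          C * Real.log (R / r) ^ growthExponent (m + 1) := by
  obtain ⟨C, hC, h⟩ := exists_abs_truncated_le m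
  refine ⟨C, hC, fun g hg hg1 r R hr hrR => ?_⟩
  -- no parameters are doubled yet
  have hF : Normalized (k := 0) fun i p => g i p.1 :=
    { measurable := fun i => (hg i).comp measurable_fst
      lintegral_le := fun i => by
        rw [← (measurePreserving_prodMk_empty (X := Fin (m + 1) → ℝ)
          (default : Fin 0 → ℝ)).lintegral_comp (by have := hg i; fun_prop)]
        exact hg1 i }
  have hm := measurePreserving_prodMk_empty (X := Fin (m + 2) → ℝ) (default : Fin 0 → ℝ × ℝ)
  have hS := measurableSet_truncationRegion (m + 1) r R
  obtain ⟨hi, -⟩ := hF.admissible.truncated hr hrR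
  have hb := h _ hF r R hr hrR
  have he : ∀ x : Fin (m + 2) → ℝ,
      cubeProd (fun ζ => simplexProd (fun i p => g i p.1) (x, ζ)) (default : Fin 0 → ℝ × ℝ) *
        truncatedInv r R ((∑ i, x i) + mid (default : Fin 0 → ℝ × ℝ)) =
      (truncationRegion (m + 1) r R).indicator
        (fun x => (∏ i, g i (i.removeNth x)) * (1 / ∑ i, x i)) x := fun x => by
    have h1 : mid (default : Fin 0 → ℝ × ℝ) = 0 := by simp [mid]
    have h2 : cubeProd (fun ζ => simplexProd (fun i p => g i p.1) (x, ζ))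
        (default : Fin 0 → ℝ × ℝ) = ∏ i, g i (i.removeNth x) := Fintype.prod_unique _
    rw [h1, h2, add_zero]
    by_cases hx : x ∈ truncationRegion (m + 1) r R
    · rw [Set.indicator_of_mem hx, truncatedInv, Set.indicator_of_mem (by exact hx)]
    · rw [Set.indicator_of_notMem hx, truncatedInv, Set.indicator_of_notMem (by exact hx), mul_zero]
  rw [cubeForm, ← hm.integral_comp_of_integrable hi.aestronglyMeasurable] at hb
  replace hi := hm.integrable_comp_of_integrable hi
  simp only [Function.comp_def, he] at hi hb
  rw [integral_indicator hS] at hb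
  exact ⟨(integrable_indicator_iff hS).1 hi, hb⟩

/-! ### Complex Schwartz functions -/

lemma lintegral_enorm_pow_eq {α E : Type*} [MeasurableSpace α] {μ : Measure α}
    [NormedAddCommGroup E] {f : α → E} {p : ℕ} (hp : p ≠ 0) (hf : MemLp f p μ) :
    ∫⁻ x, ‖f x‖ₑ ^ p ∂μ = ENNReal.ofReal (lpNorm f p μ) ^ p := by
  have h := eLpNorm_nnreal_pow_eq_lintegral (μ := μ) (f := f) (p := (p : NNReal))
    (by exact_mod_cast hp)
  simp only [NNReal.coe_natCast, ENNReal.rpow_natCast] at h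
  rw [ofReal_lpNorm hf, ← h]
  rfl

/-- The real part for `false` and the imaginary part for `true`. -/
noncomputable def complexPart (b : Bool) (z : ℂ) : ℝ := if b then z.im else z.re

/-- The coefficient of `complexPart b z` in `z`. -/
noncomputable def complexUnit (b : Bool) : ℂ := if b then Complex.I else 1

lemma sum_complexUnit_mul_complexPart (z : ℂ) :
    ∑ b, complexUnit b * (complexPart b z : ℂ) = z := by
  simp [complexUnit, complexPart, mul_comm Complex.I, add_comm, Complex.re_add_im]

lemma norm_complexUnit (b : Bool) : ‖complexUnit b‖ = 1 := by cases b <;> simp [complexUnit]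

lemma enorm_complexPart_le (b : Bool) (z : ℂ) : ‖complexPart b z‖ₑ ≤ ‖z‖ₑ := by
  rw [enorm_le_iff_norm_le]
  cases b
  · simpa [complexPart] using Complex.abs_re_le_norm z
  · simpa [complexPart] using Complex.abs_im_le_norm z

lemma measurable_complexPart (b : Bool) : Measurable (complexPart b) := by
  cases b
  · exact Complex.measurable_re
  · exact Complex.measurable_im

/-- The bound for complex Schwartz functions, with all norms indexed uniformly. -/
theorem exists_norm_truncatedSimplexHilbert_le (m : ℕ) : ∃ C : ℝ, 0 ≤ C ∧
    ∀ (F : Fin (m + 2) → 𝓢(Fin (m + 1) → ℝ, ℂ)) (r R : ℝ), 0 < r → r < R →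
      IntegrableOn (simplexIntegrand F) (truncationRegion (m + 1) r R) volume ∧
      ‖truncatedSimplexHilbert r R F‖ ≤ C * Real.log (R / r) ^ growthExponent (m + 1) *
        ∏ i : Fin (m + 2), lpNorm (F i) (simplexExponent (m + 1) i : ℕ) volume := by
  obtain ⟨C, hC, h⟩ := exists_abs_integral_simplex_le m
  refine ⟨2 ^ (m + 2) * C, by positivity, fun F r R hr hrR => ?_⟩
  have hL := Real.log_pos ((one_lt_div hr).2 hrR)
  set N : Fin (m + 2) → ℝ := fun i => lpNorm (F i) (simplexExponent (m + 1) i : ℕ) volume with hN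
  have hN0 : ∀ i, 0 ≤ N i := fun i => lpNorm_nonneg
  have hmem : ∀ i : Fin (m + 2), MemLp (F i) (simplexExponent (m + 1) i : ℕ) volume :=
    fun i => (F i).memLp _ _
  by_cases hz : ∃ i, N i = 0
  · -- a vanishing norm makes the integrand vanish, as Schwartz functions are continuous
    obtain ⟨i, hi⟩ := hz
    have h0 : (F i : (Fin (m + 1) → ℝ) → ℂ) = 0 :=
      (Continuous.ae_eq_iff_eq volume (F i).continuous continuous_zero).1
        ((lpNorm_eq_zero (hmem i) (by exact_mod_cast simplexExponent_ne_zero _ _)).1 hi)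
    have hzero : simplexIntegrand F = 0 := by
      ext x
      rw [simplexIntegrand, Finset.prod_eq_zero (Finset.mem_univ i) (by rw [h0]; rfl), zero_mul]
      rfl
    rw [truncatedSimplexHilbert, hzero]
    refine ⟨integrableOn_zero, ?_⟩
    simp only [Pi.zero_apply, integral_zero, norm_zero]
    have := Finset.prod_nonneg fun i (_ : i ∈ Finset.univ) => hN0 i
    positivity
  have hNpos : ∀ i, 0 < N i := fun i => (hN0 i).lt_of_ne' fun hi => hz ⟨i, hi⟩
  -- the normalized real and imaginary parts
  set g : (Fin (m + 2) → Bool) → Fin (m + 2) → (Fin (m + 1) → ℝ) → ℝ :=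
    fun χ i x => (N i)⁻¹ * complexPart (χ i) (F i x) with hg
  have hgm : ∀ χ i, Measurable (g χ i) := fun χ i =>
    ((measurable_complexPart _).comp (F i).continuous.measurable).const_mul _
  have hg1 : ∀ χ (i : Fin (m + 2)), ∫⁻ x, ‖g χ i x‖ₑ ^ simplexExponent (m + 1) i ≤ 1 :=
      fun χ i => by
    calc _ ≤ ∫⁻ x, ENNReal.ofReal (N i)⁻¹ ^ simplexExponent (m + 1) i *
          ‖F i x‖ₑ ^ simplexExponent (m + 1) i := by
          refine lintegral_mono fun x => ?_
          rw [hg, enorm_mul, mul_pow, Real.enorm_of_nonneg (inv_nonneg.2 (hN0 i))]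
          gcongr
          exact enorm_complexPart_le _ _
      _ = 1 := by
          rw [lintegral_const_mul' _ _ (ENNReal.pow_ne_top ENNReal.ofReal_ne_top),
            lintegral_enorm_pow_eq (simplexExponent_ne_zero _ _) (hmem i), ← mul_pow,
            ← ENNReal.ofReal_mul (inv_nonneg.2 (hN0 i)), inv_mul_cancel₀ (hNpos i).ne',
            ENNReal.ofReal_one, one_pow]
  have hexp : simplexIntegrand F = fun x => ∑ χ : Fin (m + 2) → Bool,
      ((∏ i, (N i : ℂ)) * ∏ i, complexUnit (χ i)) *
        (((∏ i, g χ i (i.removeNth x)) * (1 / ∑ i, x i) : ℝ) : ℂ) := by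
    ext x
    have hF : ∀ i, F i (i.removeNth x) = ∑ b, (N i : ℂ) * complexUnit b *
        (((N i)⁻¹ * complexPart b (F i (i.removeNth x)) : ℝ) : ℂ) := fun i => by
      conv_lhs => rw [← sum_complexUnit_mul_complexPart (F i (i.removeNth x))]
      refine Finset.sum_congr rfl fun b _ => ?_
      have : (N i : ℂ) ≠ 0 := by exact_mod_cast (hNpos i).ne'
      push_cast
      field_simp
    rw [simplexIntegrand, Finset.prod_congr rfl fun i _ => hF i, Finset.prod_univ_sum,
      Fintype.piFinset_univ, Finset.sum_mul]
    refine Finset.sum_congr rfl fun χ _ => ?_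
    simp only [Finset.prod_mul_distrib, hg]
    push_cast
    simp only [Finset.prod_mul_distrib]
    ring
  have hint : ∀ χ : Fin (m + 2) → Bool, IntegrableOn (fun x => ((∏ i, (N i : ℂ)) *
      ∏ i, complexUnit (χ i)) * (((∏ i, g χ i (i.removeNth x)) * (1 / ∑ i, x i) : ℝ) : ℂ))
      (truncationRegion (m + 1) r R) := fun χ =>
    (h _ (hgm χ) (hg1 χ) r R hr hrR).1.ofReal.const_mul _
  rw [truncatedSimplexHilbert, hexp]
  refine ⟨integrable_finsetSum _ fun χ _ => hint χ, ?_⟩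
  rw [integral_finsetSum _ fun χ _ => hint χ]
  calc _ ≤ ∑ χ : Fin (m + 2) → Bool, (∏ i, N i) *
        (C * Real.log (R / r) ^ growthExponent (m + 1)) := by
        refine norm_sum_le_of_le _ fun χ _ => ?_
        rw [integral_const_mul, integral_complex_ofReal, norm_mul, norm_mul, norm_prod, norm_prod,
          Complex.norm_real]
        simp only [norm_complexUnit, Finset.prod_const_one, mul_one, Complex.norm_real,
          Real.norm_of_nonneg (hN0 _)]
        exact mul_le_mul_of_nonneg_left (h _ (hgm χ) (hg1 χ) r R hr hrR).2
          (Finset.prod_nonneg fun i _ => hN0 i)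
    _ = _ := by
        rw [Finset.sum_const, Finset.card_univ, Fintype.card_fun, Fintype.card_bool,
          Fintype.card_fin, nsmul_eq_mul]
        push_cast
        ring

theorem theorem1 (n : ℕ) (hn : 1 ≤ n) :
    ∃ C : ℝ, ∀ (F : Fin (n + 1) → 𝓢(Fin n → ℝ, ℂ)) (r R : ℝ), 0 < r → r < R →
      IntegrableOn (simplexIntegrand F) (truncationRegion n r R) volume ∧
      ‖truncatedSimplexHilbert r R F‖ ≤
        C * (Real.log (R / r)) ^ ((1 : ℝ) - (2 : ℝ) ^ (-(n : ℝ) + 1)) *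
          lpNorm (F 0) (2 ^ n) volume *
          ∏ i : Fin n, lpNorm (F i.succ) (2 ^ (n - (i.succ : ℕ) + 1)) volume := by
  obtain ⟨m, rfl⟩ : ∃ m, n = m + 1 := ⟨n - 1, by omega⟩
  obtain ⟨C, -, h⟩ := exists_norm_truncatedSimplexHilbert_le m
  refine ⟨C, fun F r R hr hrR => ⟨(h F r R hr hrR).1, (h F r R hr hrR).2.trans_eq ?_⟩⟩
  have he : growthExponent (m + 1) = 1 - (2 : ℝ) ^ (-((m + 1 : ℕ) : ℝ) + 1) := by
    rw [growthExponent, show -((m + 1 : ℕ) : ℝ) + 1 = -(m : ℝ) by push_cast; ring,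
      Real.rpow_neg zero_le_two, Real.rpow_natCast, one_div, inv_pow]
  have hs : ∀ i : Fin (m + 1), m + 1 + 1 - max (i.succ : ℕ) 1 = m + 1 - (i.succ : ℕ) + 1 :=
    fun i => by have := i.isLt; simp only [Fin.val_succ]; omega
  rw [Fin.prod_univ_succ, ← mul_assoc, he]
  simp only [simplexExponent, hs, Fin.val_zero, show m + 1 + 1 - max 0 1 = m + 1 by omega]
  push_cast
  rfl
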